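/- Consider a periodic chain of $L$ unit cells with $q$ spin-$\frac12$'s per cell and a translation-invariant Hamiltonian $H=-\sum_{r\in\mathbb Z/L}\sum_{\alpha=1}^m \mathcal O^r_\alpha$, where $\mathcal O^r_\alpha=\prod_{\mu=1}^{P_\alpha}o^r_{\alpha,\mu}$ with $P_\alpha\ge 1$, and $o^r_{\alpha,\mu}$ is $\pm$ a tensor product of Pauli matrices $I,X,Y,Z$ acting on the cell $r+\mu-1$, the same for all $r$. Assume that for all sufficiently large $L$ all the terms commute, the lowest eigenvalue of $H$ is nondegenerate, and the ground state satisfies $\mathcal O^r_\alpha|\mathrm{GS}\rangle=|\mathrm{GS}\rangle$ for all $r,\alpha$. For a cut $c=(\alpha,\tau)$, $1\le\tau\le P_\alpha-1$, and a bond between the cells $r$ and $r+1$, let $\mathcal L_c=\prod_{\mu\le\tau}o^{r-\tau+1}_{\alpha,\mu}$ and $\mathcal R_c=\prod_{\mu>\tau}o^{r-\tau+1}_{\alpha,\mu}$. Let $\mathbf t$ be the matrix over $\mathbb F_2$, indexed by the cuts, whose entry $\mathbf t_{c,d}$ is the number modulo 2 of positions at which the Pauli strings $\mathcal L_c$ and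 $\mathcal L_d$ have different non-identity Pauli matrices, and let $\operatorname{rank}(\mathbf t)$ be its rank over $\mathbb F_2$. For matrices $T^{g}\in M_{D'}(\mathbb C)$, $g\in\{0,1\}^q$, say that $T$ generates the ground state at length $L$ if $\sum_{g^0,\dots,g^{L-1}}\operatorname{Tr}(T^{g^0}\cdots T^{g^{L-1}})|g^0\dots g^{L-1}\rangle$ is a nonzero multiple of $|\mathrm{GS}\rangle$. Call $T$ canonical if $\sum_g T^g(T^g)^\dagger=\sum_g (T^g)^\dagger T^g=1$, and say that $T$ has a canonical form if $T^g=\lambda\, S\breve T^gS^{-1}$ for all $g$, with a scalar $\lambda\neq0$, an invertible $S$ and a canonical $\breve T$. Virtual operators of $T$ are invertible matrices $U_c$ such that, for every $c=(\alpha,\tau)$, $\mathcal L_c\circ(T^{g^1}\cdots T^{g^\tau})=T^{g^1}\cdots T^{g^\tau}\,U_c$ and $\mathcal R_c\circ(T^{g^{1}}\cdots T^{g^{P_\alpha-\tau}})=U_c^{-1}\,T^{g^{1}}\cdots T^{g^{P_\alpha-\tau}}$, where $\circ$ is the action on the physical indices ($X\circ T^g=T^{1-g}$, $Z\circ T^g=(-1)^gT^g$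 for one spin). Then: 1. $\mathbf t$ is antisymmetric with zero diagonal, and $\operatorname{rank}(\mathbf t)$ is even. For every $L\ge\max_\alpha P_\alpha$ and every bond, $\mathcal L_c\mathcal L_d=(-1)^{\mathbf t_{c,d}}\mathcal L_d\mathcal L_c$ and $\mathcal R_c\mathcal R_d=(-1)^{\mathbf t_{c,d}}\mathcal R_d\mathcal R_c$. 2. If $T$ has a canonical form and generates the ground state for all sufficiently large $L$, then its virtual operators exist, are unique, and satisfy $U_cU_d=(-1)^{\mathbf t_{c,d}}U_dU_c$. 3. The relations $U_cU_d=(-1)^{\mathbf t_{c,d}}U_dU_c$ have an irreducible representation by invertible complex matrices of size $D=2^{\operatorname{rank}(\mathbf t)/2}$, and every (finite-dimensional) irreducible representation by invertible complex matrices has this dimension. 4. $D=2^{\operatorname{rank}(\mathbf t)/2}$ is the minimal MPS bond dimension: there are $D\times D$ matrices $T^g$, independent of $L$, that generate the ground state for all sufficiently large $L$; and for every sufficiently large $L$, matrices of size $D'\times D'$ that generate the ground state at length $L$ have $D'\ge D$. 5. If $D\times D$ matrices $T^g$ with $D=2^{\operatorname{rank}(\mathbf t)/2}$ generate the ground state for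 all sufficiently large $L$, then $T$ has a canonical form and its virtual operators act irreducibly on $\mathbb C^{D}$. -/

import Mathlib

open Filter

namespace StabMPS

/-- Configurations of the `q` spins of one unit cell. -/
abbrev Spin (q : ℕ) := Fin q → ZMod 2

/-- A Hermitian Pauli string on one unit cell: `± σ_1 ⊗ ⋯ ⊗ σ_q`, where `σ_i` is `I`, `X`, `Z`, `Y`
according to `(x i, z i) = (0,0), (1,0), (0,1), (1,1)`. -/
structure PauliString (q : ℕ) where
  sign : ℤˣ
  x : Spin q
  z : Spin q

namespace PauliString

variable {q : ℕ}

/-- The identity operator of a unit cell. -/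
def one : PauliString q := ⟨1, 0, 0⟩

/-- The scalar in `p |g⟩ = p.phase g • |g + x⟩` (with `Y = i X Z`). -/
noncomputable def phase (p : PauliString q) (g : Spin q) : ℂ :=
  ((p.sign : ℤ) : ℂ) *
    ∏ i, (Complex.I ^ (p.x i * p.z i).val * (-1) ^ (p.z i * g i).val)

/-- The symplectic form: `0` if the two strings commute, `1` if they anticommute. -/
def symp (p p' : PauliString q) : ZMod 2 :=
  ∑ i, (p.x i * p'.z i + p.z i * p'.x i)

end PauliString

/-- The operator `⊗_{k : κ} p k` acting on families indexed by spin configurations. For `V = ℂ`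
this is the action on the amplitudes of a state of the cells `κ`; for `V` a space of matrices it is
the action `∘` on the physical indices of (products of) MPS matrices. -/
noncomputable def pauliOp {q : ℕ} {κ : Type} [Fintype κ] {V : Type} [AddCommGroup V] [Module ℂ V]
    (p : κ → PauliString q) : Module.End ℂ ((κ → Spin q) → V) where
  toFun F := fun g => (∏ k, (p k).phase (g k + (p k).x)) • F (fun k => g k + (p k).x)
  map_add' F G := by
    funext g
    simp
  map_smul' c F := by
    funext g
    simp only [Pi.smul_apply, RingHom.id_apply]
    exact smul_comm _ _ _

/-- The data of a translation-invariant stabilizer Hamiltonian with `q` spins per unit cell and `m`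
types of interactions. The term of type `α` starting at cell `r` acts on cell `r + μ`, `μ < P α`,
by the Pauli string `o α μ`; the values `o α μ` with `P α ≤ μ` are never used. -/
structure Code (q m : ℕ) where
  P : Fin m → ℕ
  P_pos : ∀ α, 0 < P α
  o : Fin m → ℕ → PauliString q

/-- States of a periodic chain of `L` unit cells. -/
abbrev Hilb (q L : ℕ) := (ZMod L → Spin q) → ℂ

namespace Code

variable {q m : ℕ} (C : Code q m)

/-- The part of the term of type `α` starting at cell `r` made of its factors `a ≤ μ < b`. -/
noncomputable def seg (L : ℕ) [NeZero L] (α : Fin m) (a b : ℕ) (r : ZMod L) :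
    Module.End ℂ (Hilb q L) :=
  pauliOp fun c : ZMod L =>
    if a ≤ (c - r).val ∧ (c - r).val < b then C.o α (c - r).val else PauliString.one

/-- The Hamiltonian term `𝒪^r_α` on the periodic chain. -/
noncomputable def term (L : ℕ) [NeZero L] (α : Fin m) (r : ZMod L) : Module.End ℂ (Hilb q L) :=
  C.seg L α 0 (C.P α) r

/-- The Hamiltonian `H = - ∑_{r,α} 𝒪^r_α`. -/
noncomputable def hamiltonian (L : ℕ) [NeZero L] : Module.End ℂ (Hilb q L) :=
  - ∑ r : ZMod L, ∑ α : Fin m, C.term L α r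

/-- The Hamiltonian terms commute. -/
def Commuting (L : ℕ) [NeZero L] : Prop :=
  ∀ (α β : Fin m) (r s : ZMod L), Commute (C.term L α r) (C.term L β s)

/-- The stabilizer condition for a (not necessarily normalized) ground state. -/
def IsGroundState (L : ℕ) [NeZero L] (ψ : Hilb q L) : Prop :=
  ψ ≠ 0 ∧ ∀ (α : Fin m) (r : ZMod L), C.term L α r ψ = ψ

/-- The lowest eigenvalue of `H` is nondegenerate, and its eigenvectors satisfy the stabilizer
condition. -/
def HasUniqueGroundState (L : ℕ) [NeZero L] : Prop :=
  ∃ E : ℝ, (∀ E' : ℝ, (C.hamiltonian L).HasEigenvalue (E' : ℂ) → E ≤ E') ∧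
    Module.finrank ℂ ((C.hamiltonian L).eigenspace (E : ℂ)) = 1 ∧
    ∀ ψ ∈ (C.hamiltonian L).eigenspace (E : ℂ), ∀ (α : Fin m) (r : ZMod L),
      C.term L α r ψ = ψ

/-- The cuts `(α, τ)`, `1 ≤ τ ≤ P α - 1`, of the Hamiltonian terms. -/
abbrev Cut := Σ α : Fin m, Fin (C.P α - 1)

/-- The position `τ` of a cut. -/
def pos (c : C.Cut) : ℕ := c.2.val + 1

/-- The left part `ℒ^{r-τ+1}_{α,τ}` of a term cut at the bond between the cells `r` and `r + 1`. -/
noncomputable def leftOp (L : ℕ) [NeZero L] (c : C.Cut) (r : ZMod L) : Module.End ℂ (Hilb q L) :=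
  C.seg L c.1 0 (C.pos c) (r - (C.pos c : ZMod L) + 1)

/-- The right part `ℛ^{r-τ+1}_{α,τ}` of a term cut at the bond between the cells `r` and `r + 1`. -/
noncomputable def rightOp (L : ℕ) [NeZero L] (c : C.Cut) (r : ZMod L) : Module.End ℂ (Hilb q L) :=
  C.seg L c.1 (C.pos c) (C.P c.1) (r - (C.pos c : ZMod L) + 1)

/-- The matrix `𝐭` with values modulo 2. In the cell `r - k` the operator `ℒ^{r-τ+1}_{α,τ}` acts by
the factor number `τ - 1 - k` (counted from 0) of the term, if `k < τ`. -/
def tMatrix : Matrix C.Cut C.Cut (ZMod 2) := fun c d =>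
  ∑ k ∈ Finset.range (min (C.pos c) (C.pos d)),
    (C.o c.1 (C.pos c - 1 - k)).symp (C.o d.1 (C.pos d - 1 - k))

end Code

/-- A translation-invariant MPS tensor of bond dimension `D`. -/
abbrev Tensor (q D : ℕ) := Spin q → Matrix (Fin D) (Fin D) ℂ

namespace Tensor

variable {q D : ℕ} (T : Tensor q D)

/-- The product of `n` consecutive MPS matrices. -/
noncomputable def block (n : ℕ) (g : Fin n → Spin q) : Matrix (Fin D) (Fin D) ℂ :=
  (List.ofFn fun k => T (g k)).prod

/-- The periodic matrix product state `∑_g Tr(T^{g^0} ⋯ T^{g^{L-1}}) |g⟩`. -/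
noncomputable def mps (L : ℕ) : Hilb q L := fun g =>
  ((List.range L).map fun n => T (g (n : ZMod L))).prod.trace

/-- `T` generates the periodic ground state for all sufficiently large system sizes. -/
def Generates {m : ℕ} (C : Code q m) : Prop :=
  ∀ᶠ L : ℕ in atTop, ∀ [NeZero L], C.IsGroundState L (T.mps L)

/-- The canonical form of an MPS with flat entanglement spectrum. -/
def IsCanonical : Prop :=
  ∑ g, T g * (T g).conjTranspose = 1 ∧ ∑ g, (T g).conjTranspose * T g = 1

/-- `T` is, up to normalization, related to a canonical MPS by a similarity transformation. -/
def HasCanonicalForm : Prop :=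
  ∃ (c : ℂ) (S : (Matrix (Fin D) (Fin D) ℂ)ˣ) (T' : Tensor q D),
    c ≠ 0 ∧ T'.IsCanonical ∧
      ∀ g, T g = c • ((S : Matrix (Fin D) (Fin D) ℂ) * T' g *
        ((S⁻¹ : (Matrix (Fin D) (Fin D) ℂ)ˣ) : Matrix (Fin D) (Fin D) ℂ))

/-- The `U c` are the virtual operators of `T`: on the physical indices, the left part of a cut
term acts on the MPS matrices as multiplication by `U` from the right, and the right part as
multiplication by `U⁻¹` from the left. -/
def IsVirtual {m : ℕ} (C : Code q m) (U : C.Cut → (Matrix (Fin D) (Fin D) ℂ)ˣ) : Prop :=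
  ∀ c : C.Cut,
    (∀ g, pauliOp (fun k : Fin (C.pos c) => C.o c.1 k) (T.block (C.pos c)) g =
      T.block (C.pos c) g * (U c : Matrix (Fin D) (Fin D) ℂ)) ∧
    (∀ g, pauliOp (fun k : Fin (C.P c.1 - C.pos c) => C.o c.1 (C.pos c + k))
        (T.block (C.P c.1 - C.pos c)) g =
      (((U c)⁻¹ : (Matrix (Fin D) (Fin D) ℂ)ˣ) : Matrix (Fin D) (Fin D) ℂ) *
        T.block (C.P c.1 - C.pos c) g)

end Tensor

/-- The relations `A_i A_j = (-1)^{t_ij} A_j A_i` of the generalized Clifford algebra of `t`. -/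
def CliffordRel {ι R : Type} [Ring R] (t : Matrix ι ι (ZMod 2)) (A : ι → R) : Prop :=
  ∀ i j, A i * A j = (-1) ^ (t i j).val * (A j * A i)

/-- A `D`-dimensional representation, by invertible matrices, of the generalized Clifford algebra
of `t`. -/
def IsCliffordRep {ι : Type} {D : ℕ} (t : Matrix ι ι (ZMod 2))
    (U : ι → (Matrix (Fin D) (Fin D) ℂ)ˣ) : Prop :=
  CliffordRel t fun i => (U i : Matrix (Fin D) (Fin D) ℂ)

/-- The matrices `U i` act irreducibly on `ℂ^D`. -/
def IsIrreducible {ι : Type} {D : ℕ} (U : ι → (Matrix (Fin D) (Fin D) ℂ)ˣ) : Prop :=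
  0 < D ∧ ∀ W : Submodule ℂ (Fin D → ℂ),
    (∀ i, ∀ w ∈ W, (U i : Matrix (Fin D) (Fin D) ℂ).mulVec w ∈ W) → W = ⊥ ∨ W = ⊤

end StabMPS

/-!
Conjugation by the cut operators grades the algebra they generate: the product with exponents `v`
has degree `𝐭 v`, and components of different degrees are independent. Hence a representation of the
relations of `𝐭` generates an algebra of dimension at least `2 ^ rank 𝐭`. In an irreducible
representation the components are moreover one-dimensional, so that `D ^ 2 = 2 ^ rank 𝐭`.

The left parts of the terms cut at the right end of an interval and the right parts of those cut at
its left end both preserve the Schmidt space of the ground state on the interval, and they commute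
with each other. So the Schmidt rank is at least `2 ^ rank 𝐭`, while it is at most `D' ^ 2` for an
MPS of bond dimension `D'`. For an MPS of bond dimension `2 ^ (rank 𝐭 / 2)` the products of
consecutive matrices therefore span all matrices.

Conversely, an irreducible summand `U` of the action of the cut operators on the ground state at one
length gives a family of matrices `Φ n`, indexed by configurations of `n` cells, on which the cut
operators act as the virtual operators `U` at the two ends. The trace of `Φ n Φ (n + 1)` and that of
`Φ (n + 1) Φ n` are both ground states, so uniqueness makes the two concatenations proportional, and
the MPS tensor is the quotient of `Φ (n + 1)` by `Φ n`.

For the canonical form, the relations satisfied by the blocks of the tensor make their Gram matrices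
intertwine `U` with `(U⁻¹)ᴴ`. By Schur's lemma they are multiples of `Q` or of `Q⁻¹` for one
positive matrix `Q = S Sᴴ`, and conjugation by `S` makes the tensor canonical up to a scalar. In the
other direction, a subspace of matrices invariant under left multiplication by a canonical tensor is
invariant under its adjoints, so the trace pairing detects the span of the blocks and the stabilizer
conditions on the ring hold already for the blocks.
-/

namespace StabMPS

section Sign

variable (K : Type*) [CommRing K]

/-- The character `a ↦ (-1) ^ a` of `ZMod 2`. -/
def sgn : AddChar (ZMod 2) K := AddChar.zmodChar 2 (ζ := -1) (by norm_num)

theorem sgn_apply (a : ZMod 2) : sgn K a = (-1) ^ a.val := rfl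

theorem sgn_one : sgn K 1 = -1 := by rw [sgn_apply, ZMod.val_one, pow_one]

theorem sgn_mul_self (a : ZMod 2) : sgn K a * sgn K a = 1 := by
  rw [← AddChar.map_add_eq_mul, CharTwo.add_self_eq_zero, AddChar.map_zero_eq_one]

theorem sgn_sum {ι : Type*} (s : Finset ι) (f : ι → ZMod 2) :
    sgn K (∑ i ∈ s, f i) = ∏ i ∈ s, sgn K (f i) :=
  map_prod (sgn K).toMonoidHom (fun i => Multiplicative.ofAdd (f i)) s

theorem zmod_two_eq_zero_or_one (a : ZMod 2) : a = 0 ∨ a = 1 := by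
  revert a
  decide

theorem sgn_injective {K : Type*} [Field K] [NeZero (2 : K)] :
    Function.Injective (sgn K) := by
  have h : (-1 : K) ≠ 1 := fun h => two_ne_zero (by linear_combination -h : (2 : K) = 0)
  intro a b hab
  rcases zmod_two_eq_zero_or_one a with rfl | rfl <;>
    rcases zmod_two_eq_zero_or_one b with rfl | rfl <;>
    simp_all [sgn_one, h.symm]

theorem cliffordRel_iff {ι R : Type} [Ring R] [Algebra K R] (t : Matrix ι ι (ZMod 2))
    (A : ι → R) : CliffordRel t A ↔ ∀ i j, A i * A j = sgn K (t i j) • (A j * A i) := by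
  simp only [CliffordRel, sgn_apply, Algebra.smul_def, map_pow, map_neg, map_one]

end Sign

section Homogeneous

variable {K : Type*} {ι R : Type} [Field K] [Ring R] [Algebra K R]

variable (K) in
/-- The homogeneous component of degree `χ` of an algebra with a family of elements `A`: the common
eigenspace of the conjugations by the `A i`, with eigenvalues `(-1) ^ χ i`. -/
def homog (A : ι → R) (χ : ι → ZMod 2) : Submodule K R where
  carrier := {X | ∀ i, A i * X = sgn K (χ i) • (X * A i)}
  add_mem' hx hy i := by rw [mul_add, hx i, hy i, add_mul, smul_add]
  zero_mem' i := by simp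
  smul_mem' c x hx i := by rw [mul_smul_comm, hx i, smul_mul_assoc, smul_comm]

theorem mem_homog_zero {A : ι → R} {X : R} : X ∈ homog K A 0 ↔ ∀ i, Commute (A i) X := by
  refine forall_congr' fun i => ?_
  rw [Pi.zero_apply, AddChar.map_zero_eq_one, one_smul]
  rfl

theorem one_mem_homog (A : ι → R) : (1 : R) ∈ homog K A 0 :=
  mem_homog_zero.2 fun _ => Commute.one_right _

theorem mul_mem_homog {A : ι → R} {χ χ' : ι → ZMod 2} {X Y : R} (hX : X ∈ homog K A χ)
    (hY : Y ∈ homog K A χ') : X * Y ∈ homog K A (χ + χ') := by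
  intro i
  rw [← mul_assoc, hX i, smul_mul_assoc, mul_assoc, hY i, mul_smul_comm, smul_smul, Pi.add_apply,
    AddChar.map_add_eq_mul, mul_assoc]

theorem inv_mem_homog {A : ι → R} {χ : ι → ZMod 2} {X : Rˣ} (hX : (X : R) ∈ homog K A χ) :
    (↑X⁻¹ : R) ∈ homog K A χ := by
  intro i
  have hconj : (↑X⁻¹ : R) * (A i * X) * ↑X⁻¹ = ↑X⁻¹ * (sgn K (χ i) • (X * A i)) * ↑X⁻¹ := by
    rw [hX i]
  have hinv : (↑X⁻¹ : R) * A i = sgn K (χ i) • (A i * ↑X⁻¹) := by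
    simpa [mul_assoc] using hconj
  rw [hinv, smul_smul, sgn_mul_self, one_smul]

theorem CliffordRel.mem_homog {t : Matrix ι ι (ZMod 2)} {A : ι → R} (h : CliffordRel t A) (j : ι) :
    A j ∈ homog K A (t.col j) := fun i => (cliffordRel_iff K t A).1 h i j

variable (K) in
theorem CliffordRel.exists_unit_mem_homog [Fintype ι] {t : Matrix ι ι (ZMod 2)} {A : ι → R}
    (h : CliffordRel t A) (hA : ∀ i, IsUnit (A i)) {χ : ι → ZMod 2}
    (hχ : χ ∈ LinearMap.range t.mulVecLin) : ∃ X : Rˣ, (X : R) ∈ homog K A χ := by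
  rw [Matrix.range_mulVecLin] at hχ
  induction hχ using Submodule.span_induction with
  | mem _ hx =>
    obtain ⟨j, rfl⟩ := hx
    exact ⟨(hA j).unit, h.mem_homog j⟩
  | zero => exact ⟨1, one_mem_homog A⟩
  | add _ _ _ _ hX hY =>
    obtain ⟨⟨X, hX⟩, ⟨Y, hY⟩⟩ := And.intro hX hY
    exact ⟨X * Y, mul_mem_homog hX hY⟩
  | smul a χ _ hX =>
    rcases zmod_two_eq_zero_or_one a with rfl | rfl
    · exact ⟨1, by rw [zero_smul]; exact one_mem_homog A⟩
    · rwa [one_smul]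

theorem commute_conj_of_eq_or_eq_neg {u v : Rˣ}
    (h : (u : R) * v = v * u ∨ (u : R) * v = -(v * u)) :
    Commute (DistribSMul.toLinearMap K R (ConjAct.toConjAct u))
      (DistribSMul.toLinearMap K R (ConjAct.toConjAct v)) := by
  refine LinearMap.ext fun x => ?_
  change ConjAct.toConjAct u • ConjAct.toConjAct v • x =
    ConjAct.toConjAct v • ConjAct.toConjAct u • x
  have huv : u * v = v * u ∨ u * v = -(v * u) := h.imp Units.ext Units.ext
  rw [smul_smul, smul_smul, ← map_mul, ← map_mul]
  rcases huv with huv | huv <;> simp [huv, ConjAct.units_smul_def]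

theorem CliffordRel.eq_or_eq_neg {t : Matrix ι ι (ZMod 2)} {A : ι → R} (h : CliffordRel t A)
    (i j : ι) : A i * A j = A j * A i ∨ A i * A j = -(A j * A i) := by
  have hij := h i j
  rcases zmod_two_eq_zero_or_one (t i j) with ht | ht
  · exact Or.inl (by simpa [ht] using hij)
  · exact Or.inr (by simpa [ht, ZMod.val_one] using hij)

theorem CliffordRel.iSupIndep_homog [NeZero (2 : K)] {t : Matrix ι ι (ZMod 2)} {A : ι → R}
    (h : CliffordRel t A) (hA : ∀ i, IsUnit (A i)) : iSupIndep (homog K A) := by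
  choose u hu using hA
  let conj (i : ι) : Module.End K R := DistribSMul.toLinearMap K R (ConjAct.toConjAct (u i))
  have hcomm (i j : ι) : Commute (conj i) (conj j) :=
    commute_conj_of_eq_or_eq_neg (by simpa only [hu] using h.eq_or_eq_neg i j)
  have hind := Module.End.independent_iInf_maxGenEigenspace_of_forall_mapsTo conj
    fun i j φ => Module.End.mapsTo_maxGenEigenspace_of_comm (hcomm j i) φ
  have hinj : Function.Injective fun (χ : ι → ZMod 2) (i : ι) => sgn K (χ i) := fun χ χ' hχ =>
    funext fun i => sgn_injective (congrFun hχ i)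
  refine (hind.comp hinj).mono fun χ X hX => (Submodule.mem_iInf _).2 fun i => ?_
  refine (conj i).genEigenspace (sgn K (χ i)) |>.mono (le_top (a := (1 : ℕ∞))) ?_
  change X ∈ (conj i).eigenspace (sgn K (χ i))
  rw [Module.End.mem_eigenspace_iff]
  change (u i : R) * X * ↑(u i)⁻¹ = sgn K (χ i) • X
  rw [hu, hX i, ← hu, smul_mul_assoc, mul_assoc, Units.mul_inv, mul_one]

theorem CliffordRel.exists_linearIndependent_homog [Fintype ι] [NeZero (2 : K)] [Nontrivial R]
    {t : Matrix ι ι (ZMod 2)} {A : ι → R} (h : CliffordRel t A) (hA : ∀ i, IsUnit (A i)) :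
    ∃ X : LinearMap.range t.mulVecLin → Rˣ,
      (∀ χ : LinearMap.range t.mulVecLin, (X χ : R) ∈ homog K A χ) ∧
        LinearIndependent K fun χ => (X χ : R) := by
  choose X hX using fun χ : LinearMap.range t.mulVecLin => h.exists_unit_mem_homog K hA χ.2
  exact ⟨X, hX, ((h.iSupIndep_homog hA).comp Subtype.val_injective).linearIndependent _ hX
    fun χ => (X χ).ne_zero⟩

theorem card_range_mulVecLin [Fintype ι] (t : Matrix ι ι (ZMod 2)) :
    Nat.card (LinearMap.range t.mulVecLin) = 2 ^ t.rank := by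
  rw [Module.natCard_eq_pow_finrank (K := ZMod 2), Nat.card_eq_fintype_card, ZMod.card]
  rfl

variable (K) in
theorem CliffordRel.two_pow_rank_le_finrank [Fintype ι] [NeZero (2 : K)] [Nontrivial R]
    [FiniteDimensional K R] {t : Matrix ι ι (ZMod 2)} {A : ι → R} (h : CliffordRel t A)
    (hA : ∀ i, IsUnit (A i)) : 2 ^ t.rank ≤ Module.finrank K R := by
  classical
  obtain ⟨X, -, hX⟩ := h.exists_linearIndependent_homog (K := K) hA
  rw [← card_range_mulVecLin, Nat.card_eq_fintype_card]
  exact hX.fintype_card_le_finrank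

theorem exists_eq_smul_one_of_commute [Algebra.IsCentral K R] {A : ι → R}
    (hgen : Algebra.adjoin K (Set.range A) = ⊤) {x : R} (hx : ∀ i, Commute (A i) x) :
    ∃ c : K, x = c • 1 := by
  have hcenter : x ∈ Subalgebra.center K R := by
    refine Subalgebra.mem_center_iff.2 fun a => ?_
    have ha : a ∈ Algebra.adjoin K (Set.range A) := hgen ▸ Algebra.mem_top
    refine (Subalgebra.mem_centralizer_iff K).1 (Algebra.adjoin_le_centralizer_centralizer K _ ha) x
      ((Subalgebra.mem_centralizer_iff K).2 ?_) |>.symm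
    rintro _ ⟨i, rfl⟩
    exact hx i
  obtain ⟨c, hc⟩ := (Algebra.IsCentral.mem_center_iff K).1 hcenter
  exact ⟨c, hc.trans (Algebra.algebraMap_eq_smul_one c)⟩

theorem exists_eq_smul_of_semiconjBy [Algebra.IsCentral K R] {A B : ι → R}
    (hgen : Algebra.adjoin K (Set.range A) = ⊤) {Q : Rˣ} {X : R}
    (hQ : ∀ i, SemiconjBy Q.val (B i) (A i)) (hX : ∀ i, SemiconjBy X (B i) (A i)) :
    ∃ c : K, X = c • Q.val := by
  have hcomm i : Commute (X * Q⁻¹.val) (A i) := (hX i).mul_left (hQ i).units_inv_symm_left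
  obtain ⟨c, hc⟩ := exists_eq_smul_one_of_commute hgen fun i => (hcomm i).symm
  exact ⟨c, by rw [← Q.inv_mul_cancel_right X, hc, smul_mul_assoc, one_mul]⟩

theorem exists_eq_smul_inv_of_semiconjBy [Algebra.IsCentral K R] {A B : ι → R}
    (hgen : Algebra.adjoin K (Set.range A) = ⊤) {Q : Rˣ}
    {X : R} (hQ : ∀ i, SemiconjBy Q.val (B i) (A i)) (hX : ∀ i, SemiconjBy X (A i) (B i)) :
    ∃ c : K, X = c • Q⁻¹.val := by
  have hcomm i : Commute (Q.val * X) (A i) := (hQ i).mul_left (hX i)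
  obtain ⟨c, hc⟩ := exists_eq_smul_one_of_commute hgen fun i => (hcomm i).symm
  exact ⟨c, by rw [← Q.inv_mul_cancel_left X, hc, mul_smul_comm, mul_one]⟩

theorem exists_eq_smul_of_mem_homog [Algebra.IsCentral K R] {A : ι → R}
    (hgen : Algebra.adjoin K (Set.range A) = ⊤) {χ : ι → ZMod 2} {X : Rˣ} {Y : R}
    (hX : (X : R) ∈ homog K A χ) (hY : Y ∈ homog K A χ) : ∃ c : K, Y = c • (X : R) := by
  have hXY := mul_mem_homog (inv_mem_homog hX) hY
  rw [ZModModule.add_self] at hXY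
  obtain ⟨c, hc⟩ := exists_eq_smul_one_of_commute hgen (mem_homog_zero.1 hXY)
  exact ⟨c, by rw [← X.mul_inv_cancel_left Y, hc, mul_smul_comm, mul_one]⟩

theorem CliffordRel.exists_mem_homog_of_mem_closure [Fintype ι] {t : Matrix ι ι (ZMod 2)}
    {A : ι → R} (h : CliffordRel t A) {x : R} (hx : x ∈ Submonoid.closure (Set.range A)) :
    ∃ χ ∈ LinearMap.range t.mulVecLin, x ∈ homog K A χ := by
  rw [Matrix.range_mulVecLin]
  induction hx using Submonoid.closure_induction with
  | mem _ hx =>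
    obtain ⟨i, rfl⟩ := hx
    exact ⟨t.col i, Submodule.subset_span ⟨i, rfl⟩, h.mem_homog i⟩
  | one => exact ⟨0, zero_mem _, one_mem_homog A⟩
  | mul _ _ _ _ hx hy =>
    obtain ⟨⟨χ, hχ, hx⟩, ⟨χ', hχ', hy⟩⟩ := And.intro hx hy
    exact ⟨χ + χ', add_mem hχ hχ', mul_mem_homog hx hy⟩

theorem CliffordRel.finrank_eq_two_pow_rank [Fintype ι] [NeZero (2 : K)] [Nontrivial R]
    [FiniteDimensional K R] [Algebra.IsCentral K R] {t : Matrix ι ι (ZMod 2)} {A : ι → R}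
    (h : CliffordRel t A) (hA : ∀ i, IsUnit (A i)) (hgen : Algebra.adjoin K (Set.range A) = ⊤) :
    Module.finrank K R = 2 ^ t.rank := by
  classical
  refine le_antisymm ?_ (h.two_pow_rank_le_finrank K hA)
  obtain ⟨X, hX, -⟩ := h.exists_linearIndependent_homog (K := K) hA
  have hspan : Submodule.span K (Set.range fun χ => (X χ : R)) = ⊤ := by
    rw [eq_top_iff, ← Algebra.top_toSubmodule, ← hgen, Algebra.adjoin_eq_span, Submodule.span_le]
    intro x hx
    obtain ⟨χ, hχ, hxχ⟩ := h.exists_mem_homog_of_mem_closure (K := K) hx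
    obtain ⟨c, rfl⟩ := exists_eq_smul_of_mem_homog hgen (hX ⟨χ, hχ⟩) hxχ
    exact Submodule.smul_mem _ _ (Submodule.subset_span ⟨_, rfl⟩)
  have hcard := finrank_range_le_card (R := K) fun χ => (X χ : R)
  rw [Set.finrank, hspan, finrank_top] at hcard
  rwa [← card_range_mulVecLin, Nat.card_eq_fintype_card]

end Homogeneous

section Irreducible

variable {ι : Type}

theorem subalgebra_eq_top_of_irreducible {K V : Type*} [Field K] [IsAlgClosed K] [AddCommGroup V]
    [Module K V] [FiniteDimensional K V] [Nontrivial V] (𝒜 : Subalgebra K (Module.End K V))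
    (h : ∀ W : Submodule K V, (∀ a ∈ 𝒜, ∀ w ∈ W, a w ∈ W) → W = ⊥ ∨ W = ⊤) : 𝒜 = ⊤ := by
  have hsimple : IsSimpleModule 𝒜 V := by
    rw [isSimpleModule_iff]
    refine { exists_pair_ne := ⟨⊥, ⊤, bot_ne_top⟩, eq_bot_or_eq_top := fun W => ?_ }
    simpa using h (W.restrictScalars K) fun a ha w hw => W.smul_mem (⟨a, ha⟩ : 𝒜) hw
  have hschur := IsSimpleModule.algebraMap_end_bijective_of_isAlgClosed (A := 𝒜) (V := V) K
  refine eq_top_iff.2 fun f _ => ?_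
  let F : Module.End (Module.End 𝒜 V) V :=
    { toFun := f
      map_add' := f.map_add
      map_smul' := fun φ v => by
        obtain ⟨c, rfl⟩ := hschur.2 φ
        simp }
  have hfinite : Module.Finite (Module.End 𝒜 V) V := .of_restrictScalars_finite K _ _
  obtain ⟨⟨a, ha⟩, haF⟩ := Module.Finite.toModuleEnd_moduleEnd_surjective (R := 𝒜) F
  have haf : a = f := LinearMap.ext fun v => congrArg (fun G => G v) haF
  exact haf ▸ ha

theorem IsIrreducible.adjoin_eq_top {D : ℕ} {U : ι → (Matrix (Fin D) (Fin D) ℂ)ˣ}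
    (h : IsIrreducible U) :
    Algebra.adjoin ℂ (Set.range fun i => (U i : Matrix (Fin D) (Fin D) ℂ)) = ⊤ := by
  have : Nonempty (Fin D) := ⟨⟨0, h.1⟩⟩
  let 𝒜 := Algebra.adjoin ℂ (Set.range fun i => (U i : Matrix (Fin D) (Fin D) ℂ))
  let e : Matrix (Fin D) (Fin D) ℂ ≃ₐ[ℂ] Module.End ℂ (Fin D → ℂ) := Matrix.toLinAlgEquiv'
  have htop : 𝒜.map e.toAlgHom = ⊤ :=
    subalgebra_eq_top_of_irreducible _ fun W hW => h.2 W fun i =>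
      hW (e (U i)) (Subalgebra.mem_map.2 ⟨_, Algebra.subset_adjoin ⟨i, rfl⟩, rfl⟩)
  refine Subalgebra.map_injective (f := e.toAlgHom) e.injective (htop.trans ?_)
  rw [Algebra.map_top, (AlgHom.range_eq_top _).2 e.surjective]

theorem IsIrreducible.sq_eq_two_pow_rank [Fintype ι] {D : ℕ} {t : Matrix ι ι (ZMod 2)}
    {U : ι → (Matrix (Fin D) (Fin D) ℂ)ˣ} (h : IsIrreducible U) (hU : IsCliffordRep t U) :
    D ^ 2 = 2 ^ t.rank := by
  have : Nonempty (Fin D) := ⟨⟨0, h.1⟩⟩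
  rw [← CliffordRel.finrank_eq_two_pow_rank hU (fun i => (U i).isUnit) h.adjoin_eq_top,
    Module.finrank_matrix]
  simp [sq]

theorem even_and_eq_of_sq_eq_two_pow {D r : ℕ} (h : D ^ 2 = 2 ^ r) : Even r ∧ D = 2 ^ (r / 2) := by
  obtain ⟨k, -, rfl⟩ := (Nat.dvd_prime_pow Nat.prime_two).1 (h ▸ dvd_pow_self D two_ne_zero)
  obtain rfl : k * 2 = r := Nat.pow_right_injective le_rfl (by simpa [pow_mul] using h)
  simp

theorem CliffordRel.map {R S F : Type} [Ring R] [Ring S] [FunLike F R S] [RingHomClass F R S]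
    {t : Matrix ι ι (ZMod 2)} {A : ι → R} (h : CliffordRel t A) (f : F) :
    CliffordRel t fun i => f (A i) := fun i j => by
  simpa only [map_mul, map_pow, map_neg, map_one] using congrArg f (h i j)

theorem CliffordRel.restrict {K V : Type} [Field K] [AddCommGroup V] [Module K V]
    {t : Matrix ι ι (ZMod 2)} {A : ι → Module.End K V} (h : CliffordRel t A) {W : Submodule K V}
    (hW : ∀ i, ∀ w ∈ W, A i w ∈ W) : CliffordRel t fun i => (A i).restrict (hW i) :=
  (cliffordRel_iff K _ _).2 fun i j => LinearMap.ext fun w => Subtype.ext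
    (LinearMap.congr_fun ((cliffordRel_iff K _ _).1 h i j) (w : V))

/-- The restriction of the representation to an invariant subspace `W` again satisfies the
relations, so that `2 ^ rank t ≤ (dim W) ^ 2`. -/
theorem IsCliffordRep.isIrreducible [Fintype ι] {D : ℕ} {t : Matrix ι ι (ZMod 2)}
    {U : ι → (Matrix (Fin D) (Fin D) ℂ)ˣ} (hU : IsCliffordRep t U) (hD : D ^ 2 = 2 ^ t.rank) :
    IsIrreducible U := by
  refine ⟨Nat.pos_of_ne_zero fun h0 => absurd hD.symm (by simp [h0]), fun W hW =>
    or_iff_not_imp_left.2 fun hne => ?_⟩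
  have : Nontrivial W := Submodule.nontrivial_iff_ne_bot.2 hne
  have hrel := (CliffordRel.map hU Matrix.toLinAlgEquiv').restrict (W := W) hW
  have hunit (i : ι) : IsUnit ((Matrix.toLinAlgEquiv' (U i).val).restrict (hW i)) := by
    refine (LinearMap.isUnit_iff_ker_eq_bot _).2 (LinearMap.ker_eq_bot.2 fun w w' hww' => ?_)
    exact Subtype.ext (Matrix.mulVec_injective_of_isUnit (U i).isUnit (congrArg Subtype.val hww'))
  have hdim : D ^ 2 ≤ Module.finrank ℂ W ^ 2 := by
    rw [hD, sq, ← Module.finrank_linearMap]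
    exact hrel.two_pow_rank_le_finrank ℂ hunit
  refine Submodule.eq_top_of_finrank_eq (le_antisymm (Submodule.finrank_le _) ?_)
  simpa using (Nat.pow_le_pow_iff_left two_ne_zero).1 hdim

theorem exists_matrix_rep_of_involutions {V : Type*} [AddCommGroup V] [Module ℂ V]
    {A : ι → Module.End ℂ V} (hA : ∀ i, A i * A i = 1) (W : Submodule ℂ V)
    [FiniteDimensional ℂ W] (hW : ∀ i, ∀ w ∈ W, A i w ∈ W) :
    ∃ (D : ℕ) (U : ι → (Matrix (Fin D) (Fin D) ℂ)ˣ) (j : (Fin D → ℂ) →ₗ[ℂ] V),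
      (∀ i, (U i : Matrix (Fin D) (Fin D) ℂ) * U i = 1) ∧ Function.Injective j ∧
      LinearMap.range j = W ∧
      ∀ i v, A i (j v) = j ((U i : Matrix (Fin D) (Fin D) ℂ).mulVec v) := by
  let b := (Module.finBasis ℂ W).equivFun
  let j : (Fin (Module.finrank ℂ W) → ℂ) →ₗ[ℂ] V := W.subtype ∘ₗ b.symm.toLinearMap
  have hj : Function.Injective j := W.injective_subtype.comp b.symm.injective
  let M (i : ι) : Matrix (Fin _) (Fin _) ℂ :=
    LinearMap.toMatrix' (b.toLinearMap ∘ₗ (A i).restrict (hW i) ∘ₗ b.symm.toLinearMap)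
  have hM (i : ι) (v) : A i (j v) = j ((M i).mulVec v) := by
    rw [← Matrix.toLin'_apply, Matrix.toLin'_toMatrix']
    simp [j]
  have hMM (i : ι) : M i * M i = 1 := by
    refine Matrix.ext_of_mulVec_single fun k => hj ?_
    rw [← Matrix.mulVec_mulVec, ← hM, ← hM, ← Module.End.mul_apply, hA, Matrix.one_mulVec,
      Module.End.one_apply]
  refine ⟨_, fun i => ⟨M i, M i, hMM i, hMM i⟩, j, hMM, hj, ?_, hM⟩
  rw [LinearMap.range_comp_of_range_eq_top _ b.symm.range, Submodule.range_subtype]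

theorem exists_irreducible_rep_of_involutions {V : Type*} [AddCommGroup V] [Module ℂ V]
    [FiniteDimensional ℂ V] {A : ι → Module.End ℂ V} (hA : ∀ i, A i * A i = 1)
    {W : Submodule ℂ V} (hne : W ≠ ⊥) (hW : ∀ i, ∀ w ∈ W, A i w ∈ W) :
    ∃ (D : ℕ) (U : ι → (Matrix (Fin D) (Fin D) ℂ)ˣ) (j : (Fin D → ℂ) →ₗ[ℂ] V),
      IsIrreducible U ∧ (∀ i, (U i : Matrix (Fin D) (Fin D) ℂ) * U i = 1) ∧
      Function.Injective j ∧ (∀ v, j v ∈ W) ∧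
      ∀ i v, A i (j v) = j ((U i : Matrix (Fin D) (Fin D) ℂ).mulVec v) := by
  obtain ⟨K, ⟨⟨hK0, hKW, hKinv⟩, hKmin⟩⟩ := exists_minimal_of_wellFoundedLT
    (fun K : Submodule ℂ V => K ≠ ⊥ ∧ K ≤ W ∧ ∀ i, ∀ w ∈ K, A i w ∈ K) ⟨W, hne, le_rfl, hW⟩
  obtain ⟨D, U, j, hUU, hj, hjK, hjU⟩ := exists_matrix_rep_of_involutions hA K hKinv
  refine ⟨D, U, j, ⟨?_, fun W' hW' => or_iff_not_imp_left.2 fun hne' => ?_⟩, hUU, hj,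
    fun v => hKW (hjK ▸ j.mem_range_self v), hjU⟩
  · refine Nat.pos_of_ne_zero fun hD => hK0 ?_
    subst hD
    rw [← hjK, LinearMap.range_eq_bot]
    exact Subsingleton.elim _ _
  · have hle : W'.map j ≤ K := hjK ▸ LinearMap.map_le_range
    have hmap_inv : ∀ i, ∀ w ∈ W'.map j, A i w ∈ W'.map j := by
      rintro i _ ⟨v, hv, rfl⟩
      exact ⟨_, hW' i v hv, (hjU i v).symm⟩
    have hmap_ne : W'.map j ≠ ⊥ := fun h => hne' <|
      Submodule.map_injective_of_injective hj (h.trans (Submodule.map_bot j).symm)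
    have hKle : K ≤ W'.map j := hKmin ⟨hmap_ne, hle.trans hKW, hmap_inv⟩ hle
    refine Submodule.map_injective_of_injective hj ((le_antisymm hle hKle).trans ?_)
    rw [Submodule.map_top, hjK]

theorem two_pow_rank_mul_self_le [Fintype ι] (t : Matrix ι ι (ZMod 2)) :
    2 ^ t.rank * 2 ^ t.rank ≤ 2 ^ (Matrix.fromBlocks t 0 0 t).rank := by
  rw [← card_range_mulVecLin, ← card_range_mulVecLin, ← Nat.card_prod]
  have hmem : ∀ x : LinearMap.range t.mulVecLin × LinearMap.range t.mulVecLin,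
      Sum.elim (x.1 : ι → ZMod 2) (x.2 : ι → ZMod 2) ∈
        LinearMap.range (Matrix.fromBlocks t 0 0 t).mulVecLin := by
    rintro ⟨⟨_, v, rfl⟩, ⟨_, w, rfl⟩⟩
    exact ⟨Sum.elim v w, by simp [Matrix.fromBlocks_mulVec]⟩
  refine Nat.card_le_card_of_injective (fun x => (⟨_, hmem x⟩ :
    LinearMap.range (Matrix.fromBlocks t 0 0 t).mulVecLin)) fun x y hxy => ?_
  have h := congrArg Subtype.val hxy
  exact Prod.ext (Subtype.ext (funext fun i => congrFun h (Sum.inl i)))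
    (Subtype.ext (funext fun i => congrFun h (Sum.inr i)))

theorem CliffordRel.sumElim {κ R : Type} [Ring R] {t : Matrix ι ι (ZMod 2)}
    {t' : Matrix κ κ (ZMod 2)} {X : ι → R} {Y : κ → R} (hX : CliffordRel t X)
    (hY : CliffordRel t' Y) (hXY : ∀ i j, Commute (X i) (Y j)) :
    CliffordRel (Matrix.fromBlocks t 0 0 t') (Sum.elim X Y) := by
  rintro (i | i) (j | j)
  · exact hX i j
  · simpa using (hXY i j).eq
  · simpa using (hXY j i).eq.symm
  · exact hY i j

/-- The operators `X i`, `Y j` together satisfy relations of rank `2 * rank t` in an algebra of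
dimension `(dim V) ^ 2`. -/
theorem two_pow_rank_le_finrank_of_commute [Fintype ι] {K V : Type} [Field K] [NeZero (2 : K)]
    [AddCommGroup V] [Module K V] [FiniteDimensional K V] [Nontrivial V]
    {t : Matrix ι ι (ZMod 2)} {X Y : ι → Module.End K V} (hX : CliffordRel t X)
    (hY : CliffordRel t Y) (hXY : ∀ i j, Commute (X i) (Y j)) (hXunit : ∀ i, IsUnit (X i))
    (hYunit : ∀ i, IsUnit (Y i)) : 2 ^ t.rank ≤ Module.finrank K V := by
  have hle := (hX.sumElim hY hXY).two_pow_rank_le_finrank K (Sum.rec hXunit hYunit)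
  rw [Module.finrank_linearMap] at hle
  exact Nat.mul_self_le_mul_self_iff.1 ((two_pow_rank_mul_self_le t).trans hle)

end Irreducible

theorem zmod_two_add_add_self {G : Type*} [AddCommGroup G] [Module (ZMod 2) G] (x y : G) :
    x + y + y = x := by
  rw [add_assoc, ZModModule.add_self, add_zero]

namespace PauliString

variable {q : ℕ}

theorem symp_eq_dotProduct (p p' : PauliString q) : p.symp p' = p.x ⬝ᵥ p'.z + p.z ⬝ᵥ p'.x :=
  Finset.sum_add_distrib

theorem symp_one_left (p : PauliString q) : one.symp p = 0 := by simp [symp, one]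

theorem symp_one_right (p : PauliString q) : p.symp one = 0 := by simp [symp, one]

theorem symp_comm (p p' : PauliString q) : p.symp p' = p'.symp p :=
  Finset.sum_congr rfl fun i _ => by ring

theorem symp_self (p : PauliString q) : p.symp p = 0 := by
  rw [symp_eq_dotProduct, dotProduct_comm, CharTwo.add_self_eq_zero]

theorem phase_eq (p : PauliString q) (g : Spin q) :
    p.phase g = ((p.sign : ℤ) : ℂ) * (∏ i, Complex.I ^ (p.x i * p.z i).val) *
      sgn ℂ (p.z ⬝ᵥ g) := by
  rw [phase, Finset.prod_mul_distrib, dotProduct, sgn_sum, mul_assoc]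
  rfl

theorem phase_one (g : Spin q) : (one : PauliString q).phase g = 1 := by
  simp [phase, one]

theorem one_x : (one : PauliString q).x = 0 := rfl

theorem sign_mul_self (p : PauliString q) : ((p.sign : ℤ) : ℂ) * ((p.sign : ℤ) : ℂ) = 1 := by
  rw [← Int.cast_mul, ← Units.val_mul, Int.units_mul_self, Units.val_one, Int.cast_one]

theorem prod_I_pow_mul_self (p : PauliString q) :
    (∏ i, Complex.I ^ (p.x i * p.z i).val) * (∏ i, Complex.I ^ (p.x i * p.z i).val) =
      sgn ℂ (p.z ⬝ᵥ p.x) := by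
  rw [dotProduct, sgn_sum, ← Finset.prod_mul_distrib]
  refine Finset.prod_congr rfl fun i _ => ?_
  rw [sgn_apply, ← mul_pow, Complex.I_mul_I, mul_comm (p.z i)]

theorem phase_mul_phase (p : PauliString q) (g : Spin q) :
    p.phase (g + p.x) * p.phase g = 1 := by
  rw [phase_eq, phase_eq, dotProduct_add, AddChar.map_add_eq_mul, ← p.prod_I_pow_mul_self]
  have hx := p.prod_I_pow_mul_self.symm ▸ sgn_mul_self ℂ (p.z ⬝ᵥ p.x)
  linear_combination sgn ℂ (p.z ⬝ᵥ g) * sgn ℂ (p.z ⬝ᵥ g) *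
    ((∏ i, Complex.I ^ (p.x i * p.z i).val) * (∏ i, Complex.I ^ (p.x i * p.z i).val)) ^ 2 *
      p.sign_mul_self + sgn ℂ (p.z ⬝ᵥ g) * sgn ℂ (p.z ⬝ᵥ g) * hx + sgn_mul_self ℂ (p.z ⬝ᵥ g)

theorem norm_phase (p : PauliString q) (g : Spin q) : ‖p.phase g‖ = 1 := by
  have hs : ‖((p.sign : ℤ) : ℂ)‖ = 1 := by
    rcases Int.units_eq_one_or p.sign with h | h <;> simp [h]
  rw [phase, norm_mul, hs]
  simp

theorem phase_ne_zero (p : PauliString q) (g : Spin q) : p.phase g ≠ 0 :=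
  right_ne_zero_of_mul_eq_one (p.phase_mul_phase g)

theorem star_phase (p : PauliString q) (g : Spin q) : star (p.phase g) = p.phase (g + p.x) := by
  rw [eq_inv_of_mul_eq_one_left (p.phase_mul_phase g), Complex.star_def,
    Complex.inv_eq_conj (p.norm_phase g)]

theorem phase_comm (p p' : PauliString q) (g : Spin q) :
    p.phase (g + p.x) * p'.phase (g + p.x + p'.x) =
      sgn ℂ (p.symp p') * (p'.phase (g + p'.x) * p.phase (g + p'.x + p.x)) := by
  have hsgn : sgn ℂ (p.z ⬝ᵥ (g + p.x)) * sgn ℂ (p'.z ⬝ᵥ (g + p.x + p'.x)) =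
      sgn ℂ (p.symp p') *
        (sgn ℂ (p'.z ⬝ᵥ (g + p'.x)) * sgn ℂ (p.z ⬝ᵥ (g + p'.x + p.x))) := by
    simp only [← AddChar.map_add_eq_mul, symp_eq_dotProduct, dotProduct_add,
      dotProduct_comm p.x p'.z]
    congr 1
    linear_combination -(CharTwo.add_self_eq_zero (p.z ⬝ᵥ p'.x))
  simp only [phase_eq]
  linear_combination ((p.sign : ℤ) : ℂ) * (∏ i, Complex.I ^ (p.x i * p.z i).val) *
    ((p'.sign : ℤ) : ℂ) * (∏ i, Complex.I ^ (p'.x i * p'.z i).val) * hsgn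

end PauliString

section Shift

variable {q : ℕ} {κ : Type}

/-- The permutation of the configurations underlying a Pauli operator. -/
def shift (p : κ → PauliString q) : Equiv.Perm (κ → Spin q) where
  toFun g k := g k + (p k).x
  invFun g k := g k + (p k).x
  left_inv g := funext fun k => zmod_two_add_add_self (g k) (p k).x
  right_inv g := funext fun k => zmod_two_add_add_self (g k) (p k).x

theorem shift_apply (p : κ → PauliString q) (g : κ → Spin q) (k : κ) :
    shift p g k = g k + (p k).x := rfl

theorem shift_shift (p : κ → PauliString q) (g : κ → Spin q) : shift p (shift p g) = g :=
  (shift p).symm_apply_apply g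

end Shift

section PauliOp

variable {q : ℕ} {κ κ' : Type} [Fintype κ] [Fintype κ'] {V W : Type} [AddCommGroup V] [Module ℂ V]
  [AddCommGroup W] [Module ℂ W]

theorem pauliOp_apply (p : κ → PauliString q) (F : (κ → Spin q) → V) (g : κ → Spin q) :
    pauliOp p F g = (∏ k, (p k).phase (shift p g k)) • F (shift p g) := rfl

theorem pauliOp_mul_self (p : κ → PauliString q) :
    (pauliOp p : Module.End ℂ ((κ → Spin q) → V)) * pauliOp p = 1 := by
  refine LinearMap.ext fun F => funext fun g => ?_
  rw [Module.End.mul_apply, pauliOp_apply, pauliOp_apply, smul_smul, shift_shift,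
    ← Finset.prod_mul_distrib, Finset.prod_eq_one, one_smul, Module.End.one_apply]
  exact fun k _ => (p k).phase_mul_phase (g k)

theorem pauliOp_pauliOp (p : κ → PauliString q) (F : (κ → Spin q) → V) :
    pauliOp p (pauliOp p F) = F := congrArg (fun A => A F) (pauliOp_mul_self p)

theorem pauliOp_comm (p p' : κ → PauliString q) :
    (pauliOp p : Module.End ℂ ((κ → Spin q) → V)) * pauliOp p' =
      sgn ℂ (∑ k, (p k).symp (p' k)) • (pauliOp p' * pauliOp p) := by
  refine LinearMap.ext fun F => funext fun g => ?_
  have hshift : shift p' (shift p g) = shift p (shift p' g) :=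
    funext fun k => add_right_comm (g k) (p k).x (p' k).x
  rw [LinearMap.smul_apply, Pi.smul_apply, Module.End.mul_apply, Module.End.mul_apply]
  simp only [pauliOp_apply, smul_smul]
  rw [hshift, sgn_sum, ← Finset.prod_mul_distrib, ← Finset.prod_mul_distrib,
    ← Finset.prod_mul_distrib]
  congr 1
  refine Finset.prod_congr rfl fun k _ => ?_
  have hphase := (p k).phase_comm (p' k) (g k)
  rw [add_right_comm (g k) (p k).x] at hphase
  exact hphase

theorem pauliOp_commute {p p' : κ → PauliString q} (h : ∑ k, (p k).symp (p' k) = 0) :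
    Commute (pauliOp p : Module.End ℂ ((κ → Spin q) → V)) (pauliOp p') := by
  have hcomm := pauliOp_comm (V := V) p p'
  rwa [h, AddChar.map_zero_eq_one, one_smul] at hcomm

theorem sum_symp_eq_zero_of_commute [Nontrivial V] {p p' : κ → PauliString q}
    (h : Commute (pauliOp p : Module.End ℂ ((κ → Spin q) → V)) (pauliOp p')) :
    ∑ k, (p k).symp (p' k) = 0 := by
  set a := ∑ k, (p k).symp (p' k) with ha
  have hinv : (pauliOp p' * pauliOp p) * (pauliOp p * pauliOp p') =
      (1 : Module.End ℂ ((κ → Spin q) → V)) := by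
    rw [mul_assoc, ← mul_assoc (pauliOp p), pauliOp_mul_self, one_mul, pauliOp_mul_self]
  have hsgn : sgn ℂ a • (1 : Module.End ℂ ((κ → Spin q) → V)) = (1 : ℂ) • 1 := by
    rw [← hinv, ← smul_mul_assoc, ha, ← pauliOp_comm, h.eq, one_smul]
  have hsgn1 : sgn ℂ a = 1 :=
    smul_left_injective ℂ (one_ne_zero (α := Module.End ℂ ((κ → Spin q) → V))) hsgn
  exact sgn_injective (hsgn1.trans (AddChar.map_zero_eq_one _).symm)

theorem pauliOp_one {p : κ → PauliString q} (h : ∀ k, p k = PauliString.one) :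
    (pauliOp p : Module.End ℂ ((κ → Spin q) → V)) = 1 := by
  have hshift : shift p = 1 := Equiv.ext fun g => funext fun k => by
    simp [shift_apply, h, PauliString.one_x]
  refine LinearMap.ext fun F => funext fun g => ?_
  simp [pauliOp_apply, hshift, h, PauliString.phase_one]

theorem pauliOp_mul_of_disjoint {p p' p'' : κ → PauliString q}
    (h : ∀ k, (p k = PauliString.one ∧ p'' k = p' k) ∨ (p' k = PauliString.one ∧ p'' k = p k)) :
    (pauliOp p : Module.End ℂ ((κ → Spin q) → V)) * pauliOp p' = pauliOp p'' := by
  refine LinearMap.ext fun F => funext fun g => ?_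
  have hshift : shift p' (shift p g) = shift p'' g := funext fun k => by
    rcases h k with ⟨h1, h2⟩ | ⟨h1, h2⟩ <;> simp [shift_apply, h1, h2, PauliString.one_x]
  rw [Module.End.mul_apply, pauliOp_apply, pauliOp_apply, pauliOp_apply, smul_smul, hshift,
    ← Finset.prod_mul_distrib]
  congr 1
  refine Finset.prod_congr rfl fun k _ => ?_
  rcases h k with ⟨h1, h2⟩ | ⟨h1, h2⟩ <;>
    simp [shift_apply, h1, h2, PauliString.one_x, PauliString.phase_one]

theorem pauliOp_map (p : κ → PauliString q) (f : V →ₗ[ℂ] W) (F : (κ → Spin q) → V) :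
    pauliOp p (fun g => f (F g)) = fun g => f (pauliOp p F g) := by
  funext g
  rw [pauliOp_apply, pauliOp_apply, map_smul]

theorem pauliOp_mul_right {D : ℕ} (p : κ → PauliString q)
    (F : (κ → Spin q) → Matrix (Fin D) (Fin D) ℂ) (X : Matrix (Fin D) (Fin D) ℂ) :
    pauliOp p (fun g => F g * X) = fun g => pauliOp p F g * X :=
  pauliOp_map p (LinearMap.mulRight ℂ X) F

theorem pauliOp_mul_left {D : ℕ} (p : κ → PauliString q)
    (F : (κ → Spin q) → Matrix (Fin D) (Fin D) ℂ) (X : Matrix (Fin D) (Fin D) ℂ) :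
    pauliOp p (fun g => X * F g) = fun g => X * pauliOp p F g :=
  pauliOp_map p (LinearMap.mulLeft ℂ X) F

theorem pauliOp_trace {D : ℕ} (p : κ → PauliString q)
    (F : (κ → Spin q) → Matrix (Fin D) (Fin D) ℂ) :
    pauliOp p (fun g => (F g).trace) = fun g => (pauliOp p F g).trace :=
  pauliOp_map p (Matrix.traceLinearMap (Fin D) ℂ ℂ) F

theorem pauliOp_trace_mul {D : ℕ} (p : κ → PauliString q)
    (F : (κ → Spin q) → Matrix (Fin D) (Fin D) ℂ) (X : Matrix (Fin D) (Fin D) ℂ) :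
    pauliOp p (fun g => (F g * X).trace) = fun g => (pauliOp p F g * X).trace := by
  rw [pauliOp_trace, pauliOp_mul_right]

theorem pauliOp_apply_mem_span (p : κ → PauliString q) (F : (κ → Spin q) → V) (g : κ → Spin q) :
    pauliOp p F g ∈ Submodule.span ℂ (Set.range F) :=
  Submodule.smul_mem _ _ (Submodule.subset_span ⟨_, rfl⟩)

/-- Relabelling of the cells. -/
noncomputable def relabel {κ κ' : Type} (q : ℕ) (V : Type) [AddCommGroup V] [Module ℂ V]
    (e : κ ≃ κ') : ((κ → Spin q) → V) ≃ₗ[ℂ] ((κ' → Spin q) → V) :=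
  LinearEquiv.funCongrLeft ℂ V (Equiv.arrowCongr e.symm (Equiv.refl (Spin q)))

theorem relabel_apply {κ κ' : Type} (e : κ ≃ κ') (F : (κ → Spin q) → V) (g : κ' → Spin q) :
    relabel q V e F g = F (fun k => g (e k)) := rfl

theorem relabel_pauliOp (e : κ ≃ κ') (p : κ' → PauliString q) (F : (κ → Spin q) → V) :
    relabel q V e (pauliOp (fun k => p (e k)) F) = pauliOp p (relabel q V e F) := by
  funext g
  rw [relabel_apply, pauliOp_apply, pauliOp_apply, relabel_apply]
  congr 1
  exact e.prod_comp fun k => (p k).phase (g k + (p k).x)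

end PauliOp

section PauliSums

variable {q D : ℕ} {κ : Type} [Fintype κ]

theorem sum_star_pauliOp_mul [DecidableEq κ] (p : κ → PauliString q) (F G : (κ → Spin q) → ℂ) :
    ∑ g, star (pauliOp p F g) * G g = ∑ g, star (F g) * pauliOp p G g := by
  rw [← Equiv.sum_comp (shift p) fun g => star (F g) * pauliOp p G g]
  refine Finset.sum_congr rfl fun g _ => ?_
  have hstar : star (∏ k, (p k).phase (shift p g k)) = ∏ k, (p k).phase (g k) := by
    rw [star_prod]
    exact Finset.prod_congr rfl fun k _ =>
      ((p k).star_phase _).trans (congrArg _ (zmod_two_add_add_self (g k) (p k).x))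
  rw [pauliOp_apply, pauliOp_apply, shift_shift, smul_eq_mul, smul_eq_mul, star_mul', hstar]
  ring

theorem star_prod_phase_mul (p : κ → PauliString q) (g : κ → Spin q) :
    star (∏ k, (p k).phase (g k)) * ∏ k, (p k).phase (g k) = 1 := by
  rw [Complex.star_def, ← Complex.normSq_eq_conj_mul_self, Complex.normSq_eq_norm_sq, norm_prod]
  simp [PauliString.norm_phase]

theorem sum_pauliOp_mul_conjTranspose [DecidableEq κ] (p : κ → PauliString q)
    (F : (κ → Spin q) → Matrix (Fin D) (Fin D) ℂ) :
    ∑ g, pauliOp p F g * (pauliOp p F g).conjTranspose = ∑ g, F g * (F g).conjTranspose := by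
  rw [← Equiv.sum_comp (shift p) fun g => F g * (F g).conjTranspose]
  refine Finset.sum_congr rfl fun g _ => ?_
  rw [pauliOp_apply, Matrix.conjTranspose_smul, smul_mul_smul_comm, mul_comm (∏ k, _),
    star_prod_phase_mul, one_smul]

theorem sum_conjTranspose_pauliOp_mul [DecidableEq κ] (p : κ → PauliString q)
    (F : (κ → Spin q) → Matrix (Fin D) (Fin D) ℂ) :
    ∑ g, (pauliOp p F g).conjTranspose * pauliOp p F g = ∑ g, (F g).conjTranspose * F g := by
  rw [← Equiv.sum_comp (shift p) fun g => (F g).conjTranspose * F g]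
  refine Finset.sum_congr rfl fun g _ => ?_
  rw [pauliOp_apply, Matrix.conjTranspose_smul, smul_mul_smul_comm, star_prod_phase_mul, one_smul]

end PauliSums

namespace Code

variable {q m : ℕ} (C : Code q m)

section ChainOp

/-- An upper bound for the ranges of the interactions. -/
def maxRange : ℕ := Finset.univ.sup C.P

theorem P_le_maxRange (α : Fin m) : C.P α ≤ C.maxRange := Finset.le_sup (Finset.mem_univ α)

theorem pos_pos (c : C.Cut) : 0 < C.pos c := Nat.succ_pos _

theorem pos_lt (c : C.Cut) : C.pos c < C.P c.1 := by
  have := c.2.2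
  simp only [pos]
  omega

/-- The term of type `α` starting at the cell `a` of an infinite chain, as a Pauli string. -/
def stringAt (α : Fin m) (a k : ℤ) : PauliString q :=
  if 0 ≤ k - a ∧ k - a < C.P α then C.o α (k - a).toNat else PauliString.one

theorem stringAt_add (α : Fin m) (a k b : ℤ) :
    C.stringAt α (a + b) (k + b) = C.stringAt α a k := by
  rw [stringAt, stringAt, add_sub_add_right_eq_sub]

theorem stringAt_of_lt {α : Fin m} {a k : ℤ} (h : k < a) :
    C.stringAt α a k = PauliString.one := by
  rw [stringAt, if_neg]; omega

theorem stringAt_of_le {α : Fin m} {a k : ℤ} (h : a + C.P α ≤ k) :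
    C.stringAt α a k = PauliString.one := by
  rw [stringAt, if_neg]; omega

theorem stringAt_of_mem {α : Fin m} {a k : ℤ} {j : ℕ} (h : k - a = j) (hj : j < C.P α) :
    C.stringAt α a k = C.o α j := by
  rw [stringAt, if_pos (by omega), h, Int.toNat_natCast]

/-- The restriction to the cells `0, …, n - 1` of the term of type `α` starting at the cell `a`. -/
noncomputable def chainOp {V : Type} [AddCommGroup V] [Module ℂ V] (n : ℕ) (α : Fin m) (a : ℤ) :
    Module.End ℂ ((Fin n → Spin q) → V) :=
  pauliOp fun k : Fin n => C.stringAt α a (k : ℤ)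

variable {V : Type} [AddCommGroup V] [Module ℂ V] {n : ℕ}

theorem chainOp_mul_self (α : Fin m) (a : ℤ) :
    (C.chainOp n α a : Module.End ℂ ((Fin n → Spin q) → V)) * C.chainOp n α a = 1 :=
  pauliOp_mul_self _

theorem chainOp_chainOp (α : Fin m) (a : ℤ) (F : (Fin n → Spin q) → V) :
    C.chainOp n α a (C.chainOp n α a F) = F := pauliOp_pauliOp _ F

theorem chainOp_of_add_le {α : Fin m} {a : ℤ} (h : a + C.P α ≤ 0) :
    (C.chainOp n α a : Module.End ℂ ((Fin n → Spin q) → V)) = 1 :=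
  pauliOp_one fun k => C.stringAt_of_le (by omega)

theorem chainOp_of_le {α : Fin m} {a : ℤ} (h : (n : ℤ) ≤ a) :
    (C.chainOp n α a : Module.End ℂ ((Fin n → Spin q) → V)) = 1 :=
  pauliOp_one fun k => C.stringAt_of_lt (by omega)

/-- The number modulo 2 of cells among `0, …, n - 1` in which two terms anticommute. -/
def overlap (n : ℕ) (α : Fin m) (a : ℤ) (β : Fin m) (b : ℤ) : ZMod 2 :=
  ∑ k : Fin n, (C.stringAt α a (k : ℤ)).symp (C.stringAt β b (k : ℤ))

theorem chainOp_comm (α β : Fin m) (a b : ℤ) :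
    (C.chainOp n α a : Module.End ℂ ((Fin n → Spin q) → V)) * C.chainOp n β b =
      sgn ℂ (C.overlap n α a β b) • (C.chainOp n β b * C.chainOp n α a) :=
  pauliOp_comm _ _

theorem chainOp_commute {α β : Fin m} {a b : ℤ} (h : C.overlap n α a β b = 0) :
    Commute (C.chainOp n α a : Module.End ℂ ((Fin n → Spin q) → V)) (C.chainOp n β b) :=
  pauliOp_commute h

theorem overlap_comm (α β : Fin m) (a b : ℤ) :
    C.overlap n α a β b = C.overlap n β b α a :=
  Finset.sum_congr rfl fun _ _ => PauliString.symp_comm _ _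

theorem overlap_eq_zero {α β : Fin m} {a b : ℤ} (h : ∀ k : ℕ, k < n →
    C.stringAt α a k = PauliString.one ∨ C.stringAt β b k = PauliString.one) :
    C.overlap n α a β b = 0 :=
  Finset.sum_eq_zero fun k _ => by
    rcases h k k.2 with h | h
    · rw [h, PauliString.symp_one_left]
    · rw [h, PauliString.symp_one_right]

theorem overlap_add (n k : ℕ) (α β : Fin m) (a b : ℤ) :
    C.overlap (n + k) α a β b = C.overlap n α a β b + C.overlap k α (a - n) β (b - n) := by
  rw [overlap, Fin.sum_univ_add]
  congr 1
  refine Finset.sum_congr rfl fun i _ => ?_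
  rw [← C.stringAt_add α (a - n) i n, ← C.stringAt_add β (b - n) i n]
  simp [add_comm]

theorem overlap_left (c d : C.Cut) (hn : C.maxRange ≤ n) :
    C.overlap n c.1 (n - C.pos c) d.1 (n - C.pos d) = C.tMatrix c d := by
  have hc := C.pos_lt c
  have hd := C.pos_lt d
  have hcn := (C.P_le_maxRange c.1).trans hn
  have hdn := (C.P_le_maxRange d.1).trans hn
  rw [overlap, Fin.sum_univ_eq_sum_range (fun k => (C.stringAt c.1 (n - C.pos c) (k : ℤ)).symp
    (C.stringAt d.1 (n - C.pos d) (k : ℤ))), ← Finset.sum_range_reflect, tMatrix]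
  refine (Finset.sum_subset_zero_on_sdiff (fun k hk => ?_) (fun k hk => ?_) fun k hk => ?_).symm
  · simp only [Finset.mem_range, lt_min_iff] at hk ⊢
    omega
  · simp only [Finset.mem_sdiff, Finset.mem_range, lt_min_iff, not_and_or, not_lt] at hk
    rcases hk.2 with h | h
    · rw [C.stringAt_of_lt (by omega), PauliString.symp_one_left]
    · rw [C.stringAt_of_lt (α := d.1) (by omega), PauliString.symp_one_right]
  · simp only [Finset.mem_range, lt_min_iff] at hk
    rw [C.stringAt_of_mem (j := C.pos c - 1 - k) (by omega) (by omega),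
      C.stringAt_of_mem (j := C.pos d - 1 - k) (by omega) (by omega)]

theorem overlap_left_right (c d : C.Cut) (hn : 2 * C.maxRange ≤ n) :
    C.overlap n c.1 (n - C.pos c) d.1 (-C.pos d) = 0 := by
  have hc := C.pos_lt c
  have hcM := C.P_le_maxRange c.1
  have hdM := C.P_le_maxRange d.1
  refine C.overlap_eq_zero fun k _ => ?_
  rcases lt_or_ge k C.maxRange with h | h
  · exact Or.inl (C.stringAt_of_lt (by omega))
  · exact Or.inr (C.stringAt_of_le (by omega))

theorem cliffordRel_chainOp_left (hn : C.maxRange ≤ n) :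
    CliffordRel C.tMatrix fun c : C.Cut =>
      (C.chainOp n c.1 (n - C.pos c) : Module.End ℂ ((Fin n → Spin q) → ℂ)) :=
  (cliffordRel_iff ℂ _ _).2 fun c d => by rw [chainOp_comm, C.overlap_left c d hn]

theorem tMatrix_comm (c d : C.Cut) : C.tMatrix c d = C.tMatrix d c := by
  rw [← C.overlap_left c d le_rfl, ← C.overlap_left d c le_rfl, overlap_comm]

theorem tMatrix_transpose : C.tMatrix.transpose = -C.tMatrix := by
  ext c d
  rw [Matrix.transpose_apply, Matrix.neg_apply, ZMod.neg_eq_self_mod_two, C.tMatrix_comm]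

theorem tMatrix_self (c : C.Cut) : C.tMatrix c c = 0 :=
  Finset.sum_eq_zero fun _ _ => PauliString.symp_self _

end ChainOp

section Ring

variable (L : ℕ) [NeZero L]

/-- The labelling of the cells of a ring by `0, …, L - 1`, starting at the cell `s`. -/
noncomputable def ringLabel (s : ZMod L) : ZMod L ≃ Fin L where
  toFun x := ⟨(x - s).val, ZMod.val_lt _⟩
  invFun k := s + (k : ℕ)
  left_inv x := by simp
  right_inv k := by
    ext
    simp [ZMod.val_natCast, Nat.mod_eq_of_lt k.2]

variable {L}

theorem val_ringLabel (s x : ZMod L) : (ringLabel L s x : ℕ) = (x - s).val := rfl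

theorem relabel_seg {α : Fin m} {a b : ℕ} {r s : ZMod L} {p : Fin L → PauliString q}
    (h : ∀ x : ZMod L, p (ringLabel L s x) =
      if a ≤ (x - r).val ∧ (x - r).val < b then C.o α (x - r).val else PauliString.one)
    (ψ : Hilb q L) :
    relabel q ℂ (ringLabel L s) (C.seg L α a b r ψ) =
      pauliOp p (relabel q ℂ (ringLabel L s) ψ) := by
  rw [← relabel_pauliOp, seg]
  simp only [h]

theorem val_sub_cut (hL : C.maxRange ≤ L) (c : C.Cut) (r x : ZMod L) :
    (x - (r - (C.pos c : ZMod L) + 1)).val =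
      if (ringLabel L (r + 1) x : ℕ) + C.pos c < L then (ringLabel L (r + 1) x : ℕ) + C.pos c
      else (ringLabel L (r + 1) x : ℕ) + C.pos c - L := by
  have hc := (C.pos_lt c).trans_le ((C.P_le_maxRange c.1).trans hL)
  have hv : (C.pos c : ZMod L).val = C.pos c := ZMod.val_cast_of_lt hc
  rw [show x - (r - (C.pos c : ZMod L) + 1) = (x - (r + 1)) + (C.pos c : ZMod L) by ring,
    val_ringLabel]
  split_ifs with h
  · rw [ZMod.val_add_of_lt (by rwa [hv]), hv]
  · rw [ZMod.val_add_of_le (by rw [hv]; omega), hv]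

theorem relabel_leftOp (hL : C.maxRange ≤ L) (c : C.Cut) (r : ZMod L) (ψ : Hilb q L) :
    relabel q ℂ (ringLabel L (r + 1)) (C.leftOp L c r ψ) =
      C.chainOp L c.1 (L - C.pos c) (relabel q ℂ (ringLabel L (r + 1)) ψ) := by
  have hc := C.pos_lt c
  refine C.relabel_seg (fun x => ?_) ψ
  rw [C.val_sub_cut hL]
  generalize ringLabel L (r + 1) x = k
  split_ifs
  · omega
  · rw [C.stringAt_of_lt (by omega)]
  · rw [C.stringAt_of_mem (j := k + C.pos c - L) (by omega) (by omega)]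
  · omega

theorem relabel_rightOp (hL : C.maxRange ≤ L) (c : C.Cut) (r : ZMod L) (ψ : Hilb q L) :
    relabel q ℂ (ringLabel L (r + 1)) (C.rightOp L c r ψ) =
      C.chainOp L c.1 (-C.pos c) (relabel q ℂ (ringLabel L (r + 1)) ψ) := by
  have hcL := (C.P_le_maxRange c.1).trans hL
  refine C.relabel_seg (fun x => ?_) ψ
  rw [C.val_sub_cut hL]
  generalize ringLabel L (r + 1) x = k
  split_ifs
  · rw [C.stringAt_of_mem (j := k + C.pos c) (by omega) (by omega)]
  · rw [C.stringAt_of_le (by omega)]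
  · omega
  · rw [C.stringAt_of_le (by omega)]

theorem val_sub_eq_ite (x r : ZMod L) :
    (x - r).val = if r.val ≤ x.val then x.val - r.val else x.val + L - r.val := by
  have hr := ZMod.val_lt r
  have := ZMod.val_lt (x - r)
  split_ifs with h
  · exact ZMod.val_sub h
  · rcases lt_or_ge ((x - r).val + r.val) L with hlt | hge
    · have := ZMod.val_add_of_lt hlt
      rw [sub_add_cancel] at this
      omega
    · have := ZMod.val_add_val_of_le hge
      rw [sub_add_cancel] at this
      omega

theorem relabel_term (hL : C.maxRange ≤ L) (α : Fin m) (r : ZMod L) (ψ : Hilb q L) :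
    relabel q ℂ (ringLabel L 0) (C.term L α r ψ) =
      C.chainOp L α r.val (C.chainOp L α (r.val - L) (relabel q ℂ (ringLabel L 0) ψ)) := by
  have hα := (C.P_le_maxRange α).trans hL
  have hr := ZMod.val_lt r
  let p (k : Fin L) : PauliString q :=
    if (k : ℕ) < r.val then C.stringAt α (r.val - L) k else C.stringAt α r.val k
  have hmul : (C.chainOp L α r.val * C.chainOp L α (r.val - L) :
      Module.End ℂ ((Fin L → Spin q) → ℂ)) = pauliOp p := by
    refine pauliOp_mul_of_disjoint fun k => ?_
    by_cases h : (k : ℕ) < r.val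
    · exact Or.inl ⟨C.stringAt_of_lt (by omega), if_pos h⟩
    · exact Or.inr ⟨C.stringAt_of_le (by omega), if_neg h⟩
  rw [← Module.End.mul_apply, hmul]
  refine C.relabel_seg (fun x => ?_) ψ
  have hx : (ringLabel L 0 x : ℕ) = x.val := by rw [val_ringLabel, sub_zero]
  simp only [p, val_sub_eq_ite x r, hx, stringAt]
  have := ZMod.val_lt x
  grind

/-- The stabilizer condition on a ring of `n` cells labelled by `0, …, n - 1`. A term that wraps
around the ring is the product of two truncated terms of the chain. -/
def RingFixed (n : ℕ) (φ : (Fin n → Spin q) → ℂ) : Prop :=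
  ∀ (α : Fin m) (a : ℕ), a < n → C.chainOp n α a (C.chainOp n α (a - n) φ) = φ

theorem isGroundState_iff (hL : C.maxRange ≤ L) (ψ : Hilb q L) :
    C.IsGroundState L ψ ↔ relabel q ℂ (ringLabel L 0) ψ ≠ 0 ∧
      C.RingFixed L (relabel q ℂ (ringLabel L 0) ψ) := by
  rw [IsGroundState, (relabel q ℂ (ringLabel L 0)).map_ne_zero_iff]
  refine and_congr_right fun _ => ⟨fun h α a ha => ?_, fun h α r => ?_⟩
  · rw [← ZMod.val_cast_of_lt ha, ← C.relabel_term hL, h]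
  · apply (relabel q ℂ (ringLabel L 0)).injective
    rw [C.relabel_term hL, h α r.val (ZMod.val_lt r)]

/-- There is exactly one state, up to scalars, satisfying the stabilizer condition. -/
def UniqueFixed (n : ℕ) : Prop :=
  ∃ ψ : (Fin n → Spin q) → ℂ, ψ ≠ 0 ∧ C.RingFixed n ψ ∧
    ∀ φ, C.RingFixed n φ → ∃ z : ℂ, φ = z • ψ

theorem hamiltonian_apply_of_term_eq {φ : Hilb q L} (hφ : ∀ α r, C.term L α r φ = φ) :
    C.hamiltonian L φ = (-(L * m : ℂ)) • φ := by
  simp only [hamiltonian, LinearMap.neg_apply, LinearMap.sum_apply, hφ]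
  simp [← Nat.cast_smul_eq_nsmul ℂ, smul_smul]

theorem HasUniqueGroundState.uniqueFixed {C : Code q m} (hL : C.maxRange ≤ L)
    (h : C.HasUniqueGroundState L) : C.UniqueFixed L := by
  obtain ⟨E, -, hdim, hterm⟩ := h
  obtain ⟨⟨ψ, hψE⟩, hψ0, hψ⟩ := finrank_eq_one_iff'.1 hdim
  have hgs : C.IsGroundState L ψ := ⟨fun h => hψ0 (Subtype.ext h), hterm ψ hψE⟩
  have hE : (E : ℂ) = -(L * m : ℂ) := smul_left_injective ℂ hgs.1 <|
    (Module.End.mem_eigenspace_iff.1 hψE).symm.trans (C.hamiltonian_apply_of_term_eq hgs.2)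
  obtain ⟨hne, hfixed⟩ := (C.isGroundState_iff hL ψ).1 hgs
  refine ⟨relabel q ℂ (ringLabel L 0) ψ, hne, hfixed, fun φ hφ => ?_⟩
  by_cases hφ0 : φ = 0
  · exact ⟨0, by rw [hφ0, zero_smul]⟩
  obtain ⟨φ, rfl⟩ := (relabel q ℂ (ringLabel L 0)).surjective φ
  have hφE : φ ∈ (C.hamiltonian L).eigenspace (E : ℂ) := Module.End.mem_eigenspace_iff.2 <| by
    rw [C.hamiltonian_apply_of_term_eq ((C.isGroundState_iff hL φ).2 ⟨hφ0, hφ⟩).2, hE]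
  obtain ⟨z, hz⟩ := hψ ⟨φ, hφE⟩
  exact ⟨z, by rw [← map_smul]; exact congrArg _ (congrArg Subtype.val hz).symm⟩

end Ring

section Commuting

theorem overlap_eq_zero_of_commuting {L : ℕ} [NeZero L] (hL : C.maxRange ≤ L)
    (hcomm : C.Commuting L) {α β : Fin m} {a b : ℤ} (ha : 0 ≤ a) (haL : a + C.P α ≤ L)
    (hb : 0 ≤ b) (hbL : b + C.P β ≤ L) : C.overlap L α a β b = 0 := by
  have hterm {γ : Fin m} {d : ℤ} (hd : 0 ≤ d) (hdL : d + C.P γ ≤ L) (ψ : Hilb q L) :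
      C.chainOp L γ d (relabel q ℂ (ringLabel L 0) ψ) =
        relabel q ℂ (ringLabel L 0) (C.term L γ (d.toNat : ℕ) ψ) := by
    have hγ := C.P_pos γ
    rw [C.relabel_term hL, ZMod.val_cast_of_lt (by omega), Int.toNat_of_nonneg hd,
      C.chainOp_of_add_le (a := d - L) (by omega), Module.End.one_apply]
  refine sum_symp_eq_zero_of_commute (V := ℂ) (LinearMap.ext fun φ => ?_)
  obtain ⟨ψ, rfl⟩ := (relabel q ℂ (ringLabel L 0)).surjective φ
  change C.chainOp L α a (C.chainOp L β b _) = C.chainOp L β b (C.chainOp L α a _)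
  rw [hterm hb hbL, hterm ha haL, hterm ha haL, hterm hb hbL, ← Module.End.mul_apply,
    (hcomm α β _ _).eq, Module.End.mul_apply]

variable {C}

/-- In the bulk of a chain the terms commute with all (truncated) terms: embed the chain into a long
ring, so that neither term is truncated. -/
theorem overlap_eq_zero_of_bulk (hcomm : ∀ᶠ L : ℕ in atTop, ∀ [NeZero L], C.Commuting L)
    {n : ℕ} {α : Fin m} {a : ℤ} (ha : 0 ≤ a) (han : a + C.P α ≤ n) (β : Fin m) (b : ℤ) :
    C.overlap n α a β b = 0 := by
  obtain ⟨L₀, hL₀⟩ := eventually_atTop.1 hcomm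
  have hβ := C.P_le_maxRange β
  by_cases hb : b + C.P β ≤ 0 ∨ n ≤ b
  · refine C.overlap_eq_zero fun k hk => Or.inr ?_
    rcases hb with hb | hb
    · exact C.stringAt_of_le (by omega)
    · exact C.stringAt_of_lt (by omega)
  set M := C.maxRange
  have hL : NeZero (M + n + (M + L₀ + 1)) := ⟨by omega⟩
  have hlong := C.overlap_eq_zero_of_commuting (by omega) (hL₀ (M + n + (M + L₀ + 1)) (by omega))
    (α := α) (β := β) (a := a + M) (b := b + M) (by omega) (by push_cast; omega) (by omega)
    (by push_cast; omega)
  rw [C.overlap_add, C.overlap_add, C.overlap_eq_zero (n := M) fun k _ =>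
      Or.inl (C.stringAt_of_lt (by omega)), C.overlap_eq_zero (n := M + L₀ + 1) fun k _ =>
      Or.inl (C.stringAt_of_le (by push_cast; omega)), add_zero, zero_add] at hlong
  simpa only [add_sub_cancel_right] using hlong

theorem overlap_right (hcomm : ∀ᶠ L : ℕ in atTop, ∀ [NeZero L], C.Commuting L)
    {n : ℕ} (c d : C.Cut) (hn : C.maxRange ≤ n) :
    C.overlap n c.1 (-C.pos c) d.1 (-C.pos d) = C.tMatrix c d := by
  have hc := C.pos_lt c
  have hcM := C.P_le_maxRange c.1
  have h := overlap_eq_zero_of_bulk hcomm (n := n + n) (α := c.1) (a := n - C.pos c)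
    (by omega) (by push_cast; omega) d.1 (n - C.pos d)
  rw [C.overlap_add, C.overlap_left c d hn, sub_sub_cancel_left, sub_sub_cancel_left] at h
  exact (CharTwo.add_eq_zero.1 h).symm

theorem cliffordRel_chainOp_right (hcomm : ∀ᶠ L : ℕ in atTop, ∀ [NeZero L], C.Commuting L)
    {n : ℕ} (hn : C.maxRange ≤ n) :
    CliffordRel C.tMatrix fun c : C.Cut =>
      (C.chainOp n c.1 (-C.pos c) : Module.End ℂ ((Fin n → Spin q) → ℂ)) :=
  (cliffordRel_iff ℂ _ _).2 fun c d => by rw [chainOp_comm, overlap_right hcomm c d hn]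

variable {L : ℕ} [NeZero L]

theorem cliffordRel_leftOp (hL : C.maxRange ≤ L) (r : ZMod L) :
    CliffordRel C.tMatrix fun c => C.leftOp L c r := by
  refine (cliffordRel_iff ℂ _ _).2 fun c d => LinearMap.ext fun ψ => ?_
  apply (relabel q ℂ (ringLabel L (r + 1))).injective
  have hrel := (cliffordRel_iff ℂ _ _).1 (C.cliffordRel_chainOp_left hL) c d
  simp only [Module.End.mul_apply, LinearMap.smul_apply, map_smul, C.relabel_leftOp hL]
  exact LinearMap.congr_fun hrel (relabel q ℂ (ringLabel L (r + 1)) ψ)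

theorem cliffordRel_rightOp (hcomm : ∀ᶠ L : ℕ in atTop, ∀ [NeZero L], C.Commuting L)
    (hL : C.maxRange ≤ L) (r : ZMod L) : CliffordRel C.tMatrix fun c => C.rightOp L c r := by
  refine (cliffordRel_iff ℂ _ _).2 fun c d => LinearMap.ext fun ψ => ?_
  apply (relabel q ℂ (ringLabel L (r + 1))).injective
  have hrel := (cliffordRel_iff ℂ _ _).1 (cliffordRel_chainOp_right hcomm hL) c d
  simp only [Module.End.mul_apply, LinearMap.smul_apply, map_smul, C.relabel_rightOp hL]
  exact LinearMap.congr_fun hrel (relabel q ℂ (ringLabel L (r + 1)) ψ)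

end Commuting

end Code

/-- Families of `D × D` matrices indexed by the configurations of `n` cells. -/
abbrev MatrixFamily (q D n : ℕ) := (Fin n → Spin q) → Matrix (Fin D) (Fin D) ℂ

/-- The concatenation of two families of matrices indexed by configurations of consecutive
intervals. The length is a variable `N` with `n + k = N`, so that repeated concatenations compose
without casts. -/
noncomputable def concat {q D n k N : ℕ} (h : n + k = N) (Φ : MatrixFamily q D n)
    (Ψ : MatrixFamily q D k) : MatrixFamily q D N := fun g =>
  Φ (fun i => g ⟨i, by omega⟩) * Ψ (fun i => g ⟨n + i, by omega⟩)

section Generators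

variable {K R : Type*} [Field K] [Ring R] [Algebra K R] {s : Set R}

theorem mul_mem_of_adjoin_eq_top (hs : Algebra.adjoin K s = ⊤) {J : Submodule K R}
    (hJ : ∀ x ∈ s, ∀ y ∈ J, x * y ∈ J ∧ y * x ∈ J) (x : R) : ∀ y ∈ J, x * y ∈ J ∧ y * x ∈ J := by
  have hx : x ∈ Algebra.adjoin K s := hs ▸ Algebra.mem_top
  induction hx using Algebra.adjoin_induction with
  | mem x hx => exact hJ x hx
  | algebraMap c =>
    intro y hy
    rw [← Algebra.commutes, ← Algebra.smul_def]
    exact ⟨J.smul_mem _ hy, J.smul_mem _ hy⟩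
  | add a b _ _ ha hb =>
    intro y hy
    rw [add_mul, mul_add]
    exact ⟨add_mem (ha y hy).1 (hb y hy).1, add_mem (ha y hy).2 (hb y hy).2⟩
  | mul a b _ _ ha hb =>
    intro y hy
    rw [mul_assoc, ← mul_assoc y]
    exact ⟨(ha _ (hb y hy).1).1, (hb _ (ha y hy).2).2⟩

theorem eq_top_of_mul_mem_of_adjoin_eq_top [IsSimpleRing R] (hs : Algebra.adjoin K s = ⊤)
    {J : Submodule K R} (hJ : ∀ x ∈ s, ∀ y ∈ J, x * y ∈ J ∧ y * x ∈ J) (hne : J ≠ ⊥) : J = ⊤ := by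
  have hmul := mul_mem_of_adjoin_eq_top hs hJ
  let I : TwoSidedIdeal R := .mk' (J : Set R) J.zero_mem J.add_mem J.neg_mem
    (fun hy => (hmul _ _ hy).1) (fun hx => (hmul _ _ hx).2)
  have hI (x : R) : x ∈ I ↔ x ∈ J := TwoSidedIdeal.mem_mk' ..
  rcases eq_bot_or_eq_top I with h | h
  · exact absurd ((Submodule.eq_bot_iff J).2 fun x hx =>
      (TwoSidedIdeal.mem_bot R).1 (h ▸ (hI x).2 hx)) hne
  · exact Submodule.eq_top_iff'.2 fun x => (hI x).1 (h ▸ TwoSidedIdeal.mem_top R)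

theorem freeAlgebra_lift_surjective {ι : Type*} {U : ι → R}
    (hU : Algebra.adjoin K (Set.range U) = ⊤) : Function.Surjective (FreeAlgebra.lift K U) := by
  rw [← AlgHom.range_eq_top, ← hU, Algebra.adjoin_range_eq_range_freeAlgebra_lift]

end Generators

namespace Code

variable {q m : ℕ} (C : Code q m)

theorem chainOp_concat {D n k N : ℕ} (h : n + k = N) (Φ : MatrixFamily q D n)
    (Ψ : MatrixFamily q D k) (α : Fin m) (a : ℤ) :
    C.chainOp N α a (concat h Φ Ψ) = concat h (C.chainOp n α a Φ) (C.chainOp k α (a - n) Ψ) := by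
  subst h
  have hstring (i : Fin k) :
      C.stringAt α (a - n) (i : ℤ) = C.stringAt α a ((n + i : ℕ) : ℤ) := by
    rw [← C.stringAt_add α (a - n) i n]
    simp [add_comm]
  funext g
  simp only [concat, chainOp, pauliOp_apply, Fin.prod_univ_add, smul_mul_smul_comm, hstring]
  rfl

theorem exists_cut {α : Fin m} {p : ℤ} (h0 : 0 < p) (h1 : p < C.P α) :
    ∃ c : C.Cut, c.1 = α ∧ (C.pos c : ℤ) = p :=
  ⟨⟨α, ⟨(p - 1).toNat, by omega⟩⟩, rfl, by simp only [pos]; omega⟩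

theorem position_cases (n : ℕ) (α : Fin m) (a : ℤ) :
    (a + C.P α ≤ 0 ∨ n ≤ a) ∨ (0 ≤ a ∧ a + C.P α ≤ n) ∨
      (∃ c : C.Cut, c.1 = α ∧ a = -C.pos c) ∨ ∃ c : C.Cut, c.1 = α ∧ a = n - C.pos c := by
  by_cases hout : a + C.P α ≤ 0 ∨ n ≤ a
  · exact Or.inl hout
  by_cases hin : 0 ≤ a ∧ a + C.P α ≤ n
  · exact Or.inr (Or.inl hin)
  right; right
  by_cases ha : a < 0
  · obtain ⟨c, hc, hp⟩ := C.exists_cut (α := α) (p := -a) (by omega) (by omega)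
    exact Or.inl ⟨c, hc, by omega⟩
  · obtain ⟨c, hc, hp⟩ := C.exists_cut (α := α) (p := n - a) (by omega) (by omega)
    exact Or.inr ⟨c, hc, by omega⟩

section Virtual

variable {D : ℕ}

/-- The virtual operator at the position `p` of a term of type `α`, which is trivial if the bond at
the position `p` does not cut the term. -/
noncomputable def virtualOp (U : C.Cut → Matrix (Fin D) (Fin D) ℂ) (α : Fin m) (p : ℤ) :
    Matrix (Fin D) (Fin D) ℂ :=
  if h : 0 < p ∧ p < C.P α then U ⟨α, ⟨(p - 1).toNat, by omega⟩⟩ else 1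

variable {C} {U : C.Cut → Matrix (Fin D) (Fin D) ℂ}

theorem virtualOp_of_nonpos {α : Fin m} {p : ℤ} (h : p ≤ 0) : C.virtualOp U α p = 1 := by
  rw [virtualOp, dif_neg]; omega

theorem virtualOp_of_le {α : Fin m} {p : ℤ} (h : C.P α ≤ p) : C.virtualOp U α p = 1 := by
  rw [virtualOp, dif_neg]; omega

theorem virtualOp_pos (c : C.Cut) : C.virtualOp U c.1 (C.pos c) = U c := by
  have hlt := C.pos_lt c
  have hpos := C.pos_pos c
  rw [virtualOp, dif_pos (by omega)]
  congr 1
  rcases c with ⟨α, i⟩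
  simp [pos]

theorem virtualOp_mul_self (hU : ∀ c, U c * U c = 1) (α : Fin m) (p : ℤ) :
    C.virtualOp U α p * C.virtualOp U α p = 1 := by
  rw [virtualOp]
  split_ifs with h
  · exact hU _
  · exact one_mul 1

variable (C U) in
/-- The (truncated) terms of the Hamiltonian act on the physical indices of `Φ` as the virtual
operators at the two ends. -/
def HasVirtualAction (n : ℕ) (Φ : MatrixFamily q D n) : Prop :=
  ∀ (α : Fin m) (a : ℤ), C.chainOp n α a Φ =
    fun g => C.virtualOp U α (-a) * Φ g * C.virtualOp U α (n - a)

variable {n k N : ℕ} {Φ : MatrixFamily q D n} {Ψ : MatrixFamily q D n}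

theorem hasVirtualAction_of_cuts (hn : C.maxRange ≤ n)
    (hbulk : ∀ (α : Fin m) (a : ℤ), 0 ≤ a → a + C.P α ≤ n → C.chainOp n α a Φ = Φ)
    (hleft : ∀ c : C.Cut, C.chainOp n c.1 (-C.pos c) Φ = fun g => U c * Φ g)
    (hright : ∀ c : C.Cut, C.chainOp n c.1 (n - C.pos c) Φ = fun g => Φ g * U c) :
    C.HasVirtualAction U n Φ := by
  intro α a
  have hα := C.P_le_maxRange α
  have hα0 := C.P_pos α
  rcases C.position_cases n α a with (h | h) | ⟨h, h'⟩ | ⟨c, rfl, rfl⟩ | ⟨c, rfl, rfl⟩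
  · rw [C.chainOp_of_add_le h, virtualOp_of_le (by omega), virtualOp_of_le (by omega)]
    simp
  · rw [C.chainOp_of_le h, virtualOp_of_nonpos (by omega), virtualOp_of_nonpos (by omega)]
    simp
  · rw [hbulk α a h h', virtualOp_of_nonpos (by omega), virtualOp_of_le (by omega)]
    simp
  · rw [hleft, neg_neg, virtualOp_pos, virtualOp_of_le (by omega)]
    simp
  · have := C.pos_lt c
    rw [hright, sub_sub_cancel, virtualOp_pos, virtualOp_of_nonpos (by omega)]
    simp

namespace HasVirtualAction

theorem apply_of_nonneg (h : C.HasVirtualAction U n Φ) {α : Fin m} {a : ℤ} (ha : 0 ≤ a) :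
    C.chainOp n α a Φ = fun g => Φ g * C.virtualOp U α (n - a) := by
  simp only [h α a, virtualOp_of_nonpos (neg_nonpos.2 ha), one_mul]

theorem apply_of_add_le (h : C.HasVirtualAction U n Φ) {α : Fin m} {a : ℤ} (ha : a + C.P α ≤ n) :
    C.chainOp n α a Φ = fun g => C.virtualOp U α (-a) * Φ g := by
  simp only [h α a, virtualOp_of_le (le_sub_iff_add_le'.2 ha), mul_one]

theorem bulk (h : C.HasVirtualAction U n Φ) (α : Fin m) (a : ℤ) (ha : 0 ≤ a)
    (han : a + C.P α ≤ n) : C.chainOp n α a Φ = Φ := by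
  simp only [h.apply_of_nonneg ha, virtualOp_of_le (le_sub_iff_add_le'.2 han), mul_one]

theorem left (h : C.HasVirtualAction U n Φ) (c : C.Cut) (hn : C.P c.1 ≤ n + C.pos c) :
    C.chainOp n c.1 (-C.pos c) Φ = fun g => U c * Φ g := by
  rw [h.apply_of_add_le (by omega), neg_neg, virtualOp_pos]

theorem right (h : C.HasVirtualAction U n Φ) (c : C.Cut) (hn : C.pos c ≤ n) :
    C.chainOp n c.1 (n - C.pos c) Φ = fun g => Φ g * U c := by
  rw [h.apply_of_nonneg (by omega), sub_sub_cancel, virtualOp_pos]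

theorem smul (h : C.HasVirtualAction U n Φ) (z : ℂ) : C.HasVirtualAction U n (z • Φ) := by
  intro α a
  rw [map_smul, h α a]
  funext g
  simp

theorem sub (h : C.HasVirtualAction U n Φ) (h' : C.HasVirtualAction U n Ψ) :
    C.HasVirtualAction U n (Φ - Ψ) := by
  intro α a
  rw [map_sub, h α a, h' α a]
  funext g
  simp [mul_sub, sub_mul]

theorem concat (hU : ∀ c, U c * U c = 1) (hN : n + k = N) {Ψ : MatrixFamily q D k}
    (h : C.HasVirtualAction U n Φ) (h' : C.HasVirtualAction U k Ψ) :
    C.HasVirtualAction U N (StabMPS.concat hN Φ Ψ) := by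
  intro α a
  rw [C.chainOp_concat, h α a, h' α (a - n)]
  funext g
  have hleft : -(a - n : ℤ) = n - a := by ring
  have hright : (k : ℤ) - (a - n) = N - a := by rw [← hN]; push_cast; ring
  simp only [StabMPS.concat, hleft, hright]
  calc _ = C.virtualOp U α (-a) * Φ (fun i => g ⟨i, by omega⟩) *
        (C.virtualOp U α (n - a) * C.virtualOp U α (n - a)) * Ψ (fun i => g ⟨n + i, by omega⟩) *
          C.virtualOp U α (N - a) := by simp only [mul_assoc]
    _ = _ := by rw [virtualOp_mul_self hU]; simp only [mul_assoc, mul_one]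

theorem ringFixed_trace (hU : ∀ c, U c * U c = 1) (hn : C.maxRange ≤ n)
    (h : C.HasVirtualAction U n Φ) : C.RingFixed n fun g => (Φ g).trace := by
  intro α a _
  have hα := C.P_le_maxRange α
  have hleft := h.apply_of_add_le (α := α) (a := a - n) (by omega)
  have hright := h.apply_of_nonneg (α := α) (a := a) (by omega)
  rw [neg_sub] at hleft
  rw [chainOp] at hleft hright
  rw [chainOp, chainOp, pauliOp_trace, pauliOp_trace, hleft, pauliOp_mul_left, hright]
  funext g
  rw [Matrix.trace_mul_comm, mul_assoc, virtualOp_mul_self hU, mul_one]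

end HasVirtualAction

end Virtual

/-- The algebra homomorphism from the free algebra on the cuts to the operators on `n` cells, given
by the action of the cut terms at the right end. -/
noncomputable def evalRight (n : ℕ) :
    FreeAlgebra ℂ C.Cut →ₐ[ℂ] Module.End ℂ ((Fin n → Spin q) → ℂ) :=
  FreeAlgebra.lift ℂ fun c : C.Cut => C.chainOp n c.1 (n - C.pos c)

theorem evalRight_ι (n : ℕ) (c : C.Cut) :
    C.evalRight n (FreeAlgebra.ι ℂ c) = C.chainOp n c.1 (n - C.pos c) :=
  FreeAlgebra.lift_ι_apply _ _

theorem evalRight_commute {n : ℕ} {A : Module.End ℂ ((Fin n → Spin q) → ℂ)}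
    (h : ∀ c : C.Cut, Commute A (C.chainOp n c.1 (n - C.pos c))) (x : FreeAlgebra ℂ C.Cut) :
    Commute A (C.evalRight n x) := by
  induction x using FreeAlgebra.induction with
  | grade0 r => rw [AlgHom.commutes]; exact Algebra.commute_algebraMap_right r A
  | grade1 c => rw [evalRight_ι]; exact h c
  | mul a b ha hb => rw [map_mul]; exact ha.mul_right hb
  | add a b ha hb => rw [map_add]; exact ha.add_right hb

namespace HasVirtualAction

variable {D n : ℕ} {C} {U : C.Cut → Matrix (Fin D) (Fin D) ℂ} {Φ Ψ : MatrixFamily q D n}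

theorem evalRight_trace_mul (hn : C.maxRange ≤ n) (h : C.HasVirtualAction U n Φ)
    (x : FreeAlgebra ℂ C.Cut) (Y : Matrix (Fin D) (Fin D) ℂ) :
    C.evalRight n x (fun g => (Φ g * Y).trace) =
      fun g => (Φ g * (FreeAlgebra.lift ℂ U x * Y)).trace := by
  induction x using FreeAlgebra.induction generalizing Y with
  | grade0 r =>
    rw [AlgHom.commutes, AlgHom.commutes]
    funext g
    simp [Algebra.algebraMap_eq_smul_one]
  | grade1 c =>
    have hright := h.right c ((C.pos_lt c).le.trans ((C.P_le_maxRange c.1).trans hn))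
    rw [chainOp] at hright
    simp only [evalRight_ι, chainOp, pauliOp_trace_mul, hright, FreeAlgebra.lift_ι_apply, mul_assoc]
  | mul a b ha hb => rw [map_mul, Module.End.mul_apply, hb, ha, map_mul, mul_assoc]
  | add a b ha hb =>
    rw [map_add, LinearMap.add_apply, ha, hb, map_add]
    funext g
    simp [add_mul, mul_add]

theorem evalRight_trace (hn : C.maxRange ≤ n) (h : C.HasVirtualAction U n Φ)
    (x : FreeAlgebra ℂ C.Cut) :
    C.evalRight n x (fun g => (Φ g).trace) = fun g => (Φ g * FreeAlgebra.lift ℂ U x).trace := by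
  simpa only [mul_one] using h.evalRight_trace_mul hn x 1

variable (hU : Algebra.adjoin ℂ (Set.range U) = ⊤)
include hU

theorem eq_zero_of_trace_eq_zero (hn : C.maxRange ≤ n) (h : C.HasVirtualAction U n Φ)
    (h0 : ∀ g, (Φ g).trace = 0) : Φ = 0 := by
  funext g
  refine Matrix.ext_iff_trace_mul_right.2 fun X => ?_
  obtain ⟨x, rfl⟩ := freeAlgebra_lift_surjective hU X
  have htrace := congrFun (h.evalRight_trace hn x) g
  rw [show (fun g => (Φ g).trace) = 0 from funext h0, map_zero] at htrace
  simpa using htrace.symm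

theorem span_eq_top (hn : C.maxRange ≤ n) (h : C.HasVirtualAction U n Φ) (h0 : Φ ≠ 0) :
    Submodule.span ℂ (Set.range Φ) = ⊤ := by
  have hD : Nonempty (Fin D) := by
    by_contra hD
    rw [not_nonempty_iff] at hD
    exact h0 (Subsingleton.elim _ _)
  refine eq_top_of_mul_mem_of_adjoin_eq_top hU ?_ fun hbot => h0 <| funext fun g => ?_
  · rintro _ ⟨c, rfl⟩ y hy
    have hc := (C.P_le_maxRange c.1).trans hn
    have hlt := C.pos_lt c
    induction hy using Submodule.span_induction with
    | mem y hy =>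
      obtain ⟨g, rfl⟩ := hy
      rw [← congrFun (h.left c (by omega)) g, ← congrFun (h.right c (by omega)) g]
      exact ⟨pauliOp_apply_mem_span _ Φ g, pauliOp_apply_mem_span _ Φ g⟩
    | zero => simp
    | add x y _ _ hx hy =>
      rw [mul_add, add_mul]
      exact ⟨add_mem hx.1 hy.1, add_mem hx.2 hy.2⟩
    | smul z x _ hx =>
      rw [mul_smul_comm, smul_mul_assoc]
      exact ⟨Submodule.smul_mem _ _ hx.1, Submodule.smul_mem _ _ hx.2⟩
  · exact (Submodule.mem_bot ℂ).1 (hbot ▸ Submodule.subset_span ⟨g, rfl⟩)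

theorem exists_eq_smul (hUU : ∀ c, U c * U c = 1) (hn : C.maxRange ≤ n)
    (huniq : C.UniqueFixed n) (h : C.HasVirtualAction U n Φ) (h' : C.HasVirtualAction U n Ψ)
    (h0 : Φ ≠ 0) : ∃ z : ℂ, Ψ = z • Φ := by
  obtain ⟨ψ, -, -, hψ⟩ := huniq
  obtain ⟨y, hy⟩ := hψ _ (h.ringFixed_trace hUU hn)
  obtain ⟨z, hz⟩ := hψ _ (h'.ringFixed_trace hUU hn)
  have hy0 : y ≠ 0 := by
    rintro rfl
    exact h0 (h.eq_zero_of_trace_eq_zero hU hn fun g => by simpa using congrFun hy g)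
  refine ⟨z / y, sub_eq_zero.1 <|
    (h'.sub (h.smul (z / y))).eq_zero_of_trace_eq_zero hU hn fun g => ?_⟩
  have hyg : (Φ g).trace = y * ψ g := congrFun hy g
  have hzg : (Ψ g).trace = z * ψ g := congrFun hz g
  rw [Pi.sub_apply, Pi.smul_apply, Matrix.trace_sub, Matrix.trace_smul, hyg, hzg, smul_eq_mul,
    ← mul_assoc, div_mul_cancel₀ z hy0, sub_self]

theorem evalRight_trace_eq_zero_iff (hn : C.maxRange ≤ n) (h : C.HasVirtualAction U n Φ)
    (h0 : Φ ≠ 0) (x : FreeAlgebra ℂ C.Cut) :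
    C.evalRight n x (fun g => (Φ g).trace) = 0 ↔ FreeAlgebra.lift ℂ U x = 0 := by
  rw [h.evalRight_trace hn x]
  refine ⟨fun hx => Matrix.ext_iff_trace_mul_left.2 fun X => ?_, fun hx => ?_⟩
  · have hX : X ∈ Submodule.span ℂ (Set.range Φ) := h.span_eq_top hU hn h0 ▸ Submodule.mem_top
    rw [mul_zero, Matrix.trace_zero]
    induction hX using Submodule.span_induction with
    | mem y hy => obtain ⟨g, rfl⟩ := hy; exact congrFun hx g
    | zero => simp
    | add x y _ _ hx hy => rw [add_mul, Matrix.trace_add, hx, hy, add_zero]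
    | smul c x _ hx => rw [smul_mul_assoc, Matrix.trace_smul, hx, smul_zero]
  · funext g
    simp [hx]

end HasVirtualAction

end Code

theorem exists_invariant_complement {q : ℕ} {κ : Type} [Fintype κ]
    (W : Submodule ℂ ((κ → Spin q) → ℂ)) :
    ∃ W' : Submodule ℂ ((κ → Spin q) → ℂ), IsCompl W W' ∧
      ∀ p : κ → PauliString q, (∀ w ∈ W, pauliOp p w ∈ W) → ∀ w ∈ W', pauliOp p w ∈ W' := by
  classical
  let e := WithLp.linearEquiv 2 ℂ ((κ → Spin q) → ℂ)
  let K : Submodule ℂ (EuclideanSpace ℂ (κ → Spin q)) := W.comap e.toLinearMap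
  have inner_eq (x y : EuclideanSpace ℂ (κ → Spin q)) :
      inner ℂ x y = ∑ g, star (e x g) * e y g := by
    rw [PiLp.inner_apply]
    exact Finset.sum_congr rfl fun g _ => mul_comm _ _
  have hK : (K.map e.toLinearMap) = W := W.map_comap_eq_of_surjective e.surjective
  refine ⟨Kᗮ.map e.toLinearMap, ?_, ?_⟩
  · have := (Submodule.orderIsoMapComap e).isCompl K.isCompl_orthogonal
    rwa [Submodule.orderIsoMapComap_apply, Submodule.orderIsoMapComap_apply, hK] at this
  · rintro p hp _ ⟨w, hw, rfl⟩
    refine ⟨e.symm (pauliOp p (e w)), (K.mem_orthogonal _).2 fun u hu => ?_, e.apply_symm_apply _⟩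
    have hpu : e.symm (pauliOp p (e u)) ∈ K := hp _ hu
    rw [← Submodule.inner_right_of_mem_orthogonal hpu hw, inner_eq, inner_eq,
      e.apply_symm_apply, e.apply_symm_apply, sum_star_pauliOp_mul]

section TraceRepresentation

variable {ι κ : Type} {D : ℕ}

theorem exists_trace_mul_eq (f : Matrix (Fin D) (Fin D) ℂ →ₗ[ℂ] (κ → ℂ)) :
    ∃ Φ : κ → Matrix (Fin D) (Fin D) ℂ, ∀ X, f X = fun g => (Φ g * X).trace := by
  refine ⟨fun g => Matrix.of fun i j => f (Matrix.single j i 1) g, fun X => funext fun g => ?_⟩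
  have hsingle (i j : Fin D) :
      f (Matrix.single i j (X i j)) g = X i j * f (Matrix.single i j 1) g := by
    rw [← smul_eq_mul, ← Pi.smul_apply, ← map_smul, Matrix.smul_single, smul_eq_mul, mul_one]
  rw [Matrix.matrix_eq_sum_single X]
  conv_rhs => rw [← Matrix.matrix_eq_sum_single X]
  simp only [map_sum, Finset.sum_apply, hsingle, Matrix.trace, Matrix.diag_apply, Matrix.mul_apply,
    Matrix.of_apply]
  rw [Finset.sum_comm]
  exact Finset.sum_congr rfl fun _ _ => Finset.sum_congr rfl fun _ _ => mul_comm _ _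

theorem exists_trace_mul_lift_eq {U : ι → Matrix (Fin D) (Fin D) ℂ}
    (hU : Algebra.adjoin ℂ (Set.range U) = ⊤) (F : FreeAlgebra ℂ ι →ₗ[ℂ] (κ → ℂ))
    (hF : ∀ x, FreeAlgebra.lift ℂ U x = 0 → F x = 0) :
    ∃ Φ : κ → Matrix (Fin D) (Fin D) ℂ,
      ∀ x, F x = fun g => (Φ g * FreeAlgebra.lift ℂ U x).trace := by
  obtain ⟨s, hs⟩ := (FreeAlgebra.lift ℂ U).toLinearMap.exists_rightInverse_of_surjective
    (LinearMap.range_eq_top.2 (freeAlgebra_lift_surjective hU))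
  have hs' (X) : FreeAlgebra.lift ℂ U (s X) = X := LinearMap.congr_fun hs X
  obtain ⟨Φ, hΦ⟩ := exists_trace_mul_eq (F ∘ₗ s)
  refine ⟨Φ, fun x => ?_⟩
  rw [← hΦ, LinearMap.comp_apply, ← sub_eq_zero, ← map_sub]
  exact hF _ (by rw [map_sub, hs', sub_self])

end TraceRepresentation

section Intertwiner

variable {ι V : Type} [AddCommGroup V] [Module ℂ V] {D : ℕ} {A : ι → Module.End ℂ V}
  {U : ι → Matrix (Fin D) (Fin D) ℂ} {j : (Fin D → ℂ) →ₗ[ℂ] V}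

theorem freeAlgebra_lift_apply_of_intertwines (h : ∀ i v, A i (j v) = j ((U i).mulVec v))
    (x : FreeAlgebra ℂ ι) (v : Fin D → ℂ) :
    FreeAlgebra.lift ℂ A x (j v) = j ((FreeAlgebra.lift ℂ U x).mulVec v) := by
  induction x using FreeAlgebra.induction generalizing v with
  | grade0 r =>
    rw [AlgHom.commutes, AlgHom.commutes, Module.algebraMap_end_apply,
      Algebra.algebraMap_eq_smul_one, Matrix.smul_mulVec, Matrix.one_mulVec, map_smul]
  | grade1 i => rw [FreeAlgebra.lift_ι_apply, FreeAlgebra.lift_ι_apply, h]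
  | mul a b ha hb => rw [map_mul, Module.End.mul_apply, hb, ha, map_mul, Matrix.mulVec_mulVec]
  | add a b ha hb => rw [map_add, LinearMap.add_apply, ha, hb, map_add, Matrix.add_mulVec, map_add]

theorem CliffordRel.of_intertwines {t : Matrix ι ι (ZMod 2)} (hA : CliffordRel t A)
    (hj : Function.Injective j) (h : ∀ i v, A i (j v) = j ((U i).mulVec v)) :
    CliffordRel t U := by
  refine (cliffordRel_iff ℂ t U).2 fun i k => Matrix.ext_of_mulVec_single fun a => hj ?_
  have hrel := LinearMap.congr_fun ((cliffordRel_iff ℂ t A).1 hA i k) (j (Pi.single a 1))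
  simp only [Module.End.mul_apply, LinearMap.smul_apply, h] at hrel
  rw [← Matrix.mulVec_mulVec, hrel, Matrix.smul_mulVec, ← Matrix.mulVec_mulVec, map_smul]

end Intertwiner

namespace Code

variable {q m : ℕ} {C : Code q m} {n : ℕ} {ψ : (Fin n → Spin q) → ℂ}

theorem bulk_commute (hcomm : ∀ᶠ L : ℕ in atTop, ∀ [NeZero L], C.Commuting L)
    {α : Fin m} {a : ℤ} (ha : 0 ≤ a) (han : a + C.P α ≤ n) (β : Fin m) (b : ℤ) :
    Commute (C.chainOp n α a : Module.End ℂ ((Fin n → Spin q) → ℂ)) (C.chainOp n β b) :=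
  C.chainOp_commute (overlap_eq_zero_of_bulk hcomm ha han β b)

theorem left_commute_evalRight (hn : 2 * C.maxRange ≤ n) (c : C.Cut) (x : FreeAlgebra ℂ C.Cut) :
    Commute (C.chainOp n c.1 (-C.pos c)) (C.evalRight n x) :=
  C.evalRight_commute (fun d => (C.chainOp_commute (C.overlap_left_right d c hn)).symm) x

theorem right_evalRight (c : C.Cut) (x : FreeAlgebra ℂ C.Cut) (φ : (Fin n → Spin q) → ℂ) :
    C.chainOp n c.1 (n - C.pos c) (C.evalRight n x φ) =
      C.evalRight n (FreeAlgebra.ι ℂ c * x) φ := by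
  rw [map_mul, evalRight_ι, Module.End.mul_apply]

theorem evalRight_mem {W : Submodule ℂ ((Fin n → Spin q) → ℂ)}
    (hW : ∀ c : C.Cut, ∀ w ∈ W, C.chainOp n c.1 (n - C.pos c) w ∈ W) (x : FreeAlgebra ℂ C.Cut)
    {w : (Fin n → Spin q) → ℂ} (hw : w ∈ W) : C.evalRight n x w ∈ W := by
  induction x using FreeAlgebra.induction generalizing w with
  | grade0 r => rw [AlgHom.commutes, Module.algebraMap_end_apply]; exact W.smul_mem r hw
  | grade1 c => rw [evalRight_ι]; exact hW c w hw
  | mul a b ha hb => rw [map_mul]; exact ha (hb hw)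
  | add a b ha hb => rw [map_add]; exact add_mem (ha hw) (hb hw)

namespace RingFixed

theorem bulk (h : C.RingFixed n ψ) {α : Fin m} {a : ℤ} (ha : 0 ≤ a) (han : a + C.P α ≤ n) :
    C.chainOp n α a ψ = ψ := by
  have := C.P_pos α
  obtain ⟨b, rfl⟩ := Int.eq_ofNat_of_zero_le ha
  have hfixed := h α b (by omega)
  rwa [C.chainOp_of_add_le (a := b - n) (by omega), Module.End.one_apply] at hfixed

theorem left_eq_right (hn : C.maxRange ≤ n) (h : C.RingFixed n ψ) (c : C.Cut) :
    C.chainOp n c.1 (-C.pos c) ψ = C.chainOp n c.1 (n - C.pos c) ψ := by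
  have := C.pos_lt c
  have := C.pos_pos c
  have := C.P_le_maxRange c.1
  have hfixed := h c.1 (n - C.pos c) (by omega)
  rw [Nat.cast_sub (by omega), sub_sub_cancel_left] at hfixed
  rw [← C.chainOp_chainOp c.1 (n - C.pos c) (C.chainOp n c.1 (-C.pos c) ψ), hfixed]

theorem bulk_evalRight (hcomm : ∀ᶠ L : ℕ in atTop, ∀ [NeZero L], C.Commuting L)
    (h : C.RingFixed n ψ) {α : Fin m} {a : ℤ} (ha : 0 ≤ a) (han : a + C.P α ≤ n)
    (x : FreeAlgebra ℂ C.Cut) : C.chainOp n α a (C.evalRight n x ψ) = C.evalRight n x ψ := by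
  have := C.evalRight_commute (fun c => bulk_commute hcomm ha han c.1 (n - C.pos c)) x
  rw [← Module.End.mul_apply, this.eq, Module.End.mul_apply, h.bulk ha han]

theorem left_evalRight (hn : 2 * C.maxRange ≤ n) (h : C.RingFixed n ψ) (c : C.Cut)
    (x : FreeAlgebra ℂ C.Cut) :
    C.chainOp n c.1 (-C.pos c) (C.evalRight n x ψ) =
      C.evalRight n (x * FreeAlgebra.ι ℂ c) ψ := by
  rw [← Module.End.mul_apply, (left_commute_evalRight hn c x).eq, Module.End.mul_apply,
    h.left_eq_right (by omega), map_mul, evalRight_ι, Module.End.mul_apply]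

theorem mem_or_mem_of_isCompl (h : C.RingFixed n ψ)
    (huniq : ∀ φ, C.RingFixed n φ → ∃ z : ℂ, φ = z • ψ)
    {W W' : Submodule ℂ ((Fin n → Spin q) → ℂ)} (hcompl : IsCompl W W')
    (hW : ∀ α a, ∀ w ∈ W, C.chainOp n α a w ∈ W) (hW' : ∀ α a, ∀ w ∈ W', C.chainOp n α a w ∈ W') :
    ψ ∈ W ∨ ψ ∈ W' := by
  obtain ⟨w, hw, w', hw', rfl⟩ :=
    Submodule.mem_sup.1 (hcompl.sup_eq_top ▸ Submodule.mem_top : ψ ∈ W ⊔ W')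
  have hfixed : C.RingFixed n w := fun α a ha => by
    have hsum := h α a ha
    rw [map_add, map_add] at hsum
    refine sub_eq_zero.1 (Submodule.disjoint_def.1 hcompl.disjoint _
      (sub_mem (hW _ _ _ (hW _ _ _ hw)) hw) ?_)
    rw [sub_eq_sub_iff_add_eq_add.2 (hsum.trans (add_comm w w'))]
    exact sub_mem hw' (hW' _ _ _ (hW' _ _ _ hw'))
  obtain ⟨z, hz⟩ := huniq w hfixed
  obtain rfl | hz0 := eq_or_ne z 0
  · rw [zero_smul] at hz
    exact Or.inr (by rwa [hz, zero_add])
  · exact Or.inl ((W.smul_mem_iff hz0).1 (hz ▸ hw))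

end RingFixed

section VirtualRelations

variable (hcomm : ∀ᶠ L : ℕ in atTop, ∀ [NeZero L], C.Commuting L)
  (hn : 2 * C.maxRange ≤ n) {D : ℕ}
include hcomm hn

theorem exists_hasVirtualAction_of_relations {U : C.Cut → Matrix (Fin D) (Fin D) ℂ}
    (hU : Algebra.adjoin ℂ (Set.range U) = ⊤) (hψ : C.RingFixed n ψ)
    (hrel : ∀ x, FreeAlgebra.lift ℂ U x = 0 → C.evalRight n x ψ = 0) :
    ∃ Φ, C.HasVirtualAction U n Φ ∧ ∀ g, (Φ g).trace = ψ g := by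
  obtain ⟨Φ, hΦ⟩ := exists_trace_mul_lift_eq hU
    ((LinearMap.applyₗ ψ).comp (C.evalRight n).toLinearMap) hrel
  replace hΦ (x) : C.evalRight n x ψ = fun g => (Φ g * FreeAlgebra.lift ℂ U x).trace := hΦ x
  have chainOp_eq {A : MatrixFamily q D n} {α : Fin m} {a : ℤ}
      (h : ∀ x, C.chainOp n α a (C.evalRight n x ψ) =
        fun g => (A g * FreeAlgebra.lift ℂ U x).trace) : C.chainOp n α a Φ = A := by
    refine funext fun g => Matrix.ext_iff_trace_mul_right.2 fun X => ?_
    obtain ⟨x, rfl⟩ := freeAlgebra_lift_surjective hU X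
    rw [← congrFun (h x) g, hΦ, chainOp, chainOp, pauliOp_trace_mul]
  refine ⟨Φ, hasVirtualAction_of_cuts (by omega)
    (fun α a ha han => chainOp_eq fun x => ?_) (fun c => chainOp_eq fun x => ?_)
    (fun c => chainOp_eq fun x => ?_), fun g => ?_⟩
  · rw [hψ.bulk_evalRight hcomm ha han, hΦ]
  · rw [hψ.left_evalRight hn, hΦ, map_mul, FreeAlgebra.lift_ι_apply]
    funext g
    rw [← mul_assoc, Matrix.trace_mul_comm, ← mul_assoc]
  · rw [right_evalRight, hΦ, map_mul, FreeAlgebra.lift_ι_apply]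
    simp only [mul_assoc]
  · simpa using (congrFun (hΦ 1) g).symm

omit hcomm hn in
variable (n) in
/-- The states fixed by the terms inside the interval and annihilated, through the action of the
cut terms at the right end, by all the relations between the matrices `U c`. -/
noncomputable def relationSpace (U : C.Cut → Matrix (Fin D) (Fin D) ℂ) :
    Submodule ℂ ((Fin n → Spin q) → ℂ) where
  carrier := {φ | (∀ (α : Fin m) (a : ℤ), 0 ≤ a → a + C.P α ≤ n → C.chainOp n α a φ = φ) ∧
    ∀ x, FreeAlgebra.lift ℂ U x = 0 → C.evalRight n x φ = 0}
  add_mem' h h' := ⟨fun α a ha han => by rw [map_add, h.1 α a ha han, h'.1 α a ha han],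
    fun x hx => by rw [map_add, h.2 x hx, h'.2 x hx, add_zero]⟩
  zero_mem' := ⟨fun _ _ _ _ => map_zero _, fun _ _ => map_zero _⟩
  smul_mem' z φ h := ⟨fun α a ha han => by rw [map_smul, h.1 α a ha han],
    fun x hx => by rw [map_smul, h.2 x hx, smul_zero]⟩

theorem chainOp_mem_relationSpace {U : C.Cut → Matrix (Fin D) (Fin D) ℂ} (β : Fin m) (b : ℤ)
    {φ : (Fin n → Spin q) → ℂ} (hφ : φ ∈ relationSpace n U) :
    C.chainOp n β b φ ∈ relationSpace n U := by
  have hbulk (α : Fin m) (a : ℤ) (ha : 0 ≤ a) (han : a + C.P α ≤ n) :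
      C.chainOp n α a (C.chainOp n β b φ) = C.chainOp n β b φ := by
    rw [← Module.End.mul_apply, (bulk_commute hcomm ha han β b).eq, Module.End.mul_apply,
      hφ.1 α a ha han]
  rcases C.position_cases n β b with (h | h) | ⟨h, h'⟩ | ⟨c, rfl, rfl⟩ | ⟨c, rfl, rfl⟩
  · rwa [C.chainOp_of_add_le h]
  · rwa [C.chainOp_of_le h]
  · rwa [hφ.1 β b h h']
  · refine ⟨hbulk, fun x hx => ?_⟩
    rw [← Module.End.mul_apply, ← (left_commute_evalRight hn c x).eq, Module.End.mul_apply,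
      hφ.2 x hx, map_zero]
  · refine ⟨hbulk, fun x hx => ?_⟩
    rw [← evalRight_ι, ← Module.End.mul_apply, ← map_mul]
    exact hφ.2 _ (by rw [map_mul, hx, zero_mul])

/-- The operators that cut terms induce at the right end of the ground state act on the space they
generate from it; the virtual operators are an irreducible summand of this action. That their
relations annihilate the ground state follows from uniqueness: otherwise `relationSpace` and an
invariant complement of it would both contain a part of the ground state. -/
theorem exists_virtual_relations (hψ0 : ψ ≠ 0) (hψ : C.RingFixed n ψ)
    (huniq : ∀ φ, C.RingFixed n φ → ∃ z : ℂ, φ = z • ψ) :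
    ∃ (D : ℕ) (U : C.Cut → (Matrix (Fin D) (Fin D) ℂ)ˣ), IsIrreducible U ∧
      IsCliffordRep C.tMatrix U ∧ (∀ c, (U c : Matrix (Fin D) (Fin D) ℂ) * U c = 1) ∧
      ∀ x, FreeAlgebra.lift ℂ (fun c => (U c : Matrix (Fin D) (Fin D) ℂ)) x = 0 →
        C.evalRight n x ψ = 0 := by
  let W₀ := LinearMap.range ((LinearMap.applyₗ ψ).comp (C.evalRight n).toLinearMap)
  have hψW₀ : ψ ∈ W₀ := ⟨1, by simp⟩
  obtain ⟨D, U, j, hirr, hUU, hj, hjW, hjU⟩ := exists_irreducible_rep_of_involutions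
    (A := fun c : C.Cut => (C.chainOp n c.1 (n - C.pos c) : Module.End ℂ ((Fin n → Spin q) → ℂ)))
    (fun c => C.chainOp_mul_self _ _) (Submodule.ne_bot_iff W₀ |>.2 ⟨ψ, hψW₀, hψ0⟩)
    (by rintro c _ ⟨x, rfl⟩; exact ⟨FreeAlgebra.ι ℂ c * x, (right_evalRight c x ψ).symm⟩)
  have hjmem (v) : j v ∈ relationSpace n fun c => (U c : Matrix (Fin D) (Fin D) ℂ) := by
    refine ⟨fun α a ha han => ?_, fun x hx => ?_⟩
    · obtain ⟨x, hx⟩ := hjW v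
      exact hx ▸ hψ.bulk_evalRight hcomm ha han x
    · exact (freeAlgebra_lift_apply_of_intertwines hjU x v).trans (by simp [hx])
  refine ⟨D, U, hirr, (C.cliffordRel_chainOp_left (by omega)).of_intertwines hj hjU, hUU, ?_⟩
  obtain ⟨W', hcompl, hinv⟩ := exists_invariant_complement
    (relationSpace n fun c => (U c : Matrix (Fin D) (Fin D) ℂ))
  have hW' (α a) : ∀ w ∈ W', C.chainOp n α a w ∈ W' :=
    hinv _ fun w => chainOp_mem_relationSpace hcomm hn α a
  refine ((hψ.mem_or_mem_of_isCompl huniq hcompl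
    (fun α a w => chainOp_mem_relationSpace hcomm hn α a) hW').resolve_right fun hψW' => ?_).2
  have hj0 (v) : j v = 0 := by
    obtain ⟨x, hx⟩ := hjW v
    exact Submodule.disjoint_def.1 hcompl.disjoint _ (hjmem v)
      (hx ▸ evalRight_mem (fun c => hW' _ _) x hψW')
  have : (1 : Fin D → ℂ) = 0 := hj ((hj0 1).trans (map_zero j).symm)
  exact one_ne_zero (congrFun this ⟨0, hirr.1⟩)

end VirtualRelations

end Code

section Concat

variable {q D : ℕ}

theorem concat_assoc {n₁ n₂ n₃ n₁₂ n₂₃ N : ℕ} (h₁₂ : n₁ + n₂ = n₁₂) (h : n₁₂ + n₃ = N)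
    (h₂₃ : n₂ + n₃ = n₂₃) (h' : n₁ + n₂₃ = N) (A : MatrixFamily q D n₁) (B : MatrixFamily q D n₂)
    (E : MatrixFamily q D n₃) :
    concat h (concat h₁₂ A B) E = concat h' A (concat h₂₃ B E) := by
  subst h₁₂ h₂₃ h
  funext g
  simp only [concat, mul_assoc, add_assoc]

variable {n k N : ℕ} (h : n + k = N)

theorem smul_concat (z : ℂ) (A : MatrixFamily q D n) (B : MatrixFamily q D k) :
    concat h (z • A) B = z • concat h A B := by
  funext g
  simp [concat]

theorem concat_smul (z : ℂ) (A : MatrixFamily q D n) (B : MatrixFamily q D k) :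
    concat h A (z • B) = z • concat h A B := by
  funext g
  simp [concat]

theorem concat_append (A : MatrixFamily q D n) (B : MatrixFamily q D k) (g : Fin n → Spin q)
    (u : Fin k → Spin q) : concat h A B (Fin.append g u ∘ Fin.cast h.symm) = A g * B u := by
  rw [concat]
  congr 2
  · funext i; exact Fin.append_left g u i
  · funext i; exact Fin.append_right g u i

theorem concat_left_cancel {A : MatrixFamily q D n} {B E : MatrixFamily q D k}
    (hA : Submodule.span ℂ (Set.range A) = ⊤) (heq : concat h A B = concat h A E) : B = E := by
  funext u
  obtain ⟨a, ha⟩ := (Submodule.mem_span_range_iff_exists_fun ℂ).1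
    (hA ▸ Submodule.mem_top : (1 : Matrix (Fin D) (Fin D) ℂ) ∈ _)
  have hmul (g : Fin n → Spin q) : A g * B u = A g * E u := by
    rw [← concat_append h, heq, concat_append]
  rw [← one_mul (B u), ← one_mul (E u), ← ha]
  simp only [Finset.sum_mul, smul_mul_assoc, hmul]

theorem concat_right_cancel {A B : MatrixFamily q D n} {E : MatrixFamily q D k}
    (hE : Submodule.span ℂ (Set.range E) = ⊤) (heq : concat h A E = concat h B E) : A = B := by
  funext g
  obtain ⟨a, ha⟩ := (Submodule.mem_span_range_iff_exists_fun ℂ).1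
    (hE ▸ Submodule.mem_top : (1 : Matrix (Fin D) (Fin D) ℂ) ∈ _)
  have hmul (u : Fin k → Spin q) : A g * E u = B g * E u := by
    rw [← concat_append h, heq, concat_append]
  rw [← mul_one (A g), ← mul_one (B g), ← ha]
  simp only [Finset.mul_sum, mul_smul_comm, hmul]

theorem concat_ne_zero {A : MatrixFamily q D n} {B : MatrixFamily q D k} (hA : A ≠ 0)
    (hB : Submodule.span ℂ (Set.range B) = ⊤) : concat h A B ≠ 0 := fun h0 =>
  hA <| concat_right_cancel h hB <| h0.trans <| by
    simpa only [zero_smul] using (smul_concat h 0 0 B).symm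

/-- If `1 = ∑ a g • Φ g`, then the quotient of `Ψ` by `Φ` is `S u = z • ∑ a g • Ψ (g, u)`. -/
theorem exists_concat_eq_of_concat_comm {p M : ℕ} {Φ : MatrixFamily q D n} {Ψ : MatrixFamily q D N}
    (hΦ : Submodule.span ℂ (Set.range Φ) = ⊤) (hNM : n + N = M) (hNM' : N + n = M)
    (hp : n + p = N) (hp' : p + n = N) {z : ℂ} (hcomm : concat hNM Φ Ψ = z • concat hNM' Ψ Φ) :
    ∃ S : MatrixFamily q D p, concat hp' S Φ = Ψ ∧ concat hp Φ S = z • Ψ := by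
  obtain ⟨a, ha⟩ := (Submodule.mem_span_range_iff_exists_fun ℂ).1
    (hΦ ▸ Submodule.mem_top : (1 : Matrix (Fin D) (Fin D) ℂ) ∈ _)
  let S : MatrixFamily q D p := fun u => ∑ g, a g • z • Ψ (Fin.append g u ∘ Fin.cast hp.symm)
  have hexchange (g : Fin n → Spin q) (w : Fin N → Spin q) :
      z • Ψ (Fin.append g (fun i : Fin p => w ⟨i, by omega⟩) ∘ Fin.cast hp.symm) *
        Φ (fun i => w ⟨p + i, by omega⟩) = Φ g * Ψ w := by
    rw [← concat_append hNM, hcomm, Pi.smul_apply, smul_mul_assoc, concat]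
    subst hp hNM
    congr 3
    · funext i
      refine Fin.addCases (fun j => ?_) (fun j => ?_) i
      · exact (Fin.append_left _ _ j).trans (Fin.append_left g w j).symm
      · exact (Fin.append_right _ _ j).trans (Fin.append_right g w ⟨j, by omega⟩).symm
    · funext i
      refine (Fin.append_right g w ⟨p + i, by omega⟩).symm.trans (congrArg (Fin.append g w) ?_)
      ext
      simp [add_assoc]
  have hS : concat hp' S Φ = Ψ := by
    funext w
    rw [concat, Finset.sum_mul]
    calc _ = ∑ g, a g • (Φ g * Ψ w) :=
          Finset.sum_congr rfl fun g _ => by rw [smul_mul_assoc, hexchange]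
      _ = Ψ w := by simp only [← smul_mul_assoc, ← Finset.sum_mul, ha, one_mul]
  refine ⟨S, hS, concat_right_cancel hNM' hΦ ?_⟩
  rw [smul_concat, ← hcomm, concat_assoc hp hNM' hp' hNM, hS]

end Concat

namespace Tensor

variable {q D : ℕ} (T : Tensor q D)

theorem block_zero (g : Fin 0 → Spin q) : T.block 0 g = 1 := by simp [block]

theorem block_one (g : Fin 1 → Spin q) : T.block 1 g = T (g 0) := by simp [block]

theorem block_add {n k N : ℕ} (h : n + k = N) : T.block N = concat h (T.block n) (T.block k) := by
  subst h
  funext g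
  have hsplit : (fun i => T (g i)) = Fin.append (fun i : Fin n => T (g ⟨i, by omega⟩))
      (fun i : Fin k => T (g ⟨n + i, by omega⟩)) := by
    rw [← Fin.append_castAdd_natAdd (f := fun i => T (g i))]
    rfl
  rw [block, hsplit, List.ofFn_fin_append, List.prod_append]
  rfl

theorem concat_block_eq_smul {n : ℕ} {Φ : MatrixFamily q D n} {z : ℂ}
    (h : concat rfl Φ (T.block 1) = z • concat (Nat.add_comm 1 n) (T.block 1) Φ) (k : ℕ) :
    concat rfl Φ (T.block k) = z ^ k • concat (Nat.add_comm k n) (T.block k) Φ := by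
  induction k with
  | zero =>
    funext g
    simp only [concat, T.block_zero, pow_zero, one_smul, mul_one, one_mul, zero_add]
  | succ k ih =>
    rw [T.block_add (n := k) (k := 1) rfl,
      ← concat_assoc rfl rfl rfl rfl, ih, smul_concat,
      concat_assoc (Nat.add_comm k n) _ rfl (by omega), h, concat_smul, smul_smul, ← pow_succ,
      ← concat_assoc rfl]

theorem block_ne_zero {n : ℕ} {Φ : MatrixFamily q D n} (hΦ : Φ ≠ 0)
    (hspan : Submodule.span ℂ (Set.range (concat (Nat.add_comm 1 n) (T.block 1) Φ)) = ⊤) (k : ℕ) :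
    T.block k ≠ 0 := by
  induction k with
  | zero =>
    refine fun h0 => hΦ (funext fun g => ?_)
    rw [← one_mul (Φ g), ← T.block_zero 0, h0, Pi.zero_apply, zero_mul, Pi.zero_apply]
  | succ k ih =>
    refine fun h0 => concat_ne_zero (N := k + (n + 1)) rfl ih hspan ?_
    rw [← concat_assoc rfl (by omega), ← T.block_add, h0]
    funext g
    simp [concat]

theorem relabel_mps (L : ℕ) [NeZero L] :
    relabel q ℂ (Code.ringLabel L 0) (T.mps L) = fun g => (T.block L g).trace := by
  funext g
  rw [relabel_apply, mps, block]
  simp only [bind_pure_comp, List.map_eq_map, List.map_map]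
  congr 2
  apply List.ext_getElem
  · simp
  · intro i h1 h2
    simp only [List.length_map, List.length_range] at h1
    simp only [List.getElem_map, List.getElem_range, List.getElem_ofFn, Function.comp_apply]
    congr 2
    ext
    simp [Code.ringLabel, ZMod.val_natCast, Nat.mod_eq_of_lt h1]

end Tensor

namespace Code

variable {q m : ℕ} {C : Code q m}

theorem eventually_uniqueFixed
    (huniq : ∀ᶠ L : ℕ in atTop, ∀ [NeZero L], C.HasUniqueGroundState L) :
    ∀ᶠ n : ℕ in atTop, C.UniqueFixed n := by
  filter_upwards [huniq, eventually_ge_atTop C.maxRange, eventually_gt_atTop 0] with n h hn hn0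
  have : NeZero n := ⟨hn0.ne'⟩
  exact HasUniqueGroundState.uniqueFixed hn h

namespace HasVirtualAction

variable {D n : ℕ} {U : C.Cut → Matrix (Fin D) (Fin D) ℂ} {Φ : MatrixFamily q D n}

theorem exists_mul (hU : Algebra.adjoin ℂ (Set.range U) = ⊤) (hUU : ∀ c, U c * U c = 1)
    (hn : C.maxRange ≤ n) (h : C.HasVirtualAction U n Φ) (h0 : Φ ≠ 0) {k : ℕ} (hk : 0 < k) :
    ∃ Ψ, C.HasVirtualAction U (n * k) Ψ ∧ Ψ ≠ 0 := by
  induction k, hk using Nat.le_induction with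
  | base => rw [Nat.succ_eq_add_one, zero_add, mul_one]; exact ⟨Φ, h, h0⟩
  | succ k _ ih =>
    obtain ⟨Ψ, hΨ, hΨ0⟩ := ih
    exact ⟨_, hΨ.concat hUU (Nat.mul_succ n k).symm h,
      concat_ne_zero _ hΨ0 (h.span_eq_top hU hn h0)⟩

theorem evalRight_eq_zero_iff (hU : Algebra.adjoin ℂ (Set.range U) = ⊤)
    (hUU : ∀ c, U c * U c = 1) (hn : C.maxRange ≤ n) (h : C.HasVirtualAction U n Φ) (h0 : Φ ≠ 0)
    {ψ : (Fin n → Spin q) → ℂ} (huniq : ∀ φ, C.RingFixed n φ → ∃ z : ℂ, φ = z • ψ)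
    (x : FreeAlgebra ℂ C.Cut) : C.evalRight n x ψ = 0 ↔ FreeAlgebra.lift ℂ U x = 0 := by
  obtain ⟨z, hz⟩ := huniq _ (h.ringFixed_trace hUU hn)
  have hz0 : z ≠ 0 := by
    rintro rfl
    exact h0 (h.eq_zero_of_trace_eq_zero hU hn fun g => by simpa using congrFun hz g)
  rw [← h.evalRight_trace_eq_zero_iff hU hn h0 x, hz, map_smul, smul_eq_zero, or_iff_right hz0]

theorem of_concat (hn : C.maxRange ≤ n) {k N : ℕ} {Ψ : MatrixFamily q D k}
    (hΨ : Submodule.span ℂ (Set.range Ψ) = ⊤) (hN : n + k = N) (hN' : k + n = N)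
    (h : C.HasVirtualAction U N (StabMPS.concat hN Φ Ψ))
    (h' : C.HasVirtualAction U N (StabMPS.concat hN' Ψ Φ)) : C.HasVirtualAction U n Φ := by
  have hleft {α : Fin m} {a : ℤ} (ha : a + C.P α ≤ n) :
      StabMPS.concat hN (C.chainOp n α a Φ) Ψ = C.chainOp N α a (StabMPS.concat hN Φ Ψ) := by
    rw [C.chainOp_concat, C.chainOp_of_add_le (a := a - n) (by omega), Module.End.one_apply]
  refine hasVirtualAction_of_cuts hn (fun α a ha han => ?_) (fun c => ?_) fun c => ?_
  · exact concat_right_cancel hN hΨ ((hleft han).trans (h.bulk α a ha (by omega)))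
  · have hc := C.P_le_maxRange c.1
    refine concat_right_cancel hN hΨ ((hleft (by omega)).trans ((h.left c (by omega)).trans ?_))
    funext g
    simp only [StabMPS.concat, mul_assoc]
  · have hc := C.P_le_maxRange c.1
    have := C.pos_lt c
    refine concat_left_cancel hN' hΨ ?_
    have hsub : (n - C.pos c : ℤ) = (N - C.pos c : ℤ) - k := by omega
    calc StabMPS.concat hN' Ψ (C.chainOp n c.1 (n - C.pos c) Φ)
        = C.chainOp N c.1 (N - C.pos c) (StabMPS.concat hN' Ψ Φ) := by
          rw [C.chainOp_concat, C.chainOp_of_le (a := (N - C.pos c : ℤ)) (by omega), hsub,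
            Module.End.one_apply]
      _ = _ := by
          rw [h'.right c (by omega)]
          funext g
          simp only [StabMPS.concat, mul_assoc]

theorem concat_of_concat_comm (hn : C.maxRange ≤ n) (h : C.HasVirtualAction U n Φ)
    {S : MatrixFamily q D 1} {z : ℂ}
    (hS : StabMPS.concat rfl Φ S = z • StabMPS.concat (Nat.add_comm 1 n) S Φ) :
    C.HasVirtualAction U (n + 1) (StabMPS.concat rfl Φ S) := by
  have hleft {α : Fin m} {a : ℤ} (ha : a + C.P α ≤ n) :
      C.chainOp (n + 1) α a (StabMPS.concat rfl Φ S) =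
        StabMPS.concat rfl (C.chainOp n α a Φ) S := by
    rw [C.chainOp_concat, C.chainOp_of_add_le (a := a - n) (by omega), Module.End.one_apply]
  have hright {α : Fin m} {a : ℤ} (ha : 1 ≤ a) : C.chainOp (n + 1) α a (StabMPS.concat rfl Φ S) =
        z • StabMPS.concat (Nat.add_comm 1 n) S (C.chainOp n α (a - 1) Φ) := by
    rw [hS, map_smul, C.chainOp_concat, C.chainOp_of_le (by simpa using ha), Module.End.one_apply,
      Nat.cast_one]
  refine hasVirtualAction_of_cuts (by omega) (fun α a ha han => ?_) (fun c => ?_) fun c => ?_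
  · have hα := C.P_le_maxRange α
    by_cases han' : a + C.P α ≤ n
    · rw [hleft han', h.bulk α a ha han']
    · rw [hright (by omega), h.bulk α (a - 1) (by omega) (by omega), hS]
  · have hc := C.P_le_maxRange c.1
    rw [hleft (by omega), h.left c (by omega)]
    funext g
    simp only [StabMPS.concat, mul_assoc]
  · have hc := C.P_le_maxRange c.1
    have := C.pos_lt c
    have hsub : ((n + 1 : ℕ) - C.pos c : ℤ) - 1 = n - C.pos c := by omega
    rw [hright (by omega), hsub, h.right c (by omega), hS]
    funext g
    simp only [StabMPS.concat, Pi.smul_apply, smul_mul_assoc, mul_assoc]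

theorem concat_block {T : Tensor q D} {z : ℂ} (hn : C.maxRange ≤ n) (h : C.HasVirtualAction U n Φ)
    (hT : StabMPS.concat rfl Φ (T.block 1) =
      z • StabMPS.concat (Nat.add_comm 1 n) (T.block 1) Φ) (k : ℕ) :
    C.HasVirtualAction U (n + k) (StabMPS.concat rfl Φ (T.block k)) := by
  induction k with
  | zero =>
    have hzero : StabMPS.concat rfl Φ (T.block 0) = Φ :=
      funext fun g => by rw [StabMPS.concat, T.block_zero, mul_one]; rfl
    exact hzero.symm ▸ h
  | succ k ih =>
    rw [T.block_add (n := k) (k := 1) rfl, ← concat_assoc rfl rfl rfl rfl]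
    refine ih.concat_of_concat_comm (by omega) (z := z) ?_
    rw [concat_assoc rfl rfl rfl rfl, ← T.block_add, T.concat_block_eq_smul hT,
      T.concat_block_eq_smul hT, concat_smul, smul_smul, ← pow_succ',
      T.block_add (Nat.add_comm 1 k), concat_assoc]

variable (hU : Algebra.adjoin ℂ (Set.range U) = ⊤) (hUU : ∀ c, U c * U c = 1)
include hU hUU

/-- The families on `n` and `n + 1` cells commute up to a scalar by uniqueness; `T` is their
quotient. -/
theorem exists_tensor (hn : C.maxRange ≤ n) (huniq : C.UniqueFixed (n + (n + 1)))
    (hΦ : C.HasVirtualAction U n Φ) (hΦ0 : Φ ≠ 0) {Ψ : MatrixFamily q D (n + 1)}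
    (hΨ : C.HasVirtualAction U (n + 1) Ψ) (hΨ0 : Ψ ≠ 0) :
    ∃ T : Tensor q D, ∀ k, C.maxRange ≤ k → C.HasVirtualAction U k (T.block k) ∧ T.block k ≠ 0 := by
  have hΦspan := hΦ.span_eq_top hU hn hΦ0
  have hΨspan := hΨ.span_eq_top hU (by omega) hΨ0
  have hlen : (n + 1) + n = n + (n + 1) := by omega
  have hΨΦ0 := concat_ne_zero hlen hΨ0 hΦspan
  obtain ⟨z, hz⟩ := (hΨ.concat hUU hlen hΦ).exists_eq_smul hU hUU (by omega) huniq
    (hΦ.concat hUU rfl hΨ) hΨΦ0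
  have hz0 : z ≠ 0 := by
    rintro rfl
    exact concat_ne_zero rfl hΦ0 hΨspan (by rw [hz, zero_smul])
  obtain ⟨S, hSΦ, hΦS⟩ :=
    exists_concat_eq_of_concat_comm hΦspan rfl hlen rfl (Nat.add_comm 1 n) hz
  let T : Tensor q D := fun x => S fun _ => x
  have hT : T.block 1 = S := funext fun g => (T.block_one g).trans <| congrArg S <|
    funext fun i => congrArg g (Subsingleton.elim _ _)
  have hcomm : StabMPS.concat rfl Φ (T.block 1) =
      z • StabMPS.concat (Nat.add_comm 1 n) (T.block 1) Φ := by rw [hT, hΦS, hSΦ]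
  have hspan : Submodule.span ℂ (Set.range (StabMPS.concat (Nat.add_comm 1 n) (T.block 1) Φ)) = ⊤ :=
    by rw [hT, hSΦ, hΨspan]
  refine ⟨T, fun k hk => ⟨?_, T.block_ne_zero hΦ0 hspan k⟩⟩
  have hright := hΦ.concat_block hn hcomm k
  have hswap : StabMPS.concat (Nat.add_comm k n) (T.block k) Φ =
      (z ^ k)⁻¹ • StabMPS.concat rfl Φ (T.block k) := by
    rw [T.concat_block_eq_smul hcomm, inv_smul_smul₀ (pow_ne_zero k hz0)]
  exact of_concat hk hΦspan _ _ (hswap ▸ hright.smul _) hright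

theorem generates {T : Tensor q D}
    (h : ∀ᶠ N in atTop, C.HasVirtualAction U N (T.block N) ∧ T.block N ≠ 0) : T.Generates C := by
  filter_upwards [h, eventually_ge_atTop C.maxRange] with L ⟨hT, hT0⟩ hL _
  rw [C.isGroundState_iff hL, T.relabel_mps]
  exact ⟨fun h0 => hT0 (hT.eq_zero_of_trace_eq_zero hU hL (congrFun h0)),
    hT.ringFixed_trace hUU hL⟩

end HasVirtualAction

section Existence

variable (hcomm : ∀ᶠ L : ℕ in atTop, ∀ [NeZero L], C.Commuting L)
include hcomm

theorem exists_hasVirtualAction {n : ℕ} (hn : 2 * C.maxRange ≤ n) (huniq : C.UniqueFixed n) :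
    ∃ (D : ℕ) (U : C.Cut → (Matrix (Fin D) (Fin D) ℂ)ˣ), IsIrreducible U ∧
      IsCliffordRep C.tMatrix U ∧ (∀ c, (U c : Matrix (Fin D) (Fin D) ℂ) * U c = 1) ∧
      ∃ Φ, C.HasVirtualAction (fun c => (U c : Matrix (Fin D) (Fin D) ℂ)) n Φ ∧ Φ ≠ 0 := by
  obtain ⟨ψ, hψ0, hψ, huniq⟩ := huniq
  obtain ⟨D, U, hirr, hrep, hUU, hrel⟩ := exists_virtual_relations hcomm hn hψ0 hψ huniq
  obtain ⟨Φ, hΦ, htrace⟩ :=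
    exists_hasVirtualAction_of_relations hcomm hn hirr.adjoin_eq_top hψ hrel
  refine ⟨D, U, hirr, hrep, hUU, Φ, hΦ, ?_⟩
  rintro rfl
  exact hψ0 (funext fun g => by rw [← htrace g]; simp)

/-- The relations among the virtual operators at the lengths `n` and `k` agree, since both can be
read off from the fixed state of length `n * k`. -/
theorem HasVirtualAction.exists_of_uniqueFixed_mul {D n k : ℕ}
    {U : C.Cut → Matrix (Fin D) (Fin D) ℂ} {Φ : MatrixFamily q D n}
    (hU : Algebra.adjoin ℂ (Set.range U) = ⊤) (hUU : ∀ c, U c * U c = 1) (hn0 : 0 < n)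
    (hn : C.maxRange ≤ n) (h : C.HasVirtualAction U n Φ) (h0 : Φ ≠ 0) (hk0 : 0 < k)
    (hk : 2 * C.maxRange ≤ k) (huniq : C.UniqueFixed k) (huniq' : C.UniqueFixed (n * k)) :
    ∃ Ψ, C.HasVirtualAction U k Ψ ∧ Ψ ≠ 0 := by
  obtain ⟨D', U', hirr', -, hUU', Φ', hΦ', hΦ0'⟩ := exists_hasVirtualAction hcomm hk huniq
  obtain ⟨ψ, hψ0, hψ, huniq⟩ := huniq
  obtain ⟨ψ', -, -, huniq'⟩ := huniq'
  obtain ⟨Ψ, hΨ, hΨ0⟩ := h.exists_mul hU hUU hn h0 hk0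
  have hmul := hΦ'.exists_mul hirr'.adjoin_eq_top hUU' (by omega) hΦ0' hn0
  rw [mul_comm] at hmul
  obtain ⟨Ψ', hΨ', hΨ0'⟩ := hmul
  have hle : C.maxRange ≤ n * k := hn.trans (Nat.le_mul_of_pos_right n hk0)
  have hrel (x : FreeAlgebra ℂ C.Cut) (hx : FreeAlgebra.lift ℂ U x = 0) :
      C.evalRight k x ψ = 0 := by
    rwa [hΦ'.evalRight_eq_zero_iff hirr'.adjoin_eq_top hUU' (by omega) hΦ0' huniq,
      ← hΨ'.evalRight_eq_zero_iff hirr'.adjoin_eq_top hUU' hle hΨ0' huniq',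
      hΨ.evalRight_eq_zero_iff hU hUU hle hΨ0 huniq']
  obtain ⟨Ξ, hΞ, htrace⟩ := exists_hasVirtualAction_of_relations hcomm hk hU hψ hrel
  refine ⟨Ξ, hΞ, ?_⟩
  rintro rfl
  exact hψ0 (funext fun g => by rw [← htrace g]; simp)

theorem exists_generates (huniq : ∀ᶠ L : ℕ in atTop, ∀ [NeZero L], C.HasUniqueGroundState L) :
    ∃ (D : ℕ) (U : C.Cut → (Matrix (Fin D) (Fin D) ℂ)ˣ), IsIrreducible U ∧
      IsCliffordRep C.tMatrix U ∧ ∃ T : Tensor q D, T.Generates C := by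
  obtain ⟨n, hn⟩ := eventually_atTop.1 ((eventually_uniqueFixed huniq).and
    ((eventually_ge_atTop (2 * C.maxRange)).and (eventually_gt_atTop 0)))
  obtain ⟨hun, hrange, hn0⟩ := hn n le_rfl
  obtain ⟨D, U, hirr, hrep, hUU, Φ, hΦ, hΦ0⟩ := exists_hasVirtualAction hcomm hrange hun
  have hU := hirr.adjoin_eq_top
  obtain ⟨Ψ, hΨ, hΨ0⟩ := hΦ.exists_of_uniqueFixed_mul (k := n + 1) hcomm hU hUU hn0 (by omega) hΦ0
    (by omega) (by omega) (hn _ (by omega)).1 (hn _ (Nat.le_mul_of_pos_right n (by omega))).1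
  obtain ⟨T, hT⟩ := hΦ.exists_tensor hU hUU (by omega) (hn _ (by omega)).1 hΦ0 hΨ hΨ0
  exact ⟨D, U, hirr, hrep, T, HasVirtualAction.generates hU hUU
    (eventually_atTop.2 ⟨C.maxRange, hT⟩)⟩

end Existence

end Code

section Slices

variable {q n k : ℕ}

/-- The span of the states of the first `n` cells obtained by fixing the configuration of the last
`k` cells. Its dimension is the Schmidt rank of `ψ`. -/
def sliceSpan (ψ : (Fin (n + k) → Spin q) → ℂ) : Submodule ℂ ((Fin n → Spin q) → ℂ) :=
  Submodule.span ℂ (Set.range fun (h : Fin k → Spin q) (g : Fin n → Spin q) => ψ (Fin.append g h))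

theorem shift_append (p : Fin (n + k) → PauliString q) (g : Fin n → Spin q) (h : Fin k → Spin q) :
    shift p (Fin.append g h) =
      Fin.append (shift (p ∘ Fin.castAdd k) g) (shift (p ∘ Fin.natAdd n) h) := by
  funext i
  refine Fin.addCases (fun i => ?_) (fun i => ?_) i <;> simp [shift_apply]

theorem pauliOp_append (p : Fin (n + k) → PauliString q) (ψ : (Fin (n + k) → Spin q) → ℂ)
    (g : Fin n → Spin q) (h : Fin k → Spin q) :
    pauliOp p ψ (Fin.append g h) =
      (∏ i, (p (Fin.natAdd n i)).phase (shift (p ∘ Fin.natAdd n) h i)) *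
        pauliOp (p ∘ Fin.castAdd k)
          (fun g => ψ (Fin.append g (shift (p ∘ Fin.natAdd n) h))) g := by
  rw [pauliOp_apply, pauliOp_apply, shift_append, Fin.prod_univ_add, smul_eq_mul, smul_eq_mul]
  simp only [Fin.append_left, Fin.append_right, Function.comp_apply]
  ring

theorem pauliOp_mem_sliceSpan (p : Fin (n + k) → PauliString q) {ψ : (Fin (n + k) → Spin q) → ℂ}
    {φ : (Fin n → Spin q) → ℂ} (hφ : φ ∈ sliceSpan ψ) :
    pauliOp (p ∘ Fin.castAdd k) φ ∈ sliceSpan (pauliOp p ψ) := by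
  induction hφ using Submodule.span_induction with
  | mem _ hy =>
    obtain ⟨h, rfl⟩ := hy
    set h' := shift (p ∘ Fin.natAdd n) h
    have hphase : ∏ i, (p (Fin.natAdd n i)).phase (h i) ≠ 0 :=
      Finset.prod_ne_zero_iff.2 fun i _ => (p (Fin.natAdd n i)).phase_ne_zero _
    rw [← Submodule.smul_mem_iff _ hphase]
    refine Submodule.subset_span ⟨h', funext fun g => (pauliOp_append p ψ g h').trans ?_⟩
    rw [shift_shift]
    rfl
  | zero => rw [map_zero]; exact zero_mem _
  | add x y _ _ hx hy => rw [map_add]; exact add_mem hx hy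
  | smul c x _ hx => rw [map_smul]; exact Submodule.smul_mem _ _ hx

theorem sliceSpan_ne_bot {ψ : (Fin (n + k) → Spin q) → ℂ} (h : ψ ≠ 0) : sliceSpan ψ ≠ ⊥ := by
  refine fun hbot => h (funext fun w => ?_)
  have hmem : (fun g : Fin n → Spin q => ψ (Fin.append g fun i => w (Fin.natAdd n i))) ∈
      sliceSpan ψ := Submodule.subset_span ⟨_, rfl⟩
  rw [hbot, Submodule.mem_bot] at hmem
  have hw := congrFun hmem fun i => w (Fin.castAdd k i)
  rwa [Fin.append_castAdd_natAdd] at hw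

end Slices

namespace Code

variable {q m : ℕ} {C : Code q m} {n k : ℕ}

section Slices

variable {ψ : (Fin (n + k) → Spin q) → ℂ} {φ : (Fin n → Spin q) → ℂ}

theorem chainOp_mem_sliceSpan (α : Fin m) (a : ℤ) (hφ : φ ∈ sliceSpan ψ) :
    C.chainOp n α a φ ∈ sliceSpan (C.chainOp (n + k) α a ψ) :=
  pauliOp_mem_sliceSpan (fun i => C.stringAt α a i) hφ

theorem mem_sliceSpan_chainOp_of_le {α : Fin m} {a : ℤ} (ha : n ≤ a) (hφ : φ ∈ sliceSpan ψ) :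
    φ ∈ sliceSpan (C.chainOp (n + k) α a ψ) := by
  have hmem := chainOp_mem_sliceSpan (C := C) α a hφ
  rwa [C.chainOp_of_le ha, Module.End.one_apply] at hmem

namespace RingFixed

variable (hψ : C.RingFixed (n + k) ψ)
include hψ

theorem right_mem_sliceSpan (hn : C.maxRange ≤ n) (hk : C.maxRange ≤ k) (c : C.Cut)
    (hφ : φ ∈ sliceSpan ψ) : C.chainOp n c.1 (n - C.pos c) φ ∈ sliceSpan ψ := by
  have hc := C.P_le_maxRange c.1
  have hpos := C.pos_lt c
  have hmem := chainOp_mem_sliceSpan (C := C) c.1 (n - C.pos c) hφ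
  rwa [hψ.bulk (by omega) (by push_cast; omega)] at hmem

theorem left_mem_sliceSpan (hk : C.maxRange ≤ k) (c : C.Cut)
    (hφ : φ ∈ sliceSpan ψ) : C.chainOp n c.1 (-C.pos c) φ ∈ sliceSpan ψ := by
  have hc := C.P_le_maxRange c.1
  have hpos := C.pos_lt c
  have hmem := mem_sliceSpan_chainOp_of_le (C := C) (α := c.1)
    (a := ((n + k : ℕ) : ℤ) - C.pos c) (by push_cast; omega)
    (chainOp_mem_sliceSpan (C := C) c.1 (-C.pos c) hφ)
  rwa [hψ.left_eq_right (by omega), chainOp_chainOp] at hmem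

/-- The cut terms at the two ends of the interval preserve the space of slices. -/
theorem two_pow_rank_le_finrank_sliceSpan
    (hcomm : ∀ᶠ L : ℕ in atTop, ∀ [NeZero L], C.Commuting L)
    (hn : 2 * C.maxRange ≤ n) (hk : C.maxRange ≤ k) (hψ0 : ψ ≠ 0) :
    2 ^ C.tMatrix.rank ≤ Module.finrank ℂ (sliceSpan ψ) := by
  have hright (c : C.Cut) (φ) := hψ.right_mem_sliceSpan (φ := φ) (by omega) hk c
  have hleft (c : C.Cut) (φ) := hψ.left_mem_sliceSpan (φ := φ) hk c
  have hunit {α : Fin m} {a : ℤ} (h : ∀ φ ∈ sliceSpan ψ, C.chainOp n α a φ ∈ sliceSpan ψ) :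
      IsUnit ((C.chainOp n α a).restrict h) :=
    IsUnit.of_mul_eq_one ((C.chainOp n α a).restrict h)
      (LinearMap.ext fun φ => Subtype.ext (C.chainOp_chainOp α a φ.1))
  have : Nontrivial (sliceSpan ψ) := Submodule.nontrivial_iff_ne_bot.2 (sliceSpan_ne_bot hψ0)
  exact two_pow_rank_le_finrank_of_commute
    ((C.cliffordRel_chainOp_left (by omega)).restrict hright)
    ((cliffordRel_chainOp_right hcomm (by omega)).restrict hleft)
    (fun c d => LinearMap.ext fun φ => Subtype.ext <|
      LinearMap.congr_fun (C.chainOp_commute (C.overlap_left_right c d hn)).eq φ.1)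
    (fun c => hunit (hright c)) fun c => hunit (hleft c)

end RingFixed

end Slices

section BondDimension

variable {D : ℕ}

theorem finrank_sliceSpan_trace_block_le (T : Tensor q D) :
    Module.finrank ℂ (sliceSpan (n := n) (k := k) fun g => (T.block (n + k) g).trace) ≤
      Module.finrank ℂ (Submodule.span ℂ (Set.range (T.block n))) := by
  set S := Submodule.span ℂ (Set.range (T.block n))
  let ρ : Module.Dual ℂ S →ₗ[ℂ] ((Fin n → Spin q) → ℂ) :=
    { toFun := fun f g => f ⟨T.block n g, Submodule.subset_span ⟨g, rfl⟩⟩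
      map_add' := fun _ _ => rfl
      map_smul' := fun _ _ => rfl }
  have hle : sliceSpan (n := n) (k := k) (fun g => (T.block (n + k) g).trace) ≤
      LinearMap.range ρ := by
    refine Submodule.span_le.2 ?_
    rintro _ ⟨u, rfl⟩
    refine ⟨(Matrix.traceLinearMap (Fin D) ℂ ℂ ∘ₗ LinearMap.mulRight ℂ (T.block k u)) ∘ₗ S.subtype,
      funext fun g => ?_⟩
    rw [T.block_add rfl]
    exact congrArg Matrix.trace (concat_append rfl (T.block n) (T.block k) g u).symm
  exact (Submodule.finrank_mono hle).trans <|
    (LinearMap.finrank_range_le ρ).trans Subspace.dual_finrank_eq.le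

variable (hcomm : ∀ᶠ L : ℕ in atTop, ∀ [NeZero L], C.Commuting L)
include hcomm

theorem two_pow_rank_le_finrank_span_block (hn : 2 * C.maxRange ≤ n) (hk : C.maxRange ≤ k)
    [NeZero (n + k)] {T : Tensor q D} (h : C.IsGroundState (n + k) (T.mps (n + k))) :
    2 ^ C.tMatrix.rank ≤ Module.finrank ℂ (Submodule.span ℂ (Set.range (T.block n))) := by
  rw [C.isGroundState_iff (by omega), T.relabel_mps] at h
  exact (h.2.two_pow_rank_le_finrank_sliceSpan hcomm hn hk h.1).trans
    (finrank_sliceSpan_trace_block_le T)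

theorem two_pow_rank_le_sq_of_isGroundState {L : ℕ} (hL : 3 * C.maxRange ≤ L) [NeZero L]
    {T : Tensor q D} (h : C.IsGroundState L (T.mps L)) : 2 ^ C.tMatrix.rank ≤ D ^ 2 := by
  obtain ⟨k, rfl⟩ : ∃ k, L = 2 * C.maxRange + k := ⟨L - 2 * C.maxRange, by omega⟩
  have hle := (two_pow_rank_le_finrank_span_block hcomm le_rfl (by omega) h).trans
    (Submodule.finrank_le _)
  simpa [Module.finrank_matrix, sq] using hle

theorem span_block_eq_top (hD : D ^ 2 = 2 ^ C.tMatrix.rank) {T : Tensor q D} (h : T.Generates C)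
    (hn : 2 * C.maxRange ≤ n) : Submodule.span ℂ (Set.range (T.block n)) = ⊤ := by
  obtain ⟨L₀, hL₀⟩ := eventually_atTop.1 h
  have : NeZero (n + (C.maxRange + L₀ + 1)) := ⟨by omega⟩
  have hle := two_pow_rank_le_finrank_span_block hcomm hn (by omega)
    (hL₀ (n + (C.maxRange + L₀ + 1)) (by omega))
  refine Submodule.eq_top_of_finrank_eq (le_antisymm (Submodule.finrank_le _) ?_)
  simpa [Module.finrank_matrix, ← sq, hD] using hle

end BondDimension

end Code

open scoped Matrix

section Adjoint

variable {𝕜 E κ : Type*} [RCLike 𝕜] [NormedAddCommGroup E] [InnerProductSpace 𝕜 E]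
  [FiniteDimensional 𝕜 E] [Fintype κ]

open LinearMap (adjoint)

theorem sum_norm_sq_apply {A : κ → E →ₗ[𝕜] E} (h : ∑ g, adjoint (A g) ∘ₗ A g = 1) (x : E) :
    ∑ g, ‖A g x‖ ^ 2 = ‖x‖ ^ 2 := by
  simp only [norm_sq_eq_re_inner (𝕜 := 𝕜), ← LinearMap.adjoint_inner_right]
  have hx := LinearMap.congr_fun h x
  simp only [LinearMap.sum_apply, LinearMap.comp_apply, Module.End.one_apply] at hx
  rw [← map_sum, ← inner_sum, hx]

theorem sum_norm_sq_orthogonalProjectionOnto_adjoint {ι : Type*} [Fintype ι] {W : Submodule 𝕜 E}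
    (e : OrthonormalBasis ι 𝕜 W) (A : E →ₗ[𝕜] E) :
    ∑ i, ‖W.orthogonalProjectionOnto (adjoint A (e i))‖ ^ 2 =
      ∑ i, ‖W.orthogonalProjectionOnto (A (e i))‖ ^ 2 := by
  simp only [← e.sum_sq_norm_inner_right, Submodule.inner_orthogonalProjectionOnto_eq_of_mem_left]
  rw [Finset.sum_comm]
  refine Finset.sum_congr rfl fun j _ => Finset.sum_congr rfl fun i _ => ?_
  rw [LinearMap.adjoint_inner_right, norm_inner_symm]

/-- Over an orthonormal basis of `W`, the projections of the `(A g)† e` to `W` have the same total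
square norm as the `(A g)† e` themselves, so the latter lie in `W`. -/
theorem adjoint_mem_of_forall_mem {A : κ → E →ₗ[𝕜] E}
    (hA : ∑ g, adjoint (A g) ∘ₗ A g = 1) (hA' : ∑ g, A g ∘ₗ adjoint (A g) = 1)
    {W : Submodule 𝕜 E} (hW : ∀ g, ∀ w ∈ W, A g w ∈ W) (g : κ) {w : E} (hw : w ∈ W) :
    adjoint (A g) w ∈ W := by
  let e := stdOrthonormalBasis 𝕜 W
  have hle (x : E) : ‖W.orthogonalProjectionOnto x‖ ^ 2 ≤ ‖x‖ ^ 2 := by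
    gcongr
    exact W.norm_orthogonalProjectionOnto_apply_le x
  have hsum : ∑ i, ∑ g, ‖W.orthogonalProjectionOnto (adjoint (A g) (e i))‖ ^ 2 =
      ∑ i, ∑ g, ‖adjoint (A g) (e i)‖ ^ 2 := calc
    _ = ∑ i, ∑ g, ‖W.orthogonalProjectionOnto (A g (e i))‖ ^ 2 := by
      rw [Finset.sum_comm, Finset.sum_congr rfl fun g _ =>
        sum_norm_sq_orthogonalProjectionOnto_adjoint e (A g), Finset.sum_comm]
    _ = ∑ i, ∑ g, ‖A g (e i)‖ ^ 2 := Finset.sum_congr rfl fun i _ =>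
      Finset.sum_congr rfl fun g _ => by
        rw [W.norm_orthogonalProjectionOnto_apply (hW g _ (e i).2)]
    _ = ∑ i, ∑ g, ‖adjoint (A g) (e i)‖ ^ 2 := Finset.sum_congr rfl fun i _ => by
      rw [sum_norm_sq_apply hA, sum_norm_sq_apply (by simpa only [LinearMap.adjoint_adjoint])]
  have hmem (i) : adjoint (A g) (e i) ∈ W := by
    have hi := (Finset.sum_eq_sum_iff_of_le fun i _ => Finset.sum_le_sum fun g _ => hle _).1
      hsum i (Finset.mem_univ i)
    have hig := (Finset.sum_eq_sum_iff_of_le fun g _ => hle _).1 hi g (Finset.mem_univ g)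
    exact (W.mem_iff_norm_starProjection _).2 ((sq_eq_sq₀ (norm_nonneg _) (norm_nonneg _)).1 hig)
  have hrepr : w = ∑ i, e.repr ⟨w, hw⟩ i • (e i : E) := by
    simpa using congrArg W.subtype (e.sum_repr ⟨w, hw⟩).symm
  rw [hrepr, map_sum]
  exact W.sum_mem fun i _ => by
    rw [map_smul]
    exact W.smul_mem _ (hmem i)

end Adjoint

namespace Tensor

variable {q D : ℕ} {T : Tensor q D}

open scoped ComplexOrder in
/-- For the Hilbert–Schmidt inner product, multiplication by `(T g)ᴴ` is the adjoint of
multiplication by `T g`. -/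
theorem IsCanonical.conjTranspose_mul_mem (hT : T.IsCanonical)
    {J : Submodule ℂ (Matrix (Fin D) (Fin D) ℂ)} (hJ : ∀ g, ∀ w ∈ J, T g * w ∈ J) (g : Spin q)
    {w : Matrix (Fin D) (Fin D) ℂ} (hw : w ∈ J) : (T g)ᴴ * w ∈ J := by
  let _ : NormedAddCommGroup (Matrix (Fin D) (Fin D) ℂ) :=
    Matrix.toMatrixNormedAddCommGroup 1 Matrix.PosDef.one
  let _ : InnerProductSpace ℂ (Matrix (Fin D) (Fin D) ℂ) :=
    Matrix.toMatrixInnerProductSpace 1 Matrix.PosSemidef.one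
  have hadj (g : Spin q) : LinearMap.adjoint (LinearMap.mulLeft ℂ (T g)) =
      LinearMap.mulLeft ℂ (T g)ᴴ := by
    refine ((LinearMap.eq_adjoint_iff _ _).2 fun x y => ?_).symm
    change (y * 1 * ((T g)ᴴ * x)ᴴ).trace =
      (T g * y * 1 * xᴴ).trace
    rw [Matrix.conjTranspose_mul, Matrix.conjTranspose_conjTranspose, mul_one, mul_one,
      ← mul_assoc, Matrix.trace_mul_comm, ← mul_assoc]
  have hsum {B : Spin q → Matrix (Fin D) (Fin D) ℂ} (hB : ∑ g, B g = 1) :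
      ∑ g, LinearMap.mulLeft ℂ (B g) = 1 := LinearMap.ext fun x => by
    simp only [LinearMap.sum_apply, LinearMap.mulLeft_apply, Module.End.one_apply]
    rw [← Finset.sum_mul, hB, one_mul]
  have hmem := adjoint_mem_of_forall_mem (A := fun g => LinearMap.mulLeft ℂ (T g)) (W := J)
    (by simpa only [hadj, ← LinearMap.mulLeft_mul] using hsum hT.2)
    (by simpa only [hadj, ← LinearMap.mulLeft_mul] using hsum hT.1) hJ g hw
  rwa [hadj] at hmem

end Tensor

section Inverses

variable {R κ κ' : Type*} [Semiring R] [Fintype κ] [Fintype κ']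

/-- The family `A`, as a column over the ring `R`, has a left inverse. -/
def HasLeftInverse (A : κ → R) : Prop :=
  ∃ X : κ → R, ∑ g, X g * A g = 1

/-- The family `A`, as a row over the ring `R`, has a right inverse. -/
def HasRightInverse (A : κ → R) : Prop :=
  ∃ Y : κ → R, ∑ g, A g * Y g = 1

theorem HasLeftInverse.cancel {A : κ → R} (hA : HasLeftInverse A) {U V : R}
    (h : ∀ g, A g * U = A g * V) : U = V := by
  obtain ⟨X, hX⟩ := hA
  rw [← one_mul U, ← one_mul V, ← hX, Finset.sum_mul, Finset.sum_mul]
  exact Finset.sum_congr rfl fun g _ => by rw [mul_assoc, h, mul_assoc]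

theorem exists_unit_of_mul_eq_mul [IsDedekindFiniteMonoid R] {A A' : κ → R} {B B' : κ' → R}
    (hA : HasLeftInverse A) (hB : HasRightInverse B) (h : ∀ g k, A' g * B' k = A g * B k) :
    ∃ U : Rˣ, (∀ g, A' g = A g * U) ∧ ∀ k, B' k = U⁻¹.val * B k := by
  obtain ⟨X, hX⟩ := hA
  obtain ⟨Y, hY⟩ := hB
  set V := ∑ g, X g * A' g with hV
  set W := ∑ k, B' k * Y k with hW
  have hVB (k) : V * B' k = B k := by
    rw [hV, Finset.sum_mul]
    simp only [mul_assoc, h]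
    simp only [← mul_assoc]
    rw [← Finset.sum_mul, hX, one_mul]
  have hAW (g) : A' g * W = A g := by
    rw [hW, Finset.mul_sum]
    simp only [← mul_assoc, h]
    simp only [mul_assoc]
    rw [← Finset.mul_sum, hY, mul_one]
  have hVW : V * W = 1 := by
    rw [hV, Finset.sum_mul]
    simp only [mul_assoc, hAW, hX]
  have hWV : W * V = 1 := mul_eq_one_comm.1 hVW
  refine ⟨⟨V, W, hVW, hWV⟩, fun g => ?_, fun k => ?_⟩
  · rw [← hAW, mul_assoc, hWV, mul_one]
  · rw [← hVB, Units.inv_mk, ← mul_assoc, hWV, one_mul]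

end Inverses

theorem sum_univ_cons {β M : Type*} [Fintype β] [AddCommMonoid M] {n : ℕ}
    (f : (Fin (n + 1) → β) → M) :
    ∑ g, f g = ∑ x : β, ∑ h : Fin n → β, f (Fin.cons x h) := by
  rw [← Equiv.sum_comp (Fin.consEquiv fun _ => β), Fintype.sum_prod_type]
  rfl

namespace Tensor

variable {q D : ℕ} {T : Tensor q D}

theorem block_cons (T : Tensor q D) {n : ℕ} (x : Spin q) (h : Fin n → Spin q) :
    T.block (n + 1) (Fin.cons x h) = T x * T.block n h := by
  simp [block, List.ofFn_succ]

theorem hasLeftInverse_block (hT : HasLeftInverse T) (n : ℕ) : HasLeftInverse (T.block n) := by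
  obtain ⟨X, hX⟩ := hT
  induction n with
  | zero => exact ⟨fun _ => 1, by simp [block_zero]⟩
  | succ n ih =>
    obtain ⟨Z, hZ⟩ := ih
    refine ⟨fun g => Z (Fin.tail g) * X (g 0), ?_⟩
    rw [sum_univ_cons, Finset.sum_comm, ← hZ]
    refine Finset.sum_congr rfl fun h _ => ?_
    simp only [block_cons, Fin.tail_cons, Fin.cons_zero, mul_assoc]
    simp only [← mul_assoc (X _)]
    rw [← Finset.mul_sum, ← Finset.sum_mul, hX, one_mul]

theorem hasRightInverse_block (hT : HasRightInverse T) (n : ℕ) : HasRightInverse (T.block n) := by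
  obtain ⟨Y, hY⟩ := hT
  induction n with
  | zero => exact ⟨fun _ => 1, by simp [block_zero]⟩
  | succ n ih =>
    obtain ⟨Z, hZ⟩ := ih
    refine ⟨fun g => Z (Fin.tail g) * Y (g 0), ?_⟩
    rw [sum_univ_cons, ← hY]
    refine Finset.sum_congr rfl fun x _ => ?_
    simp only [block_cons, Fin.tail_cons, Fin.cons_zero, mul_assoc]
    simp only [← mul_assoc (T.block n _)]
    rw [← Finset.mul_sum, ← Finset.sum_mul, hZ, one_mul]

/-- A matrix in the span of the blocks of `T` is determined by its trace pairing with the long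
blocks. -/
def IsTraceFaithful (T : Tensor q D) : Prop :=
  ∀ (n : ℕ), ∀ F ∈ Submodule.span ℂ (Set.range (T.block n)),
    (∀ᶠ k : ℕ in atTop, ∀ g, (F * T.block k g).trace = 0) → F = 0

theorem isTraceFaithful_of_span_eq_top
    (hspan : ∀ᶠ n : ℕ in atTop, Submodule.span ℂ (Set.range (T.block n)) = ⊤) :
    T.IsTraceFaithful := by
  intro _ F _ hF
  obtain ⟨k, hk, hFk⟩ := (hspan.and hF).exists
  have hle : (⊤ : Submodule ℂ (Matrix (Fin D) (Fin D) ℂ)) ≤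
      LinearMap.ker (Matrix.traceLinearMap (Fin D) ℂ ℂ ∘ₗ LinearMap.mulLeft ℂ F) := by
    rw [← hk, Submodule.span_le]
    rintro _ ⟨g, rfl⟩
    exact hFk g
  have hFF : (F * Fᴴ).trace = 0 := hle Submodule.mem_top
  open scoped ComplexOrder in
  exact Matrix.trace_mul_conjTranspose_self_eq_zero_iff.1 hFF

/-- The span of the blocks of length at least `k₀`. -/
def longBlockSpan (T : Tensor q D) (k₀ : ℕ) : Submodule ℂ (Matrix (Fin D) (Fin D) ℂ) :=
  Submodule.span ℂ (⋃ k ≥ k₀, Set.range (T.block k))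

theorem block_mem_longBlockSpan {k₀ k : ℕ} (hk : k₀ ≤ k) (g : Fin k → Spin q) :
    T.block k g ∈ T.longBlockSpan k₀ :=
  Submodule.subset_span (Set.mem_iUnion₂_of_mem hk ⟨g, rfl⟩)

theorem longBlockSpan_le {k₀ : ℕ} {J : Submodule ℂ (Matrix (Fin D) (Fin D) ℂ)}
    (h : ∀ k, k₀ ≤ k → ∀ g, T.block k g ∈ J) : T.longBlockSpan k₀ ≤ J :=
  Submodule.span_le.2 <| Set.iUnion₂_subset fun k hk => Set.range_subset_iff.2 (h k hk)

theorem mul_mem_longBlockSpan {k₀ : ℕ} (x : Spin q) {w : Matrix (Fin D) (Fin D) ℂ}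
    (hw : w ∈ T.longBlockSpan k₀) : T x * w ∈ T.longBlockSpan k₀ := by
  have hle : T.longBlockSpan k₀ ≤ (T.longBlockSpan k₀).comap (LinearMap.mulLeft ℂ (T x)) :=
    longBlockSpan_le fun k hk g => by
      rw [Submodule.mem_comap, LinearMap.mulLeft_apply, ← block_cons]
      exact block_mem_longBlockSpan (by omega) _
  exact hle hw

namespace IsCanonical

theorem sum_conjTranspose_block_mul (hT : T.IsCanonical) (n : ℕ) :
    ∑ g, (T.block n g)ᴴ * T.block n g = 1 := by
  induction n with
  | zero => simp [block_zero]
  | succ n ih =>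
    rw [sum_univ_cons, Finset.sum_comm, ← ih]
    refine Finset.sum_congr rfl fun h _ => ?_
    simp only [block_cons, Matrix.conjTranspose_mul, mul_assoc]
    simp only [← mul_assoc (T _)ᴴ]
    rw [← Finset.mul_sum, ← Finset.sum_mul, hT.2, one_mul]

theorem conjTranspose_block_mul_mem (hT : T.IsCanonical)
    {J : Submodule ℂ (Matrix (Fin D) (Fin D) ℂ)} (hJ : ∀ g, ∀ w ∈ J, T g * w ∈ J) {n : ℕ}
    (g : Fin n → Spin q) {w : Matrix (Fin D) (Fin D) ℂ} (hw : w ∈ J) :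
    (T.block n g)ᴴ * w ∈ J := by
  induction n generalizing w with
  | zero => simpa only [block_zero, Matrix.conjTranspose_one, one_mul] using hw
  | succ n ih =>
    rw [← Fin.cons_self_tail g, block_cons, Matrix.conjTranspose_mul, mul_assoc]
    exact ih _ (hT.conjTranspose_mul_mem hJ _ hw)

theorem conjTranspose_mem_longBlockSpan (hT : T.IsCanonical) {n : ℕ}
    {F : Matrix (Fin D) (Fin D) ℂ} (hF : F ∈ Submodule.span ℂ (Set.range (T.block n))) (k₀ : ℕ) :
    Fᴴ ∈ T.longBlockSpan k₀ := by
  have hblock {n : ℕ} (g : Fin n → Spin q) {w} (hw : w ∈ T.longBlockSpan k₀) :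
      (T.block n g)ᴴ * w ∈ T.longBlockSpan k₀ :=
    hT.conjTranspose_block_mul_mem (fun x _ => mul_mem_longBlockSpan x) g hw
  have hone : (1 : Matrix (Fin D) (Fin D) ℂ) ∈ T.longBlockSpan k₀ := by
    rw [← hT.sum_conjTranspose_block_mul k₀]
    exact sum_mem fun g _ => hblock g (block_mem_longBlockSpan le_rfl g)
  obtain ⟨a, rfl⟩ := (Submodule.mem_span_range_iff_exists_fun ℂ).1 hF
  rw [Matrix.conjTranspose_sum]
  refine sum_mem fun g _ => ?_
  rw [Matrix.conjTranspose_smul, ← mul_one (T.block n g)ᴴ]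
  exact Submodule.smul_mem _ _ (hblock g hone)

theorem isTraceFaithful (hT : T.IsCanonical) : T.IsTraceFaithful := by
  intro n F hF htrace
  obtain ⟨k₀, hk₀⟩ := eventually_atTop.1 htrace
  have hle : T.longBlockSpan k₀ ≤
      LinearMap.ker (Matrix.traceLinearMap (Fin D) ℂ ℂ ∘ₗ LinearMap.mulLeft ℂ F) :=
    longBlockSpan_le hk₀
  have hFF : (F * Fᴴ).trace = 0 := hle (hT.conjTranspose_mem_longBlockSpan hF k₀)
  open scoped ComplexOrder in
  exact Matrix.trace_mul_conjTranspose_self_eq_zero_iff.1 hFF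

end IsCanonical

theorem block_eq_smul_conj {z : ℂ} {S : (Matrix (Fin D) (Fin D) ℂ)ˣ} {T' : Tensor q D}
    (h : ∀ g, T g = z • (S.val * T' g * S⁻¹.val)) {n : ℕ} (g : Fin n → Spin q) :
    T.block n g = z ^ n • (S.val * T'.block n g * S⁻¹.val) := by
  induction n with
  | zero => simp [block_zero]
  | succ n ih =>
    rw [← Fin.cons_self_tail g, block_cons, block_cons, ih, h, pow_succ', smul_mul_smul_comm]
    simp only [mul_assoc, Units.inv_mul_cancel_left]

namespace HasCanonicalForm

theorem isTraceFaithful (hT : T.HasCanonicalForm) : T.IsTraceFaithful := by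
  obtain ⟨z, S, T', hz, hT', hTT'⟩ := hT
  intro n F hF htrace
  suffices hconj : S⁻¹.val * F * S.val = 0 by
    simpa only [mul_assoc, Units.inv_mul_cancel_left, Units.mul_inv, mul_one, mul_zero, zero_mul,
      Units.mul_inv_cancel_left] using congr(S.val * $hconj * S⁻¹.val)
  refine hT'.isTraceFaithful n _ ?_ (htrace.mono fun k hk g => ?_)
  · have hle : Submodule.span ℂ (Set.range (T.block n)) ≤
        (Submodule.span ℂ (Set.range (T'.block n))).comap
          (LinearMap.mulRight ℂ S.val ∘ₗ LinearMap.mulLeft ℂ S⁻¹.val) := by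
      refine Submodule.span_le.2 (Set.range_subset_iff.2 fun g => ?_)
      change S⁻¹.val * T.block n g * S.val ∈ Submodule.span ℂ (Set.range (T'.block n))
      rw [block_eq_smul_conj hTT', mul_smul_comm, smul_mul_assoc]
      refine Submodule.smul_mem _ _ (Submodule.subset_span ⟨g, ?_⟩)
      simp only [mul_assoc, Units.inv_mul_cancel_left, Units.inv_mul, mul_one]
    exact hle hF
  · have hkg := hk g
    rw [block_eq_smul_conj hTT', mul_smul_comm, Matrix.trace_smul, smul_eq_zero] at hkg
    rw [← hkg.resolve_left (pow_ne_zero k hz), mul_assoc, mul_assoc, Matrix.trace_mul_comm]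
    simp only [mul_assoc]

theorem hasLeftInverse (hT : T.HasCanonicalForm) : HasLeftInverse T := by
  obtain ⟨z, S, T', hz, hT', hTT'⟩ := hT
  refine ⟨fun g => z⁻¹ • (S.val * (T' g)ᴴ * S⁻¹.val), ?_⟩
  simp only [hTT', smul_mul_smul_comm, inv_mul_cancel₀ hz, one_smul, mul_assoc,
    Units.inv_mul_cancel_left]
  simp only [← mul_assoc (T' _)ᴴ]
  rw [← Finset.mul_sum, ← Finset.sum_mul, hT'.2, one_mul, Units.mul_inv]

theorem hasRightInverse (hT : T.HasCanonicalForm) : HasRightInverse T := by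
  obtain ⟨z, S, T', hz, hT', hTT'⟩ := hT
  refine ⟨fun g => z⁻¹ • (S.val * (T' g)ᴴ * S⁻¹.val), ?_⟩
  simp only [hTT', smul_mul_smul_comm, mul_inv_cancel₀ hz, one_smul, mul_assoc,
    Units.inv_mul_cancel_left]
  simp only [← mul_assoc (T' _)]
  rw [← Finset.mul_sum, ← Finset.sum_mul, hT'.1, one_mul, Units.mul_inv]

end HasCanonicalForm

end Tensor

namespace Code

variable {q m D : ℕ} {C : Code q m} {T : Tensor q D}

/-- The terms of the Hamiltonian fix the products of the MPS matrices. -/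
def LocallyFixed (C : Code q m) (T : Tensor q D) : Prop :=
  ∀ α, C.chainOp (C.P α) α 0 (T.block (C.P α)) = T.block (C.P α)

theorem eventually_trace_sub_mul_block_eq_zero (h : T.Generates C) (α : Fin m)
    (g : Fin (C.P α) → Spin q) :
    ∀ᶠ k : ℕ in atTop, ∀ u, ((C.chainOp (C.P α) α 0 (T.block (C.P α)) g - T.block (C.P α) g) *
      T.block k u).trace = 0 := by
  obtain ⟨L₀, hL₀⟩ := eventually_atTop.1 h
  refine eventually_atTop.2 ⟨L₀ + C.maxRange, fun k hk u => ?_⟩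
  have hα := C.P_pos α
  have : NeZero (C.P α + k) := ⟨by omega⟩
  have hground := hL₀ (C.P α + k) (by omega)
  rw [C.isGroundState_iff (by omega), T.relabel_mps] at hground
  have hfix : (fun g => (C.chainOp (C.P α + k) α 0 (T.block (C.P α + k)) g).trace) =
      fun g => (T.block (C.P α + k) g).trace :=
    (pauliOp_trace _ _).symm.trans (hground.2.bulk le_rfl (by push_cast; omega))
  rw [T.block_add (n := C.P α) (k := k) rfl, C.chainOp_concat,
    C.chainOp_of_add_le (a := 0 - C.P α) (by omega), Module.End.one_apply] at hfix
  have hgu := congrFun hfix (Fin.append g u ∘ Fin.cast rfl)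
  rw [concat_append, concat_append] at hgu
  rw [sub_mul, Matrix.trace_sub, hgu, sub_self]

theorem locallyFixed_of_isTraceFaithful (h : T.Generates C) (hT : T.IsTraceFaithful) :
    C.LocallyFixed T := fun α => funext fun g =>
  sub_eq_zero.1 <| hT _ _ (sub_mem (pauliOp_apply_mem_span _ _ g) (Submodule.subset_span ⟨g, rfl⟩))
    (eventually_trace_sub_mul_block_eq_zero h α g)

theorem isVirtual_iff (U : C.Cut → (Matrix (Fin D) (Fin D) ℂ)ˣ) : T.IsVirtual C U ↔ ∀ c : C.Cut,
    (∀ g, C.chainOp (C.pos c) c.1 0 (T.block (C.pos c)) g = T.block (C.pos c) g * (U c).val) ∧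
    (∀ g, C.chainOp (C.P c.1 - C.pos c) c.1 (-C.pos c) (T.block (C.P c.1 - C.pos c)) g =
      (U c)⁻¹.val * T.block (C.P c.1 - C.pos c) g) := by
  refine forall_congr' fun c => ?_
  have := C.pos_lt c
  have hleft : (fun k : Fin (C.pos c) => C.o c.1 k) =
      fun k : Fin (C.pos c) => C.stringAt c.1 0 (k : ℤ) :=
    funext fun k => (C.stringAt_of_mem (by simp) (by omega)).symm
  have hright : (fun k : Fin (C.P c.1 - C.pos c) => C.o c.1 (C.pos c + k)) =
      fun k : Fin (C.P c.1 - C.pos c) => C.stringAt c.1 (-C.pos c) (k : ℤ) :=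
    funext fun k => (C.stringAt_of_mem (by push_cast; ring) (by omega)).symm
  rw [hleft, hright]
  rfl

theorem exists_isVirtual (hfix : C.LocallyFixed T) (hl : HasLeftInverse T)
    (hr : HasRightInverse T) : ∃ U, T.IsVirtual C U := by
  simp only [isVirtual_iff]
  refine Classical.skolem.1 fun c => exists_unit_of_mul_eq_mul (Tensor.hasLeftInverse_block hl _)
    (Tensor.hasRightInverse_block hr _) fun g k => ?_
  have := C.pos_lt c
  have hsplit : C.pos c + (C.P c.1 - C.pos c) = C.P c.1 := by omega
  have hc := hfix c.1
  rw [T.block_add hsplit, C.chainOp_concat, zero_sub] at hc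
  simpa only [concat_append] using congrFun hc (Fin.append g k ∘ Fin.cast hsplit.symm)

end Code

namespace Tensor.IsVirtual

variable {q m D : ℕ} {C : Code q m} {T : Tensor q D} {U V : C.Cut → (Matrix (Fin D) (Fin D) ℂ)ˣ}
  {n : ℕ}

theorem unique (hl : HasLeftInverse T) (hU : T.IsVirtual C U) (hV : T.IsVirtual C V) : U = V :=
  funext fun c => Units.ext <| (hasLeftInverse_block hl _).cancel fun g =>
    ((hU c).1 g).symm.trans ((hV c).1 g)

theorem right (hU : T.IsVirtual C U) (hn : C.maxRange ≤ n) (c : C.Cut) :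
    C.chainOp n c.1 (n - C.pos c) (T.block n) = fun g => T.block n g * (U c).val := by
  have hc := C.pos_lt c
  have hc' := C.P_le_maxRange c.1
  rw [T.block_add (n := n - C.pos c) (k := C.pos c) (N := n) (by omega), C.chainOp_concat,
    C.chainOp_of_le (n := n - C.pos c) (by omega), Module.End.one_apply,
    show (n : ℤ) - C.pos c - ((n - C.pos c : ℕ) : ℤ) = 0 by omega,
    funext ((Code.isVirtual_iff U).1 hU c).1]
  funext g
  simp only [concat, mul_assoc]

theorem left (hU : T.IsVirtual C U) (hn : C.maxRange ≤ n) (c : C.Cut) :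
    C.chainOp n c.1 (-C.pos c) (T.block n) = fun g => (U c)⁻¹.val * T.block n g := by
  have hc := C.pos_lt c
  have hc' := C.P_le_maxRange c.1
  rw [T.block_add (n := C.P c.1 - C.pos c) (k := n - (C.P c.1 - C.pos c)) (N := n) (by omega),
    C.chainOp_concat, C.chainOp_of_add_le (n := n - (C.P c.1 - C.pos c)) (by omega),
    Module.End.one_apply, funext ((Code.isVirtual_iff U).1 hU c).2]
  funext g
  simp only [concat, mul_assoc]

theorem isCliffordRep (hl : HasLeftInverse T) (hU : T.IsVirtual C U) :
    IsCliffordRep C.tMatrix U := by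
  refine (cliffordRel_iff ℂ _ _).2 fun c d => ?_
  have hmul (c d) : C.chainOp C.maxRange c.1 (C.maxRange - C.pos c)
      (C.chainOp C.maxRange d.1 (C.maxRange - C.pos d) (T.block C.maxRange)) =
      fun g => T.block C.maxRange g * ((U c).val * (U d).val) := by
    rw [hU.right le_rfl d, Code.chainOp, pauliOp_mul_right, ← Code.chainOp, hU.right le_rfl c]
    simp only [mul_assoc]
  refine (hasLeftInverse_block hl C.maxRange).cancel fun g => ?_
  rw [mul_smul_comm, ← congrFun (hmul c d) g, ← congrFun (hmul d c) g,
    ← C.overlap_left c d le_rfl]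
  exact congrFun (LinearMap.congr_fun (C.chainOp_comm c.1 d.1 _ _) (T.block C.maxRange)) g

end Tensor.IsVirtual

section PosDef

open scoped ComplexOrder

variable {𝕜 κ ι : Type*} [RCLike 𝕜] [Fintype κ] [Fintype ι] [DecidableEq ι]

theorem HasRightInverse.eq_zero_of_conjTranspose_mulVec_eq_zero {A : κ → Matrix ι ι 𝕜}
    (hA : HasRightInverse A) {x : ι → 𝕜} (hx : ∀ g, (A g)ᴴ *ᵥ x = 0) : x = 0 := by
  obtain ⟨Y, hY⟩ := hA
  have hYA : ∑ g, (Y g)ᴴ * (A g)ᴴ = 1 := by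
    simpa only [Matrix.conjTranspose_sum, Matrix.conjTranspose_mul, Matrix.conjTranspose_one]
      using congrArg Matrix.conjTranspose hY
  rw [← Matrix.one_mulVec x, ← hYA, Matrix.sum_mulVec]
  exact Finset.sum_eq_zero fun g _ => by rw [← Matrix.mulVec_mulVec, hx, Matrix.mulVec_zero]

theorem HasRightInverse.posDef {A : κ → Matrix ι ι 𝕜} (hA : HasRightInverse A) :
    (∑ g, A g * (A g)ᴴ).PosDef := by
  refine Matrix.PosDef.of_dotProduct_mulVec_pos
    (Matrix.posSemidef_sum _ fun g _ => Matrix.posSemidef_self_mul_conjTranspose _).1 fun x hx => ?_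
  have hquad : star x ⬝ᵥ (∑ g, A g * (A g)ᴴ) *ᵥ x =
      ∑ g, star ((A g)ᴴ *ᵥ x) ⬝ᵥ ((A g)ᴴ *ᵥ x) := by
    rw [Matrix.sum_mulVec, dotProduct_sum]
    refine Finset.sum_congr rfl fun g _ => ?_
    rw [Matrix.star_mulVec, Matrix.conjTranspose_conjTranspose, ← Matrix.dotProduct_mulVec,
      Matrix.mulVec_mulVec]
  obtain ⟨g, hg⟩ : ∃ g, (A g)ᴴ *ᵥ x ≠ 0 := by
    by_contra! h
    exact hx (hA.eq_zero_of_conjTranspose_mulVec_eq_zero h)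
  rw [hquad]
  exact Finset.sum_pos' (fun g _ => dotProduct_star_self_nonneg _)
    ⟨g, Finset.mem_univ g, Matrix.dotProduct_star_self_pos_iff.2 hg⟩

open scoped MatrixOrder Matrix.Norms.L2Operator in
theorem exists_eq_mul_conjTranspose_of_posDef {Q : Matrix ι ι ℂ} (hQ : Q.PosDef) :
    ∃ S : (Matrix ι ι ℂ)ˣ, Q = S.val * S.valᴴ := by
  obtain ⟨S, hS, h⟩ := CStarAlgebra.isStrictlyPositive_iff_eq_star_mul_self.1
    (Matrix.isStrictlyPositive_iff_posDef.2 hQ)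
  exact ⟨hS.star.unit, by simpa [Matrix.star_eq_conjTranspose] using h⟩

end PosDef

theorem sum_univ_snoc {β M : Type*} [Fintype β] [AddCommMonoid M] {n : ℕ}
    (f : (Fin (n + 1) → β) → M) :
    ∑ g, f g = ∑ x : β, ∑ h : Fin n → β, f (Fin.snoc h x) := by
  rw [← Equiv.sum_comp (Fin.snocEquiv fun _ => β), Fintype.sum_prod_type]
  rfl

namespace Tensor

variable {q D : ℕ} {T : Tensor q D}

theorem block_snoc (T : Tensor q D) {n : ℕ} (h : Fin n → Spin q) (x : Spin q) :
    T.block (n + 1) (Fin.snoc h x) = T.block n h * T x := by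
  simp [block, List.ofFn_succ', -List.ofFn_succ]

theorem hasLeftInverse_of_span_eq_top {n : ℕ}
    (h : Submodule.span ℂ (Set.range (T.block (n + 1))) = ⊤) : HasLeftInverse T := by
  obtain ⟨a, ha⟩ := (Submodule.mem_span_range_iff_exists_fun ℂ).1
    (h ▸ Submodule.mem_top : (1 : Matrix (Fin D) (Fin D) ℂ) ∈ _)
  refine ⟨fun x => ∑ h, a (Fin.snoc h x) • T.block n h, ?_⟩
  rw [← ha, sum_univ_snoc]
  simp only [Finset.sum_mul, block_snoc, smul_mul_assoc]

theorem hasRightInverse_of_span_eq_top {n : ℕ}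
    (h : Submodule.span ℂ (Set.range (T.block (n + 1))) = ⊤) : HasRightInverse T := by
  obtain ⟨a, ha⟩ := (Submodule.mem_span_range_iff_exists_fun ℂ).1
    (h ▸ Submodule.mem_top : (1 : Matrix (Fin D) (Fin D) ℂ) ∈ _)
  refine ⟨fun x => ∑ h, a (Fin.cons x h) • T.block n h, ?_⟩
  rw [← ha, sum_univ_cons]
  simp only [Finset.mul_sum, block_cons, mul_smul_comm]

section CanonicalForm

open scoped ComplexOrder

theorem eq_of_sum_eq_smul_one [NeZero D] {ν μ : ℂ} (hr : ∑ g, T g * (T g)ᴴ = ν • 1)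
    (hl : ∑ g, (T g)ᴴ * T g = μ • 1) : ν = μ := by
  have htrace : (∑ g, T g * (T g)ᴴ).trace = (∑ g, (T g)ᴴ * T g).trace := by
    simp only [Matrix.trace_sum, Matrix.trace_mul_comm (T _)]
  rw [hr, hl, Matrix.trace_smul, Matrix.trace_smul, Matrix.trace_one, Fintype.card_fin] at htrace
  exact mul_right_cancel₀ (NeZero.ne (D : ℂ)) htrace

theorem hasCanonicalForm_of_sum_eq_smul_one {ν : ℂ} (hν : 0 < ν)
    (hr : ∑ g, T g * (T g)ᴴ = ν • 1) (hl : ∑ g, (T g)ᴴ * T g = ν • 1) : T.HasCanonicalForm := by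
  obtain ⟨hre, him⟩ := Complex.pos_iff.1 hν
  set z : ℂ := ((√ν.re : ℝ) : ℂ)
  have hz : z ≠ 0 := Complex.ofReal_ne_zero.2 (Real.sqrt_ne_zero'.2 hre)
  have hzν : z⁻¹ * star z⁻¹ = ν⁻¹ := by
    rw [star_inv₀, ← mul_inv, Complex.star_def, Complex.conj_ofReal, ← Complex.ofReal_mul,
      Real.mul_self_sqrt hre.le]
    exact congrArg _ (Complex.ext rfl him)
  refine ⟨z, 1, fun g => z⁻¹ • T g, hz, ⟨?_, ?_⟩, fun g => ?_⟩
  · simp only [Matrix.conjTranspose_smul, smul_mul_smul_comm, hzν, ← Finset.smul_sum, hr,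
      smul_smul, inv_mul_cancel₀ hν.ne', one_smul]
  · simp only [Matrix.conjTranspose_smul, smul_mul_smul_comm, mul_comm (star _), hzν,
      ← Finset.smul_sum, hl, smul_smul, inv_mul_cancel₀ hν.ne', one_smul]
  · rw [inv_one, Units.val_one, one_mul, mul_one, smul_smul, mul_inv_cancel₀ hz, one_smul]

theorem HasCanonicalForm.of_conj (S : (Matrix (Fin D) (Fin D) ℂ)ˣ)
    (h : HasCanonicalForm fun g => S⁻¹.val * T g * S.val) : T.HasCanonicalForm := by
  obtain ⟨z, S', T', hz, hT', hTT'⟩ := h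
  refine ⟨z, S * S', T', hz, hT', fun g => ?_⟩
  calc T g = S.val * (S⁻¹.val * T g * S.val) * S⁻¹.val := by
        simp only [mul_assoc, Units.mul_inv_cancel_left, Units.mul_inv, mul_one]
    _ = S.val * (z • (S'.val * T' g * S'⁻¹.val)) * S⁻¹.val := congr(S.val * $(hTT' g) * S⁻¹.val)
    _ = z • ((S * S').val * T' g * (S * S')⁻¹.val) := by
        rw [mul_smul_comm, smul_mul_assoc, mul_inv_rev, Units.val_mul, Units.val_mul]
        simp only [mul_assoc]

theorem hasCanonicalForm_of_fixed [NeZero D] {Q : (Matrix (Fin D) (Fin D) ℂ)ˣ} (hQ : Q.val.PosDef)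
    {ν μ : ℂ} (hν : 0 < ν) (hr : ∑ g, T g * Q.val * (T g)ᴴ = ν • Q.val)
    (hl : ∑ g, (T g)ᴴ * Q⁻¹.val * T g = μ • Q⁻¹.val) : T.HasCanonicalForm := by
  obtain ⟨S, hS⟩ := exists_eq_mul_conjTranspose_of_posDef hQ
  have hinv : S.valᴴ * S⁻¹.valᴴ = 1 := by
    rw [← Matrix.conjTranspose_mul, Units.inv_mul, Matrix.conjTranspose_one]
  have hQinv : Q⁻¹.val = S⁻¹.valᴴ * S⁻¹.val := by
    refine Units.inv_eq_of_mul_eq_one_right ?_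
    rw [hS, mul_assoc, ← mul_assoc S.valᴴ, hinv, one_mul, Units.mul_inv]
  have hr' : ∑ g, S⁻¹.val * T g * S.val * (S⁻¹.val * T g * S.val)ᴴ = ν • 1 := by
    calc _ = S⁻¹.val * (∑ g, T g * Q.val * (T g)ᴴ) * S⁻¹.valᴴ := by
          simp only [hS, Finset.mul_sum, Finset.sum_mul, Matrix.conjTranspose_mul, mul_assoc]
      _ = ν • 1 := by
          rw [hr, hS, mul_smul_comm, smul_mul_assoc, Units.inv_mul_cancel_left, hinv]
  have hl' : ∑ g, (S⁻¹.val * T g * S.val)ᴴ * (S⁻¹.val * T g * S.val) = μ • 1 := by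
    calc _ = S.valᴴ * (∑ g, (T g)ᴴ * Q⁻¹.val * T g) * S.val := by
          simp only [hQinv, Finset.mul_sum, Finset.sum_mul, Matrix.conjTranspose_mul, mul_assoc]
      _ = μ • 1 := by
          rw [hl, hQinv, mul_smul_comm, smul_mul_assoc, ← mul_assoc S.valᴴ, hinv, one_mul,
            Units.inv_mul]
  rw [← eq_of_sum_eq_smul_one hr' hl'] at hl'
  exact .of_conj S (hasCanonicalForm_of_sum_eq_smul_one hν hr' hl')

end CanonicalForm

/-- The right Gram matrix of the blocks of length `n`, i.e. the image of the identity under the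
`n`-th power of the transfer operator `X ↦ ∑ x, T x * X * (T x)ᴴ`. -/
noncomputable def gramRight (T : Tensor q D) (n : ℕ) : Matrix (Fin D) (Fin D) ℂ :=
  ∑ g, T.block n g * (T.block n g)ᴴ

/-- The left Gram matrix of the blocks of length `n`, i.e. the image of the identity under the
`n`-th power of the adjoint transfer operator `X ↦ ∑ x, (T x)ᴴ * X * T x`. -/
noncomputable def gramLeft (T : Tensor q D) (n : ℕ) : Matrix (Fin D) (Fin D) ℂ :=
  ∑ g, (T.block n g)ᴴ * T.block n g

theorem gramRight_succ (T : Tensor q D) (n : ℕ) :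
    T.gramRight (n + 1) = ∑ x, T x * T.gramRight n * (T x)ᴴ := by
  simp only [gramRight, sum_univ_cons, block_cons, Matrix.conjTranspose_mul, Finset.mul_sum,
    Finset.sum_mul, mul_assoc]

theorem gramLeft_succ (T : Tensor q D) (n : ℕ) :
    T.gramLeft (n + 1) = ∑ x, (T x)ᴴ * T.gramLeft n * T x := by
  simp only [gramLeft, sum_univ_snoc, block_snoc, Matrix.conjTranspose_mul, Finset.mul_sum,
    Finset.sum_mul, mul_assoc]

theorem trace_gramLeft (T : Tensor q D) (n : ℕ) : (T.gramLeft n).trace = (T.gramRight n).trace := by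
  simp only [gramLeft, gramRight, Matrix.trace_sum, Matrix.trace_mul_comm (T.block n _)ᴴ]

open scoped ComplexOrder in
theorem posDef_gramRight (hr : HasRightInverse T) (n : ℕ) : (T.gramRight n).PosDef :=
  (hasRightInverse_block hr n).posDef

namespace IsVirtual

variable {m n : ℕ} {C : Code q m} {U : C.Cut → (Matrix (Fin D) (Fin D) ℂ)ˣ}

theorem semiconjBy_gramRight (hU : T.IsVirtual C U) (hn : C.maxRange ≤ n) (c : C.Cut) :
    SemiconjBy (T.gramRight n) (U c)⁻¹.valᴴ (U c).val := by
  have hfix : (U c)⁻¹.val * T.gramRight n * (U c)⁻¹.valᴴ = T.gramRight n :=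
    calc _ = ∑ g, (U c)⁻¹.val * T.block n g * ((U c)⁻¹.val * T.block n g)ᴴ := by
          simp only [gramRight, Matrix.conjTranspose_mul, Finset.mul_sum, Finset.sum_mul, mul_assoc]
      _ = T.gramRight n := by
          simp only [← congrFun (hU.left hn c)]
          exact sum_pauliOp_mul_conjTranspose _ _
  rw [SemiconjBy, ← (U c).mul_inv_cancel_left (_ * _), ← mul_assoc (U c)⁻¹.val, hfix]

theorem semiconjBy_gramLeft (hU : T.IsVirtual C U) (hn : C.maxRange ≤ n) (c : C.Cut) :
    SemiconjBy (T.gramLeft n) (U c).val (U c)⁻¹.valᴴ := by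
  have hfix : (U c).valᴴ * T.gramLeft n * (U c).val = T.gramLeft n :=
    calc _ = ∑ g, (T.block n g * (U c).val)ᴴ * (T.block n g * (U c).val) := by
          simp only [gramLeft, Matrix.conjTranspose_mul, Finset.mul_sum, Finset.sum_mul, mul_assoc]
      _ = T.gramLeft n := by
          simp only [← congrFun (hU.right hn c)]
          exact sum_conjTranspose_pauliOp_mul _ _
  have hinv : (U c)⁻¹.valᴴ * (U c).valᴴ = 1 := by
    rw [← Matrix.conjTranspose_mul, Units.mul_inv, Matrix.conjTranspose_one]
  rw [SemiconjBy, ← one_mul (_ * _), ← hinv, mul_assoc, ← mul_assoc (U c).valᴴ, hfix]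

open scoped ComplexOrder in
theorem hasCanonicalForm (hr : HasRightInverse T) (hU : T.IsVirtual C U) (hirr : IsIrreducible U) :
    T.HasCanonicalForm := by
  have : NeZero D := ⟨hirr.1.ne'⟩
  have hpos := posDef_gramRight hr
  obtain ⟨Q, hQ⟩ := (hpos C.maxRange).isUnit
  have hUQ c : SemiconjBy Q.val (U c)⁻¹.valᴴ (U c).val := hQ ▸ hU.semiconjBy_gramRight le_rfl c
  obtain ⟨ν, hν⟩ := exists_eq_smul_of_semiconjBy hirr.adjoin_eq_top hUQ
    (hU.semiconjBy_gramRight (Nat.le_succ C.maxRange))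
  obtain ⟨κ, hκ⟩ := exists_eq_smul_inv_of_semiconjBy hirr.adjoin_eq_top hUQ
    (hU.semiconjBy_gramLeft le_rfl)
  obtain ⟨κ', hκ'⟩ := exists_eq_smul_inv_of_semiconjBy hirr.adjoin_eq_top hUQ
    (hU.semiconjBy_gramLeft (Nat.le_succ C.maxRange))
  have hν0 : 0 < ν := by
    have htrace := (hpos (C.maxRange + 1)).trace_pos
    rw [hν, hQ, Matrix.trace_smul, smul_eq_mul] at htrace
    exact (pos_iff_pos_of_mul_pos htrace).2 (hpos _).trace_pos
  have hκ0 : κ ≠ 0 := by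
    rintro rfl
    apply (hpos C.maxRange).trace_pos.ne'
    rw [← trace_gramLeft, hκ, zero_smul, Matrix.trace_zero]
  refine hasCanonicalForm_of_fixed (Q := Q) (μ := κ⁻¹ * κ') (hQ ▸ hpos _) hν0 ?_ ?_
  · rw [hQ, ← gramRight_succ, hν, hQ]
  · have hQinv : Q⁻¹.val = κ⁻¹ • T.gramLeft C.maxRange := by rw [hκ, inv_smul_smul₀ hκ0]
    rw [mul_smul, ← hκ', gramLeft_succ, hQinv]
    simp only [mul_smul_comm, smul_mul_assoc, Finset.smul_sum]

end IsVirtual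

end Tensor

section Virtual

variable {q m D : ℕ} {C : Code q m} {T : Tensor q D}

theorem Tensor.HasCanonicalForm.existsUnique_isVirtual (hform : T.HasCanonicalForm)
    (hT : T.Generates C) : ∃! U, T.IsVirtual C U := by
  obtain ⟨U, hU⟩ := Code.exists_isVirtual
    (Code.locallyFixed_of_isTraceFaithful hT hform.isTraceFaithful) hform.hasLeftInverse
    hform.hasRightInverse
  exact ⟨U, hU, fun _ hV => hV.unique hform.hasLeftInverse hU⟩

theorem Tensor.Generates.hasCanonicalForm_and_isIrreducible
    (hcomm : ∀ᶠ L : ℕ in atTop, ∀ [NeZero L], C.Commuting L) (hD : D ^ 2 = 2 ^ C.tMatrix.rank)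
    (hT : T.Generates C) : T.HasCanonicalForm ∧ ∀ U, T.IsVirtual C U → IsIrreducible U := by
  have hspan (n) (hn : 2 * C.maxRange ≤ n) : Submodule.span ℂ (Set.range (T.block n)) = ⊤ :=
    Code.span_block_eq_top hcomm hD hT hn
  have hl := hasLeftInverse_of_span_eq_top (hspan (2 * C.maxRange + 1) (Nat.le_succ _))
  have hr := hasRightInverse_of_span_eq_top (hspan (2 * C.maxRange + 1) (Nat.le_succ _))
  have hirr (U) (hU : T.IsVirtual C U) : IsIrreducible U := (hU.isCliffordRep hl).isIrreducible hD
  obtain ⟨U, hU⟩ := Code.exists_isVirtual (Code.locallyFixed_of_isTraceFaithful hT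
    (isTraceFaithful_of_span_eq_top (eventually_atTop.2 ⟨_, hspan⟩))) hl hr
  exact ⟨hU.hasCanonicalForm hr (hirr U hU), hirr⟩

end Virtual

end StabMPS

theorem mainTheorem5 {q m : ℕ} (C : StabMPS.Code q m)
    (hcomm : ∀ᶠ L : ℕ in Filter.atTop, ∀ [NeZero L], C.Commuting L)
    (huniq : ∀ᶠ L : ℕ in Filter.atTop, ∀ [NeZero L], C.HasUniqueGroundState L) :
    -- `𝐭` is antisymmetric with zero diagonal, and its rank over `𝔽₂` is even
    (C.tMatrix.transpose = -C.tMatrix ∧ (∀ c, C.tMatrix c c = 0) ∧ Even C.tMatrix.rank) ∧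
    -- the physical cut operators at one bond satisfy the relations encoded by `𝐭`
    (∀ (L : ℕ) [NeZero L], (∀ α, C.P α ≤ L) → ∀ r : ZMod L,
      StabMPS.CliffordRel C.tMatrix (fun c => C.leftOp L c r) ∧
      StabMPS.CliffordRel C.tMatrix (fun c => C.rightOp L c r)) ∧
    -- the virtual operators of an MPS of the ground state exist, are unique, and satisfy the same
    -- relations
    (∀ (D : ℕ) (T : StabMPS.Tensor q D), T.Generates C → T.HasCanonicalForm →
      (∃! U : C.Cut → (Matrix (Fin D) (Fin D) ℂ)ˣ, T.IsVirtual C U) ∧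
      ∀ U : C.Cut → (Matrix (Fin D) (Fin D) ℂ)ˣ, T.IsVirtual C U →
        StabMPS.IsCliffordRep C.tMatrix U) ∧
    -- the irreducible representations of these relations have dimension `2 ^ (rank 𝐭 / 2)`
    ((∃ U : C.Cut → (Matrix (Fin (2 ^ (C.tMatrix.rank / 2)))
        (Fin (2 ^ (C.tMatrix.rank / 2))) ℂ)ˣ,
        StabMPS.IsCliffordRep C.tMatrix U ∧ StabMPS.IsIrreducible U) ∧
      ∀ (D : ℕ) (U : C.Cut → (Matrix (Fin D) (Fin D) ℂ)ˣ),
        StabMPS.IsCliffordRep C.tMatrix U → StabMPS.IsIrreducible U →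
        D = 2 ^ (C.tMatrix.rank / 2)) ∧
    -- this is the minimal bond dimension: it is attained by a tensor independent of the system
    -- size, and no tensor of smaller bond dimension gives the ground state of a long chain
    (∃ T : StabMPS.Tensor q (2 ^ (C.tMatrix.rank / 2)), T.Generates C) ∧
    (∀ᶠ L : ℕ in Filter.atTop, ∀ [NeZero L], ∀ (D : ℕ) (T : StabMPS.Tensor q D),
      C.IsGroundState L (T.mps L) → 2 ^ (C.tMatrix.rank / 2) ≤ D) ∧
    -- every MPS of minimal bond dimension has a canonical form, and its virtual operators act
    -- irreducibly
    (∀ T : StabMPS.Tensor q (2 ^ (C.tMatrix.rank / 2)), T.Generates C →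
      T.HasCanonicalForm ∧
      ∀ U : C.Cut → (Matrix (Fin (2 ^ (C.tMatrix.rank / 2)))
        (Fin (2 ^ (C.tMatrix.rank / 2))) ℂ)ˣ, T.IsVirtual C U → StabMPS.IsIrreducible U) := by
  obtain ⟨D₀, U₀, hirr₀, hcl₀, T₀, hT₀⟩ := StabMPS.Code.exists_generates hcomm huniq
  obtain ⟨heven, rfl⟩ := StabMPS.even_and_eq_of_sq_eq_two_pow (hirr₀.sq_eq_two_pow_rank hcl₀)
  have hsq : (2 ^ (C.tMatrix.rank / 2)) ^ 2 = 2 ^ C.tMatrix.rank := hirr₀.sq_eq_two_pow_rank hcl₀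
  refine ⟨⟨C.tMatrix_transpose, C.tMatrix_self, heven⟩, fun L _ hP r => ?_, fun D T hT hform =>
    ⟨hform.existsUnique_isVirtual hT, fun U hU => hU.isCliffordRep hform.hasLeftInverse⟩,
    ⟨⟨U₀, hcl₀, hirr₀⟩, fun D U hU hirr => ?_⟩, ⟨T₀, hT₀⟩, ?_,
    fun T hT => hT.hasCanonicalForm_and_isIrreducible hcomm hsq⟩
  · have hL : C.maxRange ≤ L := Finset.sup_le fun α _ => hP α
    exact ⟨C.cliffordRel_leftOp hL r, StabMPS.Code.cliffordRel_rightOp hcomm hL r⟩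
  · exact (StabMPS.even_and_eq_of_sq_eq_two_pow (hirr.sq_eq_two_pow_rank hU)).2
  · filter_upwards [Filter.eventually_ge_atTop (3 * C.maxRange)] with L hL _ D T hT
    rw [← Nat.pow_le_pow_iff_left two_ne_zero, hsq]
    exact StabMPS.Code.two_pow_rank_le_sq_of_isGroundState hcomm hL hT
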